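/- Let $S^3$ be the group of unit quaternions and $G=S^3\times S^3$. Let $p,q$ be integers with $\gcd(p,q)=1$, let $H\subset G$ be a finite subgroup, suppose that $K=K_0\cdot H$ is a subgroup of $G$, where $K_0=\{(e^{ip\theta},e^{iq\theta}):\theta\in\mathbb R\}$, and put $k=|H\cap K_0|$. Let $M$ be a smooth $7$-manifold with a smooth $G$-action. Suppose that $K$ acts on $\mathbb R^2=\mathbb C$ by orthogonal transformations so that the isotropy group of $1$ is $H$ (thus the unit circle is $K/H$), that $D\subset\mathbb C$ is the open disc of radius $L>0$, and that $G\times_K D$ is identified by a $G$-equivariant diffeomorphism with an open subset of $M$. Let $c(t)=[e,t]$ for $0\le t<L$, so that $B=G\,c(0)=G/K$ is the singular orbit at $t=0$ and $c(t)$ has isotropy group $H$ for $0<t<L$. Let $X_1,X_2,X_3$ and $Y_1,Y_2,Y_3$ be the elements $i,j,k$ of the Lie algebras of the first and of the second factor of $G$, and let $X_i^*,Y_i^*$ be their action fields on $M$. Let $\langle\ ,\ \rangle$ be a smooth $G$-invariant Riemannian metric on $M\setminus B$ for which, for $0<t<L$, the vector $c'(t)$ has length $1$ and is orthogonal to the orbit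 $G\,c(t)$, and for which, among the inner products at $c(t)$ of the fields $X_i^*,Y_j^*$, only $$f_i(t)=\langle X_i^*,X_i^*\rangle_{c(t)},\qquad g_i(t)=\langle Y_i^*,Y_i^*\rangle_{c(t)},\qquad h_i(t)=\langle X_i^*,Y_i^*\rangle_{c(t)}\qquad(i=1,2,3)$$ may be non-zero. Extend these functions to $[0,L)$ by values at $t=0$ such that $$\sum_{i=1}^3\bigl(f_i(0)a_i^2+2h_i(0)a_ib_i+g_i(0)b_i^2\bigr)>0$$ for every $\sum_i (a_iX_i+b_iY_i)$ that is not a multiple of $pX_1+qY_1$. Then the metric is smooth, i.e. there is a smooth Riemannian metric on $M$ that agrees with $\langle\ ,\ \rangle$ on $M\setminus B$ and whose inner products of the action fields at $c(0)$ are $f_i(0),g_i(0),h_i(0)$ in the notation above, if and only if both of the following hold. (a) $f_1,g_1,h_1$ are even at $t=0$ (their even extensions to $(-L,L)$ are smooth), and at $t=0$ $$p\,f_1=-q\,h_1,\qquad q\,g_1=-p\,h_1,\qquad p^2f_1''+q^2g_1''+2pq\,h_1''=2k^2 .$$ (b) On $[0,L)$ $$f_2+f_3=\phi_3(t^2),\qquad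 f_2-f_3=t^{4|p|/k}\phi_4(t^2),$$ $$g_2+g_3=\phi_5(t^2),\qquad g_2-g_3=t^{4|q|/k}\phi_6(t^2),$$ $$h_2+h_3=t^{2|q-p|/k}\phi_7(t^2),\qquad h_2-h_3=t^{2|q+p|/k}\phi_8(t^2),$$ where the $\phi_i$ are smooth functions on $[0,L^2)$ and the right-hand side is read as $0$ if the exponent of $t$ is not an integer. -/

import Mathlib

open Set Bundle
open scoped Manifold Quaternion ContDiff Pointwise

noncomputable section

namespace CohomOne

instance quaternionFinrank : Fact (Module.finrank ℝ ℍ[ℝ] = 3 + 1) :=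
  ⟨Quaternion.finrank_eq_four⟩

/-- The group `S³` of unit quaternions, with Mathlib's group and manifold structures on the
unit sphere. -/
abbrev S3 : Type := Metric.sphere (0 : ℍ[ℝ]) 1

/-- The Lie group `G = S³ × S³`. -/
abbrev G : Type := S3 × S3

/-- The model with corners of `G`. -/
abbrev IG := (𝓡 3).prod (𝓡 3)

/-- The quaternion `e^{uθ} = cos θ + u sin θ`, where `u` is `i`, `j`, `k` for `l = 0, 1, 2`. -/
def expQuat (l : Fin 3) (θ : ℝ) : ℍ[ℝ] :=
  ⟨Real.cos θ, if l = 0 then Real.sin θ else 0, if l = 1 then Real.sin θ else 0,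
    if l = 2 then Real.sin θ else 0⟩

theorem norm_expQuat (l : Fin 3) (θ : ℝ) : ‖expQuat l θ‖ = 1 := by
  have h : Quaternion.normSq (expQuat l θ) = 1 := by
    rw [Quaternion.normSq_def']
    fin_cases l <;> simp [expQuat]
  rw [Quaternion.normSq_eq_norm_mul_self] at h
  nlinarith [norm_nonneg (expQuat l θ)]

/-- The one-parameter subgroup `θ ↦ e^{uθ}` of `S³`, where `u` is `i`, `j`, `k` for
`l = 0, 1, 2`. -/
def expUnit (l : Fin 3) (θ : ℝ) : S3 :=
  ⟨expQuat l θ, by rw [mem_sphere_zero_iff_norm]; exact norm_expQuat l θ⟩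

/-- The circle `{(e^{ipθ}, e^{iqθ})}` of slope `(p, q)` in `S³ × S³`. -/
def slopeCircle (p q : ℤ) : Set G :=
  range fun θ : ℝ => (expUnit 0 (p * θ), expUnit 0 (q * θ))

section Manifold

variable (M : Type*) [TopologicalSpace M] [ChartedSpace (EuclideanSpace ℝ (Fin 7)) M]

/-- A pointwise family of inner products on the tangent spaces of `M`, without any regularity in
the base point. -/
abbrev PointwiseMetric := RiemannianMetric fun x : M => TangentSpace (𝓡 7) x

/-- A smooth Riemannian metric on `M`. -/
abbrev SmoothMetric [IsManifold (𝓡 7) ∞ M] :=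
  ContMDiffRiemannianMetric (𝓡 7) ∞ (EuclideanSpace ℝ (Fin 7))
    fun x : M => TangentSpace (𝓡 7) x

variable {M}

/-- The family of inner products is smooth on the set `U`. -/
def PointwiseMetric.SmoothOn [IsManifold (𝓡 7) ∞ M] (m : PointwiseMetric M) (U : Set M) : Prop :=
  ContMDiffOn (𝓡 7)
    ((𝓡 7).prod 𝓘(ℝ, EuclideanSpace ℝ (Fin 7) →L[ℝ] EuclideanSpace ℝ (Fin 7) →L[ℝ] ℝ)) ∞
    (fun x : M => TotalSpace.mk'
      (EuclideanSpace ℝ (Fin 7) →L[ℝ] EuclideanSpace ℝ (Fin 7) →L[ℝ] ℝ) x (m.inner x)) U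

variable [MulAction G M]

/-- `G` acts by isometries on the `G`-invariant set `U`. -/
def PointwiseMetric.InvariantOn (m : PointwiseMetric M) (U : Set M) : Prop :=
  ∀ (a : G), ∀ x ∈ U, ∀ v w : TangentSpace (𝓡 7) x,
    m.inner (a • x) (mfderiv (𝓡 7) (𝓡 7) (fun y : M => a • y) x v)
      (mfderiv (𝓡 7) (𝓡 7) (fun y : M => a • y) x w) = m.inner x v w

/-- The action field `X_l^*` at `x`, where `X_0, X_1, X_2` are `i, j, k` in the first factor of
the Lie algebra of `S³ × S³`. -/
def fieldX (l : Fin 3) (x : M) : TangentSpace (𝓡 7) x :=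
  mfderiv 𝓘(ℝ, ℝ) (𝓡 7) (fun s : ℝ => ((expUnit l s, 1) : G) • x) 0 (1 : ℝ)

/-- The action field `Y_l^*` at `x`, where `Y_0, Y_1, Y_2` are `i, j, k` in the second factor of
the Lie algebra of `S³ × S³`. -/
def fieldY (l : Fin 3) (x : M) : TangentSpace (𝓡 7) x :=
  mfderiv 𝓘(ℝ, ℝ) (𝓡 7) (fun s : ℝ => ((1, expUnit l s) : G) • x) 0 (1 : ℝ)

variable (M) in
/-- A tube of radius `L` in the `G`-manifold `M` around an orbit with isotropy group `K`,
together with a line in a slice along which the isotropy group is `H`.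

`K` acts on the plane `ℂ = ℝ²` by orthogonal transformations, the isotropy group of `1` being
`H` (so that the unit circle is `K/H`), and the slice is a smooth map from the open disc `D` of
radius `L` to `M` for which `(a, z) ↦ a • slice z` induces a smooth bijection of `G ×_K D` onto
its image, with surjective differential. That is, it is a `G`-equivariant diffeomorphism of
`G ×_K D` onto an open neighbourhood of the orbit of `slice 0`. -/
structure Tube (H K : Subgroup G) (L : ℝ) where
  /-- the orthogonal action of `K` on the plane -/
  rep : K →* (ℂ ≃ₗᵢ[ℝ] ℂ)
  continuous_rep : ∀ z : ℂ, Continuous fun a : K => rep a z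
  rep_one_eq_iff : ∀ a : K, rep a 1 = 1 ↔ (a : G) ∈ H
  /-- the slice -/
  slice : ℂ → M
  contMDiffOn_slice : ContMDiffOn 𝓘(ℝ, ℂ) (𝓡 7) ∞ slice (Metric.ball 0 L)
  slice_rep : ∀ (a : K), ∀ z ∈ Metric.ball (0 : ℂ) L, slice (rep a z) = (a : G) • slice z
  eq_rep_of_smul_slice : ∀ (a : G), ∀ z ∈ Metric.ball (0 : ℂ) L, ∀ z' ∈ Metric.ball (0 : ℂ) L,
    a • slice z = slice z' → ∃ b : K, (b : G) = a ∧ rep b z = z'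
  transverse : ∀ z ∈ Metric.ball (0 : ℂ) L, ∀ v : TangentSpace (𝓡 7) (slice z),
    ∃ (α β : Fin 3 → ℝ) (w : ℂ),
      v = ∑ l, α l • fieldX l (slice z) + ∑ l, β l • fieldY l (slice z)
        + mfderiv 𝓘(ℝ, ℂ) (𝓡 7) slice z w

namespace Tube

variable {H K : Subgroup G} {L : ℝ} (T : Tube M H K L)

/-- The line `c(t)` in the slice, transverse to the orbits. -/
def curve (t : ℝ) : M := T.slice (t : ℂ)

/-- The velocity `c'(t)`. -/
def velocity (t : ℝ) : TangentSpace (𝓡 7) (T.curve t) :=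
  mfderiv 𝓘(ℝ, ℂ) (𝓡 7) T.slice (t : ℂ) (1 : ℂ)

/-- The orbit through `c(0)`. -/
def singularOrbit : Set M := MulAction.orbit G (T.curve 0)

/-- For `0 < t < L`, the line `c` has unit speed and is orthogonal to the orbits. -/
def IsNormal (m : PointwiseMetric M) : Prop :=
  ∀ t ∈ Ioo 0 L,
    m.inner (T.curve t) (T.velocity t) (T.velocity t) = 1 ∧
    ∀ l, m.inner (T.curve t) (T.velocity t) (fieldX l (T.curve t)) = 0 ∧
      m.inner (T.curve t) (T.velocity t) (fieldY l (T.curve t)) = 0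

/-- For `0 < t < L`, among the inner products of the fields `X_i^*, Y_j^*` at `c(t)` only those
with `i = j` may be non-zero. -/
def IsDiagonal (m : PointwiseMetric M) : Prop :=
  ∀ t ∈ Ioo 0 L, ∀ i j : Fin 3, i ≠ j →
    m.inner (T.curve t) (fieldX i (T.curve t)) (fieldX j (T.curve t)) = 0 ∧
    m.inner (T.curve t) (fieldX i (T.curve t)) (fieldY j (T.curve t)) = 0 ∧
    m.inner (T.curve t) (fieldY i (T.curve t)) (fieldY j (T.curve t)) = 0

/-- The inner products of the action fields at `c(t)`, for the bilinear form `B` on the tangent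
space there, are `f_i(t) = ⟨X_i^*, X_i^*⟩`, `g_i(t) = ⟨Y_i^*, Y_i^*⟩`,
`h_i(t) = ⟨X_i^*, Y_i^*⟩`. -/
def HasCoefficients (t : ℝ)
    (B : TangentSpace (𝓡 7) (T.curve t) →L[ℝ] TangentSpace (𝓡 7) (T.curve t) →L[ℝ] ℝ)
    (f g h : Fin 3 → ℝ → ℝ) : Prop :=
  ∀ i : Fin 3,
    f i t = B (fieldX i (T.curve t)) (fieldX i (T.curve t)) ∧
    g i t = B (fieldY i (T.curve t)) (fieldY i (T.curve t)) ∧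
    h i t = B (fieldX i (T.curve t)) (fieldY i (T.curve t))

end Tube

end Manifold

/-- A function on `[0, L)` is even (and smooth) at `0`: its even extension is smooth on
`(-L, L)`. -/
def IsEvenAtZero (L : ℝ) (u : ℝ → ℝ) : Prop :=
  ContDiffOn ℝ ∞ (fun t => u |t|) (Ioo (-L) L)

/-- The one-sided second derivative at `0` of a function on `[0, L)`. -/
def secondDerivAtZero (L : ℝ) (u : ℝ → ℝ) : ℝ :=
  iteratedDerivWithin 2 u (Ico 0 L) 0

/-- On `[0, L)` one has `u(t) = t^{m/k} φ(t²)` with `φ` smooth on `[0, L²)`, where the right side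
is read as `0` if `m/k` is not an integer. -/
def IsPowTimesEven (L : ℝ) (m k : ℕ) (u : ℝ → ℝ) : Prop :=
  ∃ φ : ℝ → ℝ, ContDiffOn ℝ ∞ φ (Ico 0 (L ^ 2)) ∧
    ∀ t ∈ Ico 0 L, u t = if k ∣ m then t ^ (m / k) * φ (t ^ 2) else 0

end CohomOne

end

namespace CohomOne

open Filter Topology

/-! ### Hadamard's lemma: dividing a smooth function by its variable -/

section Hadamard

variable {F : Type*} [NormedAddCommGroup F] [NormedSpace ℝ F]

/-! The metric is pulled back along `(a, z) ↦ a • slice z`. By invariance it is encoded by a family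
`P z` of bilinear forms on the Lie algebra of `G` plus the slice plane `ℂ`, indexed by the disc. The
circle `K₀` acts on these data: it fixes `X₁, Y₁`, rotates the two `jk`-planes by `2pθ` and `2qθ`,
and rotates the slice by `dθ` for an integer `d` with `|d| = k`, because the elements of `K₀` acting
trivially on the slice are those of `H ∩ K₀` (`exists_rep_slopeExp`).

At a real point `r > 0` the action field of `pX₁ + qY₁` is the slice vector `d i r`. Hence `P r` is
given explicitly by `f, g, h` (`polarForm`), and equivariance under `K₀` then gives `P` on the
punctured disc. Smoothness of the metric thus becomes the question when a family of forms known in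
polar coordinates is smooth at the origin.

For the `jk`-planes, a real bilinear form is split into its `a b̄` and `a b` parts. Their
coefficients `U` satisfy `U(e^{idθ}z) = e^{imθ}U(z)` with `m` one of `0, -4p, -4q, 2(q-p), -2(q+p)`.
Such a `U` is smooth exactly when on the real axis it is `t^{|m/d|}` times a smooth function of
`t²`, and it vanishes if `d ∤ m`. The two directions are `isPowTimesEven_of_equivariant`, which
rests on the theorems of Hadamard and Whitney, and `IsPowTimesEven.exists_equivariant`. This is
condition (b).

For `X₁, Y₁` and the slice plane, the relations at `t = 0` say that `pX₁ + qY₁` lies in the kernel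
of the limit form, since its field vanishes at the centre. The second-order relation says that the
rotational and the radial direction have the same limit length, so that no cone point arises. This
is condition (a).

Necessity follows because a smooth metric has a smooth `P` (`conditions_of_smooth_form`). For
sufficiency, (a) and (b) give a smooth `P` on the whole disc (`exists_smooth_form`). It yields local
extensions of the metric near the singular orbit through a smooth local section and a smooth frame.
These agree on the orbit because a continuous extension is unique, so they glue
(`exists_smooth_extension`). The result is definite because the limit form is positive off the line
of `pX₁ + qY₁`, which maps to zero in the tangent space (`coeffForm_add_pos`). -/

theorem mul_mem_Ioo_of_mem_Icc {L t s : ℝ} (ht : t ∈ Ioo (-L) L) (hs : s ∈ Icc (0 : ℝ) 1) :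
    t * s ∈ Ioo (-L) L := by
  obtain ⟨h1, h2⟩ := ht; obtain ⟨h3, h4⟩ := hs
  constructor <;> nlinarith

/-- Two continuous functions on an interval around `0` that agree off `0` agree at `0`. -/
theorem eq_at_zero_of_eq_off_zero {X : Type*} [TopologicalSpace X] [T2Space X] {L : ℝ} (hL : 0 < L)
    {u v : ℝ → X} (hu : ContinuousOn u (Ioo (-L) L)) (hv : ContinuousOn v (Ioo (-L) L))
    (h : ∀ t ∈ Ioo (-L) L, t ≠ 0 → u t = v t) : u 0 = v 0 := by
  have h0 : Ioo (-L) L ∈ 𝓝 (0 : ℝ) := Ioo_mem_nhds (by linarith) hL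
  have hu' := (hu.continuousAt h0).mono_left (nhdsWithin_le_nhds (s := {0}ᶜ))
  have hv' := (hv.continuousAt h0).mono_left (nhdsWithin_le_nhds (s := {0}ᶜ))
  refine tendsto_nhds_unique_of_eventuallyEq hu' hv' ?_
  filter_upwards [mem_nhdsWithin_of_mem_nhds h0, self_mem_nhdsWithin] with t ht ht0
  exact h t ht ht0

theorem continuousOn_comp_mul {L t : ℝ} {v : ℝ → F} (hv : ContinuousOn v (Ioo (-L) L))
    (ht : t ∈ Ioo (-L) L) (k : ℕ) : ContinuousOn (fun s : ℝ => s ^ k • v (t * s)) (Icc 0 1) := by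
  refine (continuous_pow k).continuousOn.smul (hv.comp (by fun_prop) fun s hs => ?_)
  exact mul_mem_Ioo_of_mem_Icc ht hs

/-- Differentiation under the integral sign. The chain rule contributes one more factor `s`, which
is why a general power `s ^ k` is carried along. -/
theorem hasDerivAt_integral_pow_smul_comp_mul {L t₀ : ℝ} {v v' : ℝ → F}
    (hv : ∀ t ∈ Ioo (-L) L, HasDerivAt v (v' t) t) (hv' : ContinuousOn v' (Ioo (-L) L))
    (ht₀ : t₀ ∈ Ioo (-L) L) (k : ℕ) :
    HasDerivAt (fun t => ∫ s in (0 : ℝ)..1, s ^ k • v (t * s))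
      (∫ s in (0 : ℝ)..1, s ^ (k + 1) • v' (t₀ * s)) t₀ := by
  have hvc : ContinuousOn v (Ioo (-L) L) := fun t ht => (hv t ht).continuousAt.continuousWithinAt
  -- On the compact interval `[-r, r]` the derivative is bounded by some `C`, and `C` dominates the
  -- integrand because `s ^ (k + 1) ≤ 1`.
  obtain ⟨r, hr, hrL⟩ : ∃ r, |t₀| < r ∧ r < L := exists_between (abs_lt.2 ht₀)
  have hsub : Icc (-r) r ⊆ Ioo (-L) L := fun x hx => ⟨by linarith [hx.1], by linarith [hx.2]⟩
  obtain ⟨C, hC⟩ := (isCompact_Icc (a := -r) (b := r)).exists_bound_of_continuousOn (hv'.mono hsub)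
  have hmeas : ∀ (w : ℝ → F), ContinuousOn w (Ioo (-L) L) → ∀ t ∈ Ioo (-L) L, ∀ j : ℕ,
      IntervalIntegrable (fun s : ℝ => s ^ j • w (t * s)) MeasureTheory.volume 0 1 := by
    intro w hw t ht j
    refine ContinuousOn.intervalIntegrable ?_
    rw [uIcc_of_le zero_le_one]
    exact continuousOn_comp_mul hw ht j
  refine (intervalIntegral.hasDerivAt_integral_of_dominated_loc_of_deriv_le
    (F := fun t s => s ^ k • v (t * s)) (F' := fun t s => s ^ (k + 1) • v' (t * s))
    (s := Ioo (-r) r) (bound := fun _ => C) (Ioo_mem_nhds (abs_lt.1 hr).1 (abs_lt.1 hr).2)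
    ?_ (hmeas v hvc t₀ ht₀ k) ?_ ?_ intervalIntegrable_const ?_).2
  · filter_upwards [Ioo_mem_nhds ht₀.1 ht₀.2] with t ht
    exact (intervalIntegrable_iff.1 (hmeas v hvc t ht k)).aestronglyMeasurable
  · exact (intervalIntegrable_iff.1 (hmeas v' hv' t₀ ht₀ (k + 1))).aestronglyMeasurable
  · refine Eventually.of_forall fun s hs t ht => ?_
    rw [uIoc_of_le zero_le_one] at hs
    have h1 := hC (t * s) (Ioo_subset_Icc_self (mul_mem_Ioo_of_mem_Icc ht ⟨hs.1.le, hs.2⟩))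
    rw [norm_smul, norm_pow, Real.norm_of_nonneg hs.1.le]
    calc s ^ (k + 1) * ‖v' (t * s)‖ ≤ 1 * C :=
          mul_le_mul (pow_le_one₀ hs.1.le hs.2) h1 (norm_nonneg _) zero_le_one
      _ = C := one_mul C
  · refine Eventually.of_forall fun s hs t ht => ?_
    rw [uIoc_of_le zero_le_one] at hs
    have h1 := hv (t * s) (hsub (Ioo_subset_Icc_self (mul_mem_Ioo_of_mem_Icc ht ⟨hs.1.le, hs.2⟩)))
    have h2 := (h1.scomp t ((hasDerivAt_id t).mul_const s)).const_smul (s ^ k)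
    simpa [smul_smul, pow_succ, Function.comp_def, Pi.smul_def] using h2

theorem contDiffOn_integral_pow_smul_comp_mul {L : ℝ} (n : ℕ) : ∀ (k : ℕ) {v : ℝ → F},
    ContDiffOn ℝ ∞ v (Ioo (-L) L) →
      ContDiffOn ℝ n (fun t => ∫ s in (0 : ℝ)..1, s ^ k • v (t * s)) (Ioo (-L) L) := by
  have key : ∀ {v : ℝ → F}, ContDiffOn ℝ ∞ v (Ioo (-L) L) →
      ∀ t ∈ Ioo (-L) L, HasDerivAt v (deriv v t) t := fun hv t ht =>
    ((hv.differentiableOn (by simp)).differentiableAt (isOpen_Ioo.mem_nhds ht)).hasDerivAt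
  have key' : ∀ {v : ℝ → F}, ContDiffOn ℝ ∞ v (Ioo (-L) L) →
      ContDiffOn ℝ ∞ (deriv v) (Ioo (-L) L) := fun hv =>
    ((contDiffOn_infty_iff_deriv_of_isOpen isOpen_Ioo).1 hv).2
  have hd : ∀ (k : ℕ) {v : ℝ → F}, ContDiffOn ℝ ∞ v (Ioo (-L) L) → ∀ t ∈ Ioo (-L) L, HasDerivAt
      (fun t => ∫ s in (0 : ℝ)..1, s ^ k • v (t * s))
      (∫ s in (0 : ℝ)..1, s ^ (k + 1) • deriv v (t * s)) t := fun k v hv t ht =>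
    hasDerivAt_integral_pow_smul_comp_mul (key hv) (key' hv).continuousOn ht k
  induction n with
  | zero =>
    intro k v hv
    refine contDiffOn_zero.2 fun t ht => (hd k hv t ht).continuousAt.continuousWithinAt
  | succ n ih =>
    intro k v hv
    push_cast
    refine (contDiffOn_succ_iff_deriv_of_isOpen isOpen_Ioo).2 ⟨fun t ht =>
      (hd k hv t ht).differentiableAt.differentiableWithinAt, by simp, ?_⟩
    exact (ih (k + 1) (key' hv)).congr fun t ht => (hd k hv t ht).deriv

variable [CompleteSpace F] in
/-- Hadamard's lemma: a smooth function that vanishes at `0` is divisible by `t`. -/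
theorem exists_eq_smul_of_eq_zero {L : ℝ} {u : ℝ → F} (hu : ContDiffOn ℝ ∞ u (Ioo (-L) L))
    (h0 : u 0 = 0) :
    ∃ w : ℝ → F, ContDiffOn ℝ ∞ w (Ioo (-L) L) ∧ ∀ t ∈ Ioo (-L) L, u t = t • w t := by
  have hu' : ContDiffOn ℝ ∞ (deriv u) (Ioo (-L) L) :=
    ((contDiffOn_infty_iff_deriv_of_isOpen isOpen_Ioo).1 hu).2
  refine ⟨fun t => ∫ s in (0 : ℝ)..1, s ^ 0 • deriv u (t * s),
    contDiffOn_infty.2 fun n => contDiffOn_integral_pow_smul_comp_mul n 0 hu', fun t ht => ?_⟩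
  have h1 : ∀ s ∈ uIcc (0 : ℝ) 1, HasDerivAt (fun s => u (t * s)) (t • deriv u (t * s)) s := by
    intro s hs
    rw [uIcc_of_le zero_le_one] at hs
    have hd : HasDerivAt u (deriv u (t * s)) (t * s) :=
      ((hu.differentiableOn (by simp)).differentiableAt
        (isOpen_Ioo.mem_nhds (mul_mem_Ioo_of_mem_Icc ht hs))).hasDerivAt
    simpa [Function.comp_def] using hd.scomp s ((hasDerivAt_id s).const_mul t)
  have h2 : IntervalIntegrable (fun s => t • deriv u (t * s)) MeasureTheory.volume 0 1 := by
    refine ContinuousOn.intervalIntegrable ?_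
    rw [uIcc_of_le zero_le_one]
    simpa [Pi.smul_def] using (continuousOn_comp_mul hu'.continuousOn ht 0).const_smul t
  have h3 := intervalIntegral.integral_eq_sub_of_hasDerivAt h1 h2
  simp only [mul_one, mul_zero, h0, sub_zero] at h3
  simp [← h3, intervalIntegral.integral_smul]

end Hadamard

/-! ### Even smooth functions as smooth functions of the square -/

section Whitney

/-- The derivative of an even function is odd, so it vanishes at `0` and Hadamard's lemma divides it
by `t`. The quotient is again even, which lets the next induction repeat. -/
theorem exists_deriv_eq_mul_of_even {L : ℝ} (hL : 0 < L) {w : ℝ → ℝ}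
    (hw : ContDiffOn ℝ ∞ w (Ioo (-L) L)) (he : ∀ t ∈ Ioo (-L) L, w (-t) = w t) :
    ∃ v : ℝ → ℝ, ContDiffOn ℝ ∞ v (Ioo (-L) L) ∧ (∀ t ∈ Ioo (-L) L, v (-t) = v t) ∧
      ∀ t ∈ Ioo (-L) L, HasDerivAt w (t * v t) t := by
  have hd : ∀ t ∈ Ioo (-L) L, HasDerivAt w (deriv w t) t := fun t ht =>
    ((hw.differentiableOn (by simp)).differentiableAt (isOpen_Ioo.mem_nhds ht)).hasDerivAt
  have hneg : ∀ t ∈ Ioo (-L) L, -t ∈ Ioo (-L) L := fun t ht =>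
    ⟨by linarith [ht.2], by linarith [ht.1]⟩
  have hodd : ∀ t ∈ Ioo (-L) L, deriv w (-t) = -deriv w t := by
    intro t ht
    have h1 : HasDerivAt (fun s => w (-s)) (-deriv w (-t)) t := by
      simpa [Function.comp_def] using (hd (-t) (hneg t ht)).scomp t (hasDerivAt_neg t)
    have h2 : (fun s => w (-s)) =ᶠ[𝓝 t] w := by
      filter_upwards [isOpen_Ioo.mem_nhds ht] with s hs using he s hs
    have h3 := (h1.congr_of_eventuallyEq h2.symm).unique (hd t ht)
    linarith
  have h0 : (0 : ℝ) ∈ Ioo (-L) L := ⟨by linarith, hL⟩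
  obtain ⟨v, hv, hwv⟩ := exists_eq_smul_of_eq_zero
    ((contDiffOn_infty_iff_deriv_of_isOpen isOpen_Ioo).1 hw).2
    (by have := hodd 0 h0; rw [neg_zero] at this; linarith)
  refine ⟨v, hv, fun t ht => ?_, fun t ht => ?_⟩
  · by_cases h : t = 0
    · simp [h]
    · have h1 := hwv (-t) (hneg t ht)
      rw [hodd t ht, hwv t ht] at h1
      simp only [smul_eq_mul] at h1
      have : t * (v (-t) - v t) = 0 := by linarith
      rcases mul_eq_zero.1 this with h2 | h2
      · exact absurd h2 h
      · linarith
  · have := hd t ht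
    rwa [hwv t ht, smul_eq_mul] at this

/-- With `w' = t v` the singular factor of the square root cancels: the derivative of `w(√s)` is
`v(√s) / 2`. Here `v` is again smooth and even, so the order of differentiability rises by
induction. -/
theorem contDiffOn_comp_sqrt {L : ℝ} (hL : 0 < L) (n : ℕ) : ∀ {w : ℝ → ℝ},
    ContDiffOn ℝ ∞ w (Ioo (-L) L) → (∀ t ∈ Ioo (-L) L, w (-t) = w t) →
      ContDiffOn ℝ n (fun s => w (√s)) (Ico 0 (L ^ 2)) := by
  have hmaps : ∀ s ∈ Ico 0 (L ^ 2), √s ∈ Ioo (-L) L := fun s hs =>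
    ⟨by linarith [Real.sqrt_nonneg s], (Real.sqrt_lt' hL).2 hs.2⟩
  have hcont : ∀ {w : ℝ → ℝ}, ContDiffOn ℝ ∞ w (Ioo (-L) L) →
      ContinuousOn (fun s => w (√s)) (Ico 0 (L ^ 2)) := fun hw =>
    hw.continuousOn.comp Real.continuous_sqrt.continuousOn hmaps
  induction n with
  | zero => exact fun hw _ => contDiffOn_zero.2 (hcont hw)
  | succ n ih =>
    intro w hw he
    obtain ⟨v, hv, hve, hwv⟩ := exists_deriv_eq_mul_of_even hL hw he
    have hpos : ∀ s ∈ Ioo 0 (L ^ 2), HasDerivAt (fun s => w (√s)) (v (√s) / 2) s := by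
      intro s hs
      have h1 := (hwv _ (hmaps s ⟨hs.1.le, hs.2⟩)).comp s (Real.hasDerivAt_sqrt hs.1.ne')
      have h2 : √s ≠ 0 := (Real.sqrt_pos.2 hs.1).ne'
      have h3 : v (√s) / 2 = √s * v (√s) * (1 / (2 * √s)) := by field_simp
      rw [h3]
      exact h1
    have hderiv : ∀ s ∈ Ico 0 (L ^ 2),
        HasDerivWithinAt (fun s => w (√s)) (v (√s) / 2) (Ico 0 (L ^ 2)) s := by
      intro s hs
      rcases hs.1.eq_or_lt with rfl | h
      -- At the endpoint the square root is not differentiable; the one-sided derivative is obtained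
      -- as the limit of the derivatives at interior points.
      · have hmem : Ioo 0 (L ^ 2) ∈ 𝓝[>] (0 : ℝ) := Ioo_mem_nhdsGT (by positivity)
        refine (hasDerivWithinAt_Ici_of_tendsto_deriv (s := Ioo 0 (L ^ 2))
          (fun s hs => (hpos s hs).differentiableAt.differentiableWithinAt)
          (((hcont hw) 0 hs).mono Ioo_subset_Ico_self) hmem ?_).mono Ico_subset_Ici_self
        have h1 : Tendsto (fun s => v (√s) / 2) (𝓝[>] 0) (𝓝 (v (√0) / 2)) :=
          ((((hcont hv) 0 hs).mono Ioo_subset_Ico_self).mono_of_mem_nhdsWithin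
            hmem).tendsto.div_const 2
        refine h1.congr' ?_
        filter_upwards [hmem] with s hs using (hpos s hs).deriv.symm
      · exact (hpos s ⟨h, hs.2⟩).hasDerivWithinAt
    push_cast
    have hud : UniqueDiffOn ℝ (Ico 0 (L ^ 2)) := uniqueDiffOn_Ico 0 (L ^ 2)
    refine (contDiffOn_succ_iff_derivWithin hud).2
      ⟨fun s hs => (hderiv s hs).differentiableWithinAt, by simp, ?_⟩
    exact ((ih hv hve).div_const 2).congr fun s hs => (hderiv s hs).derivWithin (hud s hs)

/-- Whitney's theorem: an even smooth function of `t` is a smooth function of `t²`. -/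
theorem exists_eq_comp_sq_of_even {L : ℝ} (hL : 0 < L) {w : ℝ → ℝ}
    (hw : ContDiffOn ℝ ∞ w (Ioo (-L) L)) (he : ∀ t ∈ Ioo (-L) L, w (-t) = w t) :
    ∃ φ : ℝ → ℝ, ContDiffOn ℝ ∞ φ (Ico 0 (L ^ 2)) ∧ ∀ t ∈ Ico 0 L, w t = φ (t ^ 2) :=
  ⟨fun s => w (√s), contDiffOn_infty.2 fun n => contDiffOn_comp_sqrt hL n hw he,
    fun t ht => by simp only [Real.sqrt_sq ht.1]⟩

end Whitney

/-! ### Equivariant functions on a disc and their restriction to the real axis -/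

open Complex in
/-- A function `U` on a disc is of weight `n` if `U(e^{iφ}z) = e^{inφ}U(z)`. -/
def HasWeight (L : ℝ) (n : ℤ) (U : ℂ → ℂ) : Prop :=
  ∀ φ : ℝ, ∀ z ∈ Metric.ball (0 : ℂ) L, U (exp (φ * I) * z) = exp (n * φ * I) * U z

theorem exp_mul_mem_ball {L : ℝ} (φ : ℝ) {z : ℂ} (hz : z ∈ Metric.ball (0 : ℂ) L) :
    Complex.exp (φ * Complex.I) * z ∈ Metric.ball (0 : ℂ) L := by
  rwa [mem_ball_zero_iff, norm_mul, Complex.norm_exp_ofReal_mul_I, one_mul, ← mem_ball_zero_iff]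

theorem ofReal_mem_ball {L t : ℝ} (ht : t ∈ Ioo (-L) L) : (t : ℂ) ∈ Metric.ball (0 : ℂ) L := by
  rw [mem_ball_zero_iff, Complex.norm_real, Real.norm_eq_abs]
  exact abs_lt.2 ht

theorem hasDerivAt_comp_ofReal {L : ℝ} {U : ℂ → ℂ} (hU : ContDiffOn ℝ ∞ U (Metric.ball 0 L))
    {t : ℝ} (ht : t ∈ Ioo (-L) L) : HasDerivAt (fun s : ℝ => U s) (fderiv ℝ U t 1) t := by
  have h1 : HasFDerivAt U (fderiv ℝ U t) (t : ℂ) :=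
    ((hU.differentiableOn (by simp)).differentiableAt
    (Metric.isOpen_ball.mem_nhds (ofReal_mem_ball ht))).hasFDerivAt
  simpa [Function.comp_def] using h1.comp_hasDerivAt t Complex.ofRealCLM.hasDerivAt

open Complex in
theorem HasWeight.fderiv_rotate {L : ℝ} {n : ℤ} {U : ℂ → ℂ}
    (hU : ContDiffOn ℝ ∞ U (Metric.ball 0 L))
    (h : HasWeight L n U) (φ : ℝ) {z : ℂ} (hz : z ∈ Metric.ball (0 : ℂ) L) (w : ℂ) :
    fderiv ℝ U (exp (φ * I) * z) (exp (φ * I) * w) = exp (n * φ * I) * fderiv ℝ U z w := by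
  have hd : ∀ z ∈ Metric.ball (0 : ℂ) L, HasFDerivAt U (fderiv ℝ U z) z := fun z hz =>
    ((hU.differentiableOn (by simp)).differentiableAt (Metric.isOpen_ball.mem_nhds hz)).hasFDerivAt
  have h1 := (hd _ (exp_mul_mem_ball φ hz)).comp z
    ((hasFDerivAt_id (𝕜 := ℝ) z).const_mul (exp (φ * I)))
  have h2 := (hd z hz).const_mul (exp (n * φ * I))
  have h3 : U ∘ (fun y => exp (φ * I) * id y) =ᶠ[𝓝 z] fun y => exp (n * φ * I) * U y := by
    filter_upwards [Metric.isOpen_ball.mem_nhds hz] with y hy using h φ y hy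
  have h4 := congrArg (fun A : ℂ →L[ℝ] ℂ => A w) (h1.unique (h2.congr_of_eventuallyEq h3))
  simpa using h4

open Complex in
/-- The derivative in the direction of a rotation. -/
theorem HasWeight.fderiv_mul_I {L : ℝ} {n : ℤ} {U : ℂ → ℂ}
    (hU : ContDiffOn ℝ ∞ U (Metric.ball 0 L)) (h : HasWeight L n U) {z : ℂ}
    (hz : z ∈ Metric.ball (0 : ℂ) L) : fderiv ℝ U z (I * z) = n * I * U z := by
  have h1 : HasFDerivAt U (fderiv ℝ U z) z :=
    ((hU.differentiableOn (by simp)).differentiableAt (Metric.isOpen_ball.mem_nhds hz)).hasFDerivAt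
  have hexp : ∀ c : ℂ, HasDerivAt (fun φ : ℝ => exp (c * φ * I)) (c * I) 0 := by
    intro c
    have := (((hasDerivAt_id (0 : ℝ)).ofReal_comp.const_mul c).mul_const I).cexp
    simpa using this
  have h2 : HasDerivAt (fun φ : ℝ => exp (φ * I) * z) (I * z) 0 := by
    simpa using (hexp 1).mul_const z
  have h3 : HasDerivAt (fun φ : ℝ => U (exp (φ * I) * z)) (fderiv ℝ U z (I * z)) 0 := by
    refine HasFDerivAt.comp_hasDerivAt (0 : ℝ) ?_ h2
    simpa using h1
  have h4 : HasDerivAt (fun φ : ℝ => exp (n * φ * I) * U z) (n * I * U z) 0 :=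
    (hexp n).mul_const (U z)
  refine h3.unique ?_
  simpa only [h _ z hz] using h4

theorem contDiffOn_fderiv_apply {L : ℝ} {U : ℂ → ℂ} (hU : ContDiffOn ℝ ∞ U (Metric.ball 0 L))
    (w : ℂ) : ContDiffOn ℝ ∞ (fun z => fderiv ℝ U z w) (Metric.ball 0 L) :=
  (hU.fderiv_of_isOpen Metric.isOpen_ball (by simp)).clm_apply contDiffOn_const

open Complex in
/-- The operator `∂ₓ - i∂_y` lowers the weight by one. -/
theorem HasWeight.fderiv_one_sub {L : ℝ} {n : ℤ} {U : ℂ → ℂ}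
    (hU : ContDiffOn ℝ ∞ U (Metric.ball 0 L)) (h : HasWeight L (n + 1) U) :
    HasWeight L n (fun z => fderiv ℝ U z 1 - I * fderiv ℝ U z I) := by
  intro φ z hz
  have h1 := h.fderiv_rotate hU φ hz
  set A := fderiv ℝ U (exp (φ * I) * z)
  set B := fderiv ℝ U z
  -- The derivatives are only real linear, so rotated vectors have to be expanded in the basis `1,
  -- i`.
  have hlin : ∀ (D : ℂ →L[ℝ] ℂ) (w : ℂ), D w = w.re * D 1 + w.im * D I := by
    intro D w
    conv_lhs => rw [← re_add_im w]
    rw [map_add, mul_comm (w.im : ℂ) I]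
    have e1 : (w.re : ℂ) = w.re • (1 : ℂ) := by simp
    have e2 : I * (w.im : ℂ) = w.im • I := by simp [mul_comm]
    rw [e1, e2, map_smul, map_smul]
    simp
  set c : ℂ := exp (φ * I) with hc
  have h2 := h1 1
  have h3 := h1 I
  rw [hlin A] at h2 h3
  have h4 : exp ((n + 1 : ℤ) * φ * I) = exp (n * φ * I) * c := by
    rw [hc, ← exp_add]; congr 1; push_cast; ring
  rw [h4] at h2 h3
  have hc0 : c ≠ 0 := exp_ne_zero _
  -- The left side is `A c - i A(c i)` for every real linear `A`; the rotation rule then applies to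
  -- each term.
  have h5 : c * (A 1 - I * A I) = c * (exp (n * φ * I) * (B 1 - I * B I)) := by
    have hre : c = c.re + c.im * I := (re_add_im c).symm
    have e : c * (A 1 - I * A I) = (((c * 1).re : ℂ) * A 1 + ((c * 1).im : ℂ) * A I)
        - I * (((c * I).re : ℂ) * A 1 + ((c * I).im : ℂ) * A I) := by
      conv_lhs => rw [hre]
      simp only [mul_one, mul_re, mul_im, I_re, I_im, mul_zero, zero_sub, add_zero,
        ofReal_neg]
      linear_combination (- (c.im : ℂ) * A I) * I_sq
    rw [e, h2, h3]; ring
  exact mul_left_cancel₀ hc0 h5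

open Complex in
/-- A smooth function of weight `n ≥ 0` on a disc is divisible by `tⁿ` on the real axis. -/
theorem HasWeight.exists_eq_pow_mul {L : ℝ} (hL : 0 < L) (n : ℕ) : ∀ {U : ℂ → ℂ},
    ContDiffOn ℝ ∞ U (Metric.ball 0 L) → HasWeight L n U →
      ∃ w : ℝ → ℂ, ContDiffOn ℝ ∞ w (Ioo (-L) L) ∧ ∀ t ∈ Ioo (-L) L, U t = t ^ n * w t := by
  induction n with
  | zero =>
    intro U hU _
    exact ⟨fun t => U t, hU.comp ofRealCLM.contDiff.contDiffOn fun t ht => ofReal_mem_ball ht,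
      by simp⟩
  | succ n ih =>
    intro U hU h
    have hVs : ContDiffOn ℝ ∞ (fun z => fderiv ℝ U z 1 - I * fderiv ℝ U z I)
        (Metric.ball 0 L) :=
      (contDiffOn_fderiv_apply hU 1).sub (contDiffOn_const.mul (contDiffOn_fderiv_apply hU I))
    obtain ⟨v, hv, hVv⟩ := ih hVs (HasWeight.fderiv_one_sub hU (by exact_mod_cast h))
    -- Factors of `t` are split off one at a time. The angular derivative is known from the weight,
    -- so on the real axis `(∂ₓ - i∂_y)U = tⁿ v` becomes, for `U = tʲ w`, the equation `(j + n + 1)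
    -- w + t w' = t^{n+1-j} v`. If `j ≤ n`, its value at `0` forces `w 0 = 0`, and Hadamard's lemma
    -- gives the next factor.
    have key : ∀ j ≤ n + 1, ∃ w : ℝ → ℂ, ContDiffOn ℝ ∞ w (Ioo (-L) L) ∧
        ∀ t ∈ Ioo (-L) L, U t = t ^ j * w t := by
      intro j
      induction j with
      | zero =>
        intro _
        exact ⟨fun t => U t, hU.comp ofRealCLM.contDiff.contDiffOn fun t ht => ofReal_mem_ball ht,
          by simp⟩
      | succ j ihj =>
        intro hj
        obtain ⟨w, hw, hUw⟩ := ihj (by omega)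
        have hdw : ∀ t ∈ Ioo (-L) L, HasDerivAt w (deriv w t) t := fun t ht =>
          ((hw.differentiableOn (by simp)).differentiableAt (isOpen_Ioo.mem_nhds ht)).hasDerivAt
        have hw' : ContDiffOn ℝ ∞ (deriv w) (Ioo (-L) L) :=
          ((contDiffOn_infty_iff_deriv_of_isOpen isOpen_Ioo).1 hw).2
        have heq : ∀ t ∈ Ioo (-L) L, t ≠ 0 →
            (j + n + 1 : ℂ) * w t + t * deriv w t = t ^ (n + 1 - j) * v t := by
          intro t ht ht0
          have htc : (t : ℂ) ≠ 0 := by exact_mod_cast ht0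
          have hx : fderiv ℝ U t 1 = j * t ^ (j - 1) * w t + t ^ j * deriv w t := by
            have h1 := ((hasDerivAt_id t).ofReal_comp.pow j).mul (hdw t ht)
            have h2 : (fun s : ℝ => U s) =ᶠ[𝓝 t] (fun s : ℝ => (s : ℂ) ^ j * w s) := by
              filter_upwards [isOpen_Ioo.mem_nhds ht] with s hs using hUw s hs
            have h3 := (hasDerivAt_comp_ofReal hU ht).unique (h1.congr_of_eventuallyEq h2)
            simpa using h3
          have hy : t * fderiv ℝ U t I = (n + 1) * I * U t := by
            have h1 := h.fderiv_mul_I hU (ofReal_mem_ball ht)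
            have h2 : I * (t : ℂ) = t • I := by simp [mul_comm]
            rw [h2, map_smul] at h1
            simpa using h1
          have h1 := hVv t ht
          have h2 : t ^ j * ((j + n + 1 : ℂ) * w t + t * deriv w t) = t ^ (n + 1) * v t := by
            have hjt : (j : ℂ) * t ^ (j - 1) * t = j * t ^ j := by
              rcases j with _ | j
              · simp
              · simp [pow_succ, mul_assoc]
            calc (t : ℂ) ^ j * ((j + n + 1 : ℂ) * w t + t * deriv w t)
                = t * fderiv ℝ U t 1 - I * (t * fderiv ℝ U t I) := by
                  rw [hy, hx, hUw t ht]
                  linear_combination (-w t) * hjt + ((n : ℂ) + 1) * (t ^ j * w t) * I_sq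
              _ = t ^ (n + 1) * v t := by rw [pow_succ]; linear_combination (t : ℂ) * h1
          have h3 : (t : ℂ) ^ (n + 1) = t ^ j * t ^ (n + 1 - j) := by
            rw [← pow_add]; congr 1; omega
          rw [h3, mul_assoc] at h2
          exact mul_left_cancel₀ (pow_ne_zero _ htc) h2
        have hc : Continuous fun t : ℝ => (t : ℂ) := continuous_ofReal
        have hw0 : w 0 = 0 := by
          have h1 := eq_at_zero_of_eq_off_zero hL
            (u := fun t : ℝ => (j + n + 1 : ℂ) * w t + t * deriv w t)
            (v := fun t : ℝ => (t : ℂ) ^ (n + 1 - j) * v t)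
            ((continuousOn_const.mul hw.continuousOn).add (hc.continuousOn.mul hw'.continuousOn))
            ((hc.pow _).continuousOn.mul hv.continuousOn) heq
          have h2 : (0 : ℂ) ^ (n + 1 - j) = 0 := zero_pow (by omega)
          simp only [ofReal_zero, zero_mul, add_zero, h2] at h1
          rcases mul_eq_zero.1 h1 with h3 | h3
          · exact absurd h3 (by exact_mod_cast (Nat.succ_ne_zero (j + n)))
          · exact h3
        obtain ⟨w1, hw1, hww1⟩ := exists_eq_smul_of_eq_zero hw hw0
        refine ⟨w1, hw1, fun t ht => ?_⟩
        rw [hUw t ht, hww1 t ht, pow_succ, mul_assoc, real_smul]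
    exact key (n + 1) le_rfl

open Complex in
-- The given metric controls only the punctured disc; continuity along the real axis carries the
-- relation to the origin.
theorem hasWeight_of_ne_zero {L : ℝ} (hL : 0 < L) {n : ℤ} {U : ℂ → ℂ}
    (hU : ContinuousOn U (Metric.ball 0 L))
    (h : ∀ φ : ℝ, ∀ z ∈ Metric.ball (0 : ℂ) L, z ≠ 0 →
      U (exp (φ * I) * z) = exp (n * φ * I) * U z) : HasWeight L n U := by
  intro φ z hz
  by_cases hz0 : z = 0
  · have h1 := eq_at_zero_of_eq_off_zero hL (u := fun t : ℝ => U (exp (φ * I) * t))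
      (v := fun t : ℝ => exp (n * φ * I) * U t)
      (hU.comp (by fun_prop) fun t ht => exp_mul_mem_ball φ (ofReal_mem_ball ht))
      (continuousOn_const.mul (hU.comp (by fun_prop) fun t ht => ofReal_mem_ball ht))
      (fun t ht ht0 => h φ t (ofReal_mem_ball ht) (by exact_mod_cast ht0))
    simpa [hz0] using h1
  · exact h φ z hz hz0

open Complex in
theorem HasWeight.conj {L : ℝ} {n : ℤ} {U : ℂ → ℂ} (h : HasWeight L n U) :
    HasWeight L (-n) (fun z => (starRingEnd ℂ) (U z)) := by
  intro φ z hz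
  simp only [h φ z hz, map_mul, ← exp_conj, conj_ofReal, conj_I, map_intCast]
  congr 2
  push_cast; ring

open Complex in
/-- The restriction to the real axis of a smooth function on a disc that is multiplied by
`e^{imθ}` when its argument is rotated by `dθ`. -/
theorem isPowTimesEven_of_equivariant {L : ℝ} (hL : 0 < L) {m d : ℤ} (hd : d ≠ 0) {U : ℂ → ℂ}
    (hU : ContDiffOn ℝ ∞ U (Metric.ball 0 L))
    (h : ∀ θ : ℝ, ∀ z ∈ Metric.ball (0 : ℂ) L, z ≠ 0 →
      U (exp ((d * θ : ℝ) * I) * z) = exp (m * θ * I) * U z)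
    {u : ℝ → ℝ} (hu : ∀ t ∈ Ioo 0 L, U t = u t) (hu0 : u 0 = (U 0).re) :
    IsPowTimesEven L m.natAbs d.natAbs u := by
  have hdr : (d : ℝ) ≠ 0 := by exact_mod_cast hd
  have hdc : (d : ℂ) ≠ 0 := by exact_mod_cast hd
  have hre : ∀ t ∈ Ico 0 L, u t = (U t).re := by
    intro t ht
    rcases ht.1.eq_or_lt with rfl | h0
    · simpa using hu0
    · rw [hu t ⟨h0, ht.2⟩, ofReal_re]
  by_cases hdvd : d ∣ m
  · obtain ⟨n, rfl⟩ := hdvd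
    have hdvd' : d.natAbs ∣ (d * n).natAbs := by rw [Int.natAbs_mul]; exact dvd_mul_right _ _
    have hdiv : (d * n).natAbs / d.natAbs = n.natAbs := by
      rw [Int.natAbs_mul, Nat.mul_div_cancel_left _ (Int.natAbs_pos.2 hd)]
    have hw : HasWeight L n U := by
      refine hasWeight_of_ne_zero hL hU.continuousOn fun φ z hz hz0 => ?_
      have h1 := h (φ / d) z hz hz0
      rw [mul_div_cancel₀ _ hdr] at h1
      rw [h1]
      congr 2
      push_cast
      field_simp
    -- Conjugation reverses a negative weight and keeps the real part, which is all that `u` sees.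
    obtain ⟨V, hV, hVw, hVre⟩ : ∃ V : ℂ → ℂ, ContDiffOn ℝ ∞ V (Metric.ball 0 L) ∧
        HasWeight L (n.natAbs : ℤ) V ∧ ∀ z, (V z).re = (U z).re := by
      rcases Int.natAbs_eq n with hn | hn
      · exact ⟨U, hU, by rwa [← hn], fun _ => rfl⟩
      · refine ⟨fun z => (starRingEnd ℂ) (U z), conjCLE.contDiff.comp_contDiffOn hU, ?_,
          fun _ => by simp⟩
        have := hw.conj
        rwa [show -n = (n.natAbs : ℤ) by omega] at this
    obtain ⟨w, hws, hVeq⟩ := hVw.exists_eq_pow_mul hL n.natAbs hV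
    -- Rotation by `π` multiplies `V` by `(-1)^{|n|}`, the same sign that `t^{|n|}` acquires, so the
    -- quotient is even.
    have heven : ∀ t ∈ Ioo (-L) L, (w (-t)).re = (w t).re := by
      intro t ht
      by_cases ht0 : t = 0
      · simp [ht0]
      have h1 := hVw Real.pi t (ofReal_mem_ball ht)
      have h2 : exp (((n.natAbs : ℕ) : ℤ) * Real.pi * I) = (-1) ^ n.natAbs := by
        rw [← exp_pi_mul_I, ← exp_nat_mul, Int.cast_natCast]; congr 1; ring
      have h3 := hVeq (-t) ⟨by linarith [ht.2], by linarith [ht.1]⟩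
      rw [h2, exp_pi_mul_I, neg_one_mul, hVeq t ht] at h1
      push_cast at h3
      rw [h1, neg_pow (t : ℂ), mul_assoc] at h3
      have h4 := mul_left_cancel₀ (pow_ne_zero _ (neg_ne_zero.2 one_ne_zero)) h3
      rw [mul_left_cancel₀ (pow_ne_zero _ (by exact_mod_cast ht0)) h4]
    obtain ⟨φ, hφ, hwφ⟩ := exists_eq_comp_sq_of_even hL (w := fun t => (w t).re)
      (reCLM.contDiff.comp_contDiffOn hws) heven
    refine ⟨φ, hφ, fun t ht => ?_⟩
    rw [if_pos hdvd', hdiv, hre t ht, ← hVre, hVeq t ⟨by linarith [ht.1], ht.2⟩, ← hwφ t ht,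
      ← ofReal_pow, re_ofReal_mul]
  -- For `θ = 2π/d` the argument returns to itself while the value is multiplied by `e^{2πim/d}`,
  -- which is not `1` when `d ∤ m`.
  · have hz : ∀ t ∈ Ioo (-L) L, t ≠ 0 → U t = 0 := by
      intro t ht ht0
      have h1 := h (2 * Real.pi / d) t (ofReal_mem_ball ht) (by exact_mod_cast ht0)
      rw [mul_div_cancel₀ _ hdr] at h1
      push_cast at h1
      rw [exp_two_pi_mul_I, one_mul] at h1
      by_contra hne
      have h2 : exp (m * (2 * Real.pi / d) * I) = 1 :=
        mul_right_cancel₀ hne (by rw [one_mul]; exact h1.symm)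
      obtain ⟨j, hj⟩ := exp_eq_one_iff.1 h2
      apply hdvd
      refine ⟨j, ?_⟩
      have h3 : (m : ℂ) = d * j := by
        field_simp at hj
        have h4 : (2 * Real.pi * I : ℂ) ≠ 0 := two_pi_I_ne_zero
        apply mul_right_cancel₀ h4
        linear_combination (2 * (Real.pi : ℂ) * I) * hj
      exact_mod_cast h3
    have hz0 : U 0 = 0 := by
      have := eq_at_zero_of_eq_off_zero hL (u := fun t : ℝ => U t) (v := fun _ => 0)
        (hU.continuousOn.comp (by fun_prop) fun t ht => ofReal_mem_ball ht) continuousOn_const hz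
      simpa using this
    refine ⟨0, contDiffOn_const, fun t ht => ?_⟩
    have hdvd' : ¬ d.natAbs ∣ m.natAbs := by rwa [Int.natAbs_dvd_natAbs]
    rw [if_neg hdvd', hre t ht]
    by_cases ht0 : t = 0
    · simp [ht0, hz0]
    · rw [hz t ⟨by linarith [ht.1], ht.2⟩ ht0, zero_re]

theorem contDiffOn_comp_norm_sq {L : ℝ} {φ : ℝ → ℝ} (hφ : ContDiffOn ℝ ∞ φ (Ico 0 (L ^ 2))) :
    ContDiffOn ℝ ∞ (fun z : ℂ => φ (‖z‖ ^ 2)) (Metric.ball 0 L) := by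
  refine hφ.comp (contDiff_norm_sq ℝ).contDiffOn fun z hz => ⟨by positivity, ?_⟩
  rw [mem_ball_zero_iff] at hz
  gcongr

theorem norm_exp_mul_ofReal {r : ℝ} (hr : 0 ≤ r) (α : ℝ) :
    ‖Complex.exp (α * Complex.I) * r‖ = r := by
  rw [norm_mul, Complex.norm_exp_ofReal_mul_I, one_mul, Complex.norm_real, Real.norm_of_nonneg hr]

open Complex in
/-- The converse of `isPowTimesEven_of_equivariant`. -/
theorem IsPowTimesEven.exists_equivariant {L : ℝ} {m d : ℤ} (hd : d ≠ 0) {u : ℝ → ℝ}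
    (hu : IsPowTimesEven L m.natAbs d.natAbs u) :
    ∃ U : ℂ → ℂ, ContDiffOn ℝ ∞ U (Metric.ball 0 L) ∧
      ∀ r ∈ Ico 0 L, ∀ θ : ℝ, U (exp ((d * θ : ℝ) * I) * r) = exp (m * θ * I) * u r := by
  obtain ⟨φ, hφ, huφ⟩ := hu
  by_cases hdvd : d ∣ m
  · obtain ⟨n, rfl⟩ := hdvd
    have hdvd' : d.natAbs ∣ (d * n).natAbs := by rw [Int.natAbs_mul]; exact dvd_mul_right _ _
    have hdiv : (d * n).natAbs / d.natAbs = n.natAbs := by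
      rw [Int.natAbs_mul, Nat.mul_div_cancel_left _ (Int.natAbs_pos.2 hd)]
    simp only [hdiv, if_pos hdvd'] at huφ
    -- The extension is `z^{|n|} φ(|z|²)`, or its conjugate when `n` is negative.
    have hs : ContDiffOn ℝ ∞ (fun z : ℂ => z ^ n.natAbs * (φ (‖z‖ ^ 2) : ℂ)) (Metric.ball 0 L) :=
      (contDiff_id.pow _).contDiffOn.mul
        (ofRealCLM.contDiff.comp_contDiffOn (contDiffOn_comp_norm_sq hφ))
    have hV : ∀ r ∈ Ico 0 L, ∀ θ : ℝ, (exp ((d * θ : ℝ) * I) * r) ^ n.natAbs *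
        (φ (‖exp ((d * θ : ℝ) * I) * r‖ ^ 2) : ℂ) = exp (n.natAbs * (d * θ) * I) * u r := by
      intro r hr θ
      rw [norm_exp_mul_ofReal hr.1, huφ r hr, mul_pow, ← exp_nat_mul]
      push_cast
      rw [mul_assoc]
      congr 2
      ring
    rcases Int.natAbs_eq n with hn | hn
    · refine ⟨_, hs, fun r hr θ => ?_⟩
      rw [hV r hr θ]
      congr 2
      have : (n : ℂ) = n.natAbs := by conv_lhs => rw [hn, Int.cast_natCast]
      push_cast
      rw [this]; ring
    · refine ⟨_, conjCLE.contDiff.comp_contDiffOn hs, fun r hr θ => ?_⟩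
      simp only [Function.comp_apply, conjCLE_apply]
      rw [hV r hr θ, map_mul, ← exp_conj, conj_ofReal]
      congr 2
      have : (n : ℂ) = -n.natAbs := by conv_lhs => rw [hn, Int.cast_neg, Int.cast_natCast]
      rw [Int.cast_mul, this]
      simp only [map_mul, conj_I, map_natCast, map_intCast, conj_ofReal]
      ring
  · have hdvd' : ¬ d.natAbs ∣ m.natAbs := by rwa [Int.natAbs_dvd_natAbs]
    refine ⟨0, contDiffOn_const, fun r hr θ => ?_⟩
    simp [huφ r hr, hdvd']

/-! ### Even functions on a half-open interval and their second derivative -/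

section Even

variable {L : ℝ} {u : ℝ → ℝ}

theorem IsEvenAtZero.exists_eq_comp_sq (hL : 0 < L) (hu : IsEvenAtZero L u) :
    ∃ φ : ℝ → ℝ, ContDiffOn ℝ ∞ φ (Ico 0 (L ^ 2)) ∧ ∀ t ∈ Ico 0 L, u t = φ (t ^ 2) := by
  obtain ⟨φ, hφ, h⟩ := exists_eq_comp_sq_of_even hL hu (fun t _ => by simp only [abs_neg])
  exact ⟨φ, hφ, fun t ht => by rw [← h t ht, abs_of_nonneg ht.1]⟩

theorem IsEvenAtZero.add {v : ℝ → ℝ} (hu : IsEvenAtZero L u) (hv : IsEvenAtZero L v) :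
    IsEvenAtZero L (fun t => u t + v t) :=
  ContDiffOn.add hu hv

theorem IsEvenAtZero.const_mul (hu : IsEvenAtZero L u) (c : ℝ) :
    IsEvenAtZero L (fun t => c * u t) :=
  contDiffOn_const.mul hu

/-- The half-open interval has unique derivatives, so the one-sided derivative at the endpoint
equals the two-sided one of any smooth extension. -/
theorem iteratedDerivWithin_two_eq {U : ℝ → ℝ} (hL : 0 < L) (hU : ContDiffOn ℝ ∞ U (Ioo (-L) L))
    (h : ∀ t ∈ Ico 0 L, u t = U t) : secondDerivAtZero L u = deriv (deriv U) 0 := by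
  have h0 : (0 : ℝ) ∈ Ico 0 L := ⟨le_rfl, hL⟩
  have hUat : ContDiffAt ℝ 2 U 0 :=
    (hU.contDiffAt (Ioo_mem_nhds (by linarith) hL)).of_le (WithTop.coe_le_coe.2 le_top)
  rw [secondDerivAtZero, iteratedDerivWithin_congr h h0,
    iteratedDerivWithin_eq_iteratedDeriv (uniqueDiffOn_Ico 0 L) hUat h0, iteratedDeriv_succ,
    iteratedDeriv_one]

/-- The Taylor expansion of an even function. -/
theorem IsEvenAtZero.exists_eq_add_sq_mul (hL : 0 < L) (hu : IsEvenAtZero L u) :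
    ∃ v : ℝ → ℝ, IsEvenAtZero L v ∧ (∀ t ∈ Ico 0 L, u t = u 0 + t ^ 2 * v t) ∧
      secondDerivAtZero L u = 2 * v 0 := by
  have h0mem : (0 : ℝ) ∈ Ioo (-L) L := ⟨by linarith, hL⟩
  -- The first quotient is odd, hence vanishes at `0`, and a second division by `t` is possible.
  obtain ⟨w, hw, hwe⟩ := exists_eq_smul_of_eq_zero (u := fun t => u |t| - u 0)
    (ContDiffOn.sub hu contDiffOn_const) (by simp)
  have hwodd : ∀ t ∈ Ioo (-L) L, t ≠ 0 → w (-t) = -w t := by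
    intro t ht ht0
    have h1 := hwe t ht
    have h2 := hwe (-t) ⟨by linarith [ht.2], by linarith [ht.1]⟩
    simp only [abs_neg, smul_eq_mul] at h1 h2
    apply mul_left_cancel₀ ht0
    linarith
  have hw0 : w 0 = 0 := by
    have := eq_at_zero_of_eq_off_zero hL (u := fun t => w (-t)) (v := fun t => -w t)
      (hw.continuousOn.comp (by fun_prop) fun t ht => ⟨by linarith [ht.2], by linarith [ht.1]⟩)
      hw.continuousOn.neg hwodd
    simp only [neg_zero] at this
    linarith
  obtain ⟨v, hv, hve⟩ := exists_eq_smul_of_eq_zero hw hw0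
  have hvabs : ∀ t ∈ Ioo (-L) L, v |t| = v t := by
    intro t ht
    rcases abs_cases t with ⟨h, _⟩ | ⟨h, hlt⟩
    · rw [h]
    · rw [h]
      have h1 := hwodd t ht hlt.ne
      rw [hve t ht, hve (-t) ⟨by linarith [ht.2], by linarith [ht.1]⟩] at h1
      simp only [smul_eq_mul] at h1
      apply mul_left_cancel₀ hlt.ne
      linarith
  refine ⟨v, hv.congr hvabs, fun t ht => ?_, ?_⟩
  · have ht' : t ∈ Ioo (-L) L := ⟨by linarith [ht.1], ht.2⟩
    have h1 := hwe t ht'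
    rw [hve t ht'] at h1
    simp only [abs_of_nonneg ht.1, smul_eq_mul] at h1
    linarith
  · rw [iteratedDerivWithin_two_eq hL hu fun t ht => by rw [abs_of_nonneg ht.1]]
    have hd : ∀ t ∈ Ioo (-L) L, HasDerivAt (fun t => u |t|) (t * (2 * v t + t * deriv v t)) t := by
      intro t ht
      have hdv := ((hv.differentiableOn (by simp)).differentiableAt
        (isOpen_Ioo.mem_nhds ht)).hasDerivAt
      have h1 := (((hasDerivAt_id t).pow 2).mul hdv).const_add (u 0)
      refine (h1.congr_deriv ?_).congr_of_eventuallyEq ?_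
      · simp; ring
      · filter_upwards [isOpen_Ioo.mem_nhds ht] with s hs
        have h2 := hwe s hs
        rw [hve s hs] at h2
        simp only [smul_eq_mul] at h2
        simp only [id, Pi.mul_apply, Pi.pow_apply]
        linarith
    have hev : deriv (fun t => u |t|) =ᶠ[𝓝 0] fun t => t * (2 * v t + t * deriv v t) := by
      filter_upwards [isOpen_Ioo.mem_nhds h0mem] with t ht using (hd t ht).deriv
    rw [hev.deriv_eq]
    have hdv := ((hv.differentiableOn (by simp)).differentiableAt
      (isOpen_Ioo.mem_nhds h0mem)).hasDerivAt
    have hdv' : DifferentiableAt ℝ (deriv v) 0 :=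
      (((contDiffOn_infty_iff_deriv_of_isOpen isOpen_Ioo).1 hv).2.differentiableOn
        (by simp)).differentiableAt (isOpen_Ioo.mem_nhds h0mem)
    have h2 := (hasDerivAt_id (0 : ℝ)).mul
      ((hdv.const_mul 2).add ((hasDerivAt_id (0 : ℝ)).mul hdv'.hasDerivAt))
    exact h2.deriv.trans (by simp)

end Even

/-! ### One-parameter subgroups of the unit quaternions and the circle of slope `(p, q)` -/

section ExpUnit

@[simp] theorem expQuat_re (l : Fin 3) (θ : ℝ) : (expQuat l θ).re = Real.cos θ := rfl

@[simp] theorem expQuat_imI (l : Fin 3) (θ : ℝ) :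
    (expQuat l θ).imI = if l = 0 then Real.sin θ else 0 := rfl

@[simp] theorem expQuat_imJ (l : Fin 3) (θ : ℝ) :
    (expQuat l θ).imJ = if l = 1 then Real.sin θ else 0 := rfl

@[simp] theorem expQuat_imK (l : Fin 3) (θ : ℝ) :
    (expQuat l θ).imK = if l = 2 then Real.sin θ else 0 := rfl

theorem expQuat_add (l : Fin 3) (s t : ℝ) : expQuat l (s + t) = expQuat l s * expQuat l t := by
  ext <;> fin_cases l <;> simp [Real.cos_add, Real.sin_add] <;> ring

theorem expUnit_add (l : Fin 3) (s t : ℝ) : expUnit l (s + t) = expUnit l s * expUnit l t :=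
  Subtype.ext (expQuat_add l s t)

theorem expUnit_zero (l : Fin 3) : expUnit l 0 = 1 := by
  apply Subtype.ext
  change expQuat l 0 = 1
  ext <;> simp

/-- The imaginary unit `i`, `j` or `k`. -/
noncomputable def imUnit (l : Fin 3) : ℍ[ℝ] :=
  ⟨0, if l = 0 then 1 else 0, if l = 1 then 1 else 0, if l = 2 then 1 else 0⟩

@[simp] theorem imUnit_re (l : Fin 3) : (imUnit l).re = 0 := rfl

@[simp] theorem imUnit_imI (l : Fin 3) : (imUnit l).imI = if l = 0 then 1 else 0 := rfl

@[simp] theorem imUnit_imJ (l : Fin 3) : (imUnit l).imJ = if l = 1 then 1 else 0 := rfl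

@[simp] theorem imUnit_imK (l : Fin 3) : (imUnit l).imK = if l = 2 then 1 else 0 := rfl

theorem expQuat_eq (l : Fin 3) (θ : ℝ) :
    expQuat l θ = Real.cos θ • (1 : ℍ[ℝ]) + Real.sin θ • imUnit l := by
  ext <;> simp

theorem contDiff_expQuat (l : Fin 3) : ContDiff ℝ ∞ (expQuat l) := by
  rw [funext (expQuat_eq l)]
  exact (Real.contDiff_cos.smul contDiff_const).add (Real.contDiff_sin.smul contDiff_const)

theorem contMDiff_expUnit (l : Fin 3) : ContMDiff 𝓘(ℝ, ℝ) (𝓡 3) ∞ (expUnit l) :=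
  (contDiff_expQuat l).contMDiff.codRestrict_sphere _

theorem hasDerivAt_expQuat_zero (l : Fin 3) : HasDerivAt (expQuat l) (imUnit l) 0 := by
  rw [funext (expQuat_eq l)]
  have h := ((Real.hasDerivAt_cos 0).smul_const (1 : ℍ[ℝ])).add
    ((Real.hasDerivAt_sin 0).smul_const (imUnit l))
  exact h.congr_deriv (by simp)

theorem expUnit_eq_one_iff (l : Fin 3) (θ : ℝ) :
    expUnit l θ = 1 ↔ ∃ n : ℤ, θ = n * (2 * Real.pi) := by
  constructor
  · intro h
    have h1 : (expQuat l θ).re = (1 : ℍ[ℝ]).re := congrArg (fun x : S3 => (x : ℍ[ℝ]).re) h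
    have h2 : Real.cos θ = 1 := h1
    obtain ⟨n, hn⟩ := (Real.cos_eq_one_iff θ).1 h2
    exact ⟨n, hn.symm⟩
  · rintro ⟨n, rfl⟩
    apply Subtype.ext
    change expQuat l _ = 1
    have := Real.sin_int_mul_pi (n * 2)
    push_cast at this
    rw [expQuat_eq, Real.cos_int_mul_two_pi, ← mul_assoc, this]
    simp

end ExpUnit

section Slope

/-- The point `(e^{ipθ}, e^{iqθ})`. -/
noncomputable def slopeExp (p q : ℤ) (θ : ℝ) : G := (expUnit 0 (p * θ), expUnit 0 (q * θ))

theorem slopeExp_add (p q : ℤ) (s t : ℝ) :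
    slopeExp p q (s + t) = slopeExp p q s * slopeExp p q t := by
  simp [slopeExp, mul_add, expUnit_add]

theorem slopeExp_zero (p q : ℤ) : slopeExp p q 0 = 1 := by
  simp [slopeExp, expUnit_zero]

theorem continuous_slopeExp (p q : ℤ) : Continuous (slopeExp p q) :=
  ((contMDiff_expUnit 0).continuous.comp (continuous_const_mul _)).prodMk
    ((contMDiff_expUnit 0).continuous.comp (continuous_const_mul _))

/-- Bézout's identity `u p + v q = 1` recovers `θ` modulo `2π` from `pθ` and `qθ`. This is where
coprimality is needed. -/
theorem slopeExp_eq_one_iff {p q : ℤ} (hpq : IsCoprime p q) (θ : ℝ) :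
    slopeExp p q θ = 1 ↔ ∃ n : ℤ, θ = n * (2 * Real.pi) := by
  rw [slopeExp, Prod.mk_eq_one, expUnit_eq_one_iff, expUnit_eq_one_iff]
  constructor
  · rintro ⟨⟨a, ha⟩, ⟨b, hb⟩⟩
    obtain ⟨u, v, huv⟩ := hpq
    have huv' : (u : ℝ) * p + v * q = 1 := by exact_mod_cast huv
    refine ⟨u * a + v * b, ?_⟩
    push_cast
    linear_combination (-θ) * huv' + u * ha + v * hb
  · rintro ⟨n, rfl⟩
    exact ⟨⟨p * n, by push_cast; ring⟩, ⟨q * n, by push_cast; ring⟩⟩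

theorem slopeExp_eq_iff {p q : ℤ} (hpq : IsCoprime p q) (s t : ℝ) :
    slopeExp p q s = slopeExp p q t ↔ ∃ n : ℤ, s - t = n * (2 * Real.pi) := by
  rw [← slopeExp_eq_one_iff hpq, sub_eq_add_neg, slopeExp_add]
  have h : slopeExp p q t * slopeExp p q (-t) = 1 := by
    rw [← slopeExp_add, add_neg_cancel, slopeExp_zero]
  rw [eq_inv_of_mul_eq_one_right h, mul_inv_eq_one]

end Slope

/-! ### The rotation number of the circle acting on the slice -/

section Rotation

/-- A continuous homomorphism from `ℝ` to the multiplicative monoid of `ℂ` is an exponential. -/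
theorem exists_eq_exp_of_continuous_hom {u : ℝ → ℂ} (hc : Continuous u) (h0 : u 0 = 1)
    (hadd : ∀ s t, u (s + t) = u s * u t) : ∃ c : ℂ, ∀ t, u t = Complex.exp (t * c) := by
  set v : ℝ → ℂ := fun t => ∫ s in (0 : ℝ)..t, u s with hv
  have hdv : ∀ t, HasDerivAt v (u t) t := fun t =>
    intervalIntegral.integral_hasDerivAt_right (hc.intervalIntegrable _ _)
      hc.stronglyMeasurable.stronglyMeasurableAtFilter hc.continuousAt
  -- Integrating `u(t + s) = u(t) u(s)` over `[0, δ]` gives `u(t) v(δ) = v(t + δ) - v(t)`. Once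
  -- `v(δ) ≠ 0`, the continuous function `u` is differentiable.
  obtain ⟨δ, hδ⟩ : ∃ δ, v δ ≠ 0 := by
    by_contra! hne
    have h1 := hdv 0
    rw [show v = fun _ => 0 from funext hne, h0] at h1
    exact zero_ne_one ((hasDerivAt_const (0 : ℝ) (0 : ℂ)).unique h1)
  have hu : ∀ t, u t = (v (t + δ) - v t) / v δ := by
    intro t
    rw [eq_div_iff hδ]
    have h1 : u t * v δ = ∫ s in (0 : ℝ)..δ, u (t + s) := by
      simp only [hadd, intervalIntegral.integral_const_mul, hv]
    rw [h1, intervalIntegral.integral_comp_add_left, add_zero]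
    exact (intervalIntegral.integral_interval_sub_left (hc.intervalIntegrable _ _)
      (hc.intervalIntegrable _ _)).symm
  have hdiff : Differentiable ℝ u := by
    intro t
    have h1 : HasDerivAt (fun t => (v (t + δ) - v t) / v δ) ((u (t + δ) - u t) / v δ) t :=
      (((hdv (t + δ)).comp_add_const t δ).sub (hdv t)).div_const _
    rw [show u = fun t => (v (t + δ) - v t) / v δ from funext hu]
    exact h1.differentiableAt
  have hd : ∀ t, HasDerivAt u (u t * deriv u 0) t := by
    intro t
    have h1 : HasDerivAt (fun s => u t * u (s - t)) (u t * deriv u 0) t := by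
      refine HasDerivAt.const_mul (u t) ?_
      refine HasDerivAt.comp_sub_const t t ?_
      rw [sub_self]
      exact (hdiff 0).hasDerivAt
    refine h1.congr_of_eventuallyEq (Eventually.of_forall fun s => ?_)
    change u s = u t * u (s - t)
    rw [← hadd, add_sub_cancel]
  refine ⟨deriv u 0, fun t => ?_⟩
  have hg : ∀ t, HasDerivAt (fun t : ℝ => u t * Complex.exp (-(t * deriv u 0))) 0 t := by
    intro t
    have h1 : HasDerivAt (fun t : ℝ => Complex.exp (-(t * deriv u 0)))
        (Complex.exp (-(t * deriv u 0)) * (-(1 * deriv u 0))) t :=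
      (((hasDerivAt_id t).ofReal_comp.mul_const (deriv u 0)).neg).cexp
    refine ((hd t).mul h1).congr_deriv ?_
    ring
  have h2 := is_const_of_deriv_eq_zero (fun t => (hg t).differentiableAt)
    (fun t => (hg t).deriv) t 0
  simp only [h0, Complex.ofReal_zero, zero_mul, neg_zero, Complex.exp_zero, mul_one] at h2
  rw [Complex.exp_neg] at h2
  have := Complex.exp_ne_zero (t * deriv u 0)
  field_simp at h2
  exact h2

/-- A linear isometry of the plane is a rotation or a reflection, and the square of either is a
rotation. Every element of a one-parameter group is a square, so reflections are excluded without a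
connectedness argument. -/
theorem linearIsometryEquiv_mul_self_apply (f : ℂ ≃ₗᵢ[ℝ] ℂ) (z : ℂ) :
    (f * f) z = (f * f) 1 * z := by
  change f (f z) = f (f 1) * z
  obtain ⟨a, rfl | rfl⟩ := linear_isometry_complex f
  · simp [mul_assoc]
  · have ha : (a : ℂ) * (starRingEnd ℂ) a = 1 := by
      rw [Complex.mul_conj]; simp
    simp only [LinearIsometryEquiv.trans_apply, Complex.conjLIE_apply, rotation_apply, map_mul,
      map_one, mul_one, Complex.conj_conj]
    rw [← mul_assoc, ha]

/-- A continuous one-parameter group of orthogonal transformations of the plane of period `2π` is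
a group of rotations. -/
theorem exists_rotation_number {R : ℝ → (ℂ ≃ₗᵢ[ℝ] ℂ)} (h0 : R 0 = 1)
    (hadd : ∀ s t, R (s + t) = R s * R t) (hc : Continuous fun t => R t 1)
    (hper : R (2 * Real.pi) = 1) :
    ∃ d : ℤ, ∀ t z, R t z = Complex.exp ((d * t : ℝ) * Complex.I) * z := by
  have hrot : ∀ t z, R t z = R t 1 * z := by
    intro t z
    have h1 : R t = R (t / 2) * R (t / 2) := by rw [← hadd, add_halves]
    rw [h1]
    exact linearIsometryEquiv_mul_self_apply _ _
  obtain ⟨c, hcexp⟩ := exists_eq_exp_of_continuous_hom (u := fun t => R t 1) hc (by simp [h0])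
    (fun s t => by
      simp only [hadd]
      change R s (R t 1) = _
      rw [hrot s])
  have h1 := hcexp (2 * Real.pi)
  simp only [hper] at h1
  obtain ⟨d, hd⟩ := Complex.exp_eq_one_iff.1 h1.symm
  have h2 : c = d * Complex.I := by
    have h3 : ((2 * Real.pi : ℝ) : ℂ) ≠ 0 := by exact_mod_cast Real.two_pi_pos.ne'
    apply mul_left_cancel₀ h3
    rw [hd]; push_cast; ring
  refine ⟨d, fun t z => ?_⟩
  rw [hrot t z, hcexp t, h2]
  congr 2
  push_cast; ring

end Rotation

theorem slopeExp_mem {p q : ℤ} {H K : Subgroup G}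
    (hK : (K : Set G) = slopeCircle p q * (H : Set G)) (θ : ℝ) : slopeExp p q θ ∈ K := by
  have h : slopeExp p q θ * 1 ∈ (K : Set G) := by
    rw [hK]
    exact mul_mem_mul ⟨θ, rfl⟩ H.one_mem
  rwa [mul_one] at h

/-- An element of `K₀` lies in `H` exactly when its rotation fixes `1`, that is when `dθ ∈ 2πℤ`.
This has `|d|` solutions on the circle, which counts `H ∩ K₀`. -/
theorem exists_rep_slopeExp {p q : ℤ} (hpq : IsCoprime p q) {H K : Subgroup G}
    (hH : (H : Set G).Finite) (hK : (K : Set G) = slopeCircle p q * (H : Set G))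
    (rep : K →* (ℂ ≃ₗᵢ[ℝ] ℂ)) (hc : ∀ z : ℂ, Continuous fun a : K => rep a z)
    (hrep : ∀ a : K, rep a 1 = 1 ↔ (a : G) ∈ H) :
    ∃ d : ℤ, d ≠ 0 ∧ d.natAbs = ((H : Set G) ∩ slopeCircle p q).ncard ∧
      ∀ (θ : ℝ) (z : ℂ), rep ⟨slopeExp p q θ, slopeExp_mem hK θ⟩ z
        = Complex.exp ((d * θ : ℝ) * Complex.I) * z := by
  have hπ := Real.pi_pos
  obtain ⟨d, hd⟩ := exists_rotation_number
    (R := fun θ => rep ⟨slopeExp p q θ, slopeExp_mem hK θ⟩)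
    (by rw [← map_one rep]; congr 1; exact Subtype.ext (slopeExp_zero p q))
    (fun s t => by rw [← map_mul]; congr 1; exact Subtype.ext (slopeExp_add p q s t))
    ((hc 1).comp ((continuous_slopeExp p q).subtype_mk _))
    (by
      rw [← map_one rep]; congr 1
      exact Subtype.ext ((slopeExp_eq_one_iff hpq _).2 ⟨1, by simp⟩))
  have hmem : ∀ θ, slopeExp p q θ ∈ H ↔ ∃ n : ℤ, d * θ = n * (2 * Real.pi) := by
    intro θ
    rw [← hrep ⟨slopeExp p q θ, slopeExp_mem hK θ⟩, hd, mul_one, Complex.exp_eq_one_iff]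
    refine exists_congr fun n => ⟨fun h => ?_, fun h => ?_⟩
    · have h1 : ((d * θ : ℝ) : ℂ) = ((n * (2 * Real.pi) : ℝ) : ℂ) := by
        apply mul_right_cancel₀ Complex.I_ne_zero
        rw [h]; push_cast; ring
      exact_mod_cast h1
    · rw [h]; push_cast; ring
  have hinj : ∀ s ∈ Ico 0 (2 * Real.pi), ∀ t ∈ Ico 0 (2 * Real.pi),
      slopeExp p q s = slopeExp p q t → s = t := by
    intro s hs t ht hst
    obtain ⟨n, hn⟩ := (slopeExp_eq_iff hpq s t).1 hst
    have h1 : |(n : ℝ)| < 1 := by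
      rw [abs_lt]
      constructor <;> nlinarith [hs.1, hs.2, ht.1, ht.2]
    have h2 : n = 0 := by
      rw [← Int.abs_lt_one_iff]; exact_mod_cast h1
    rw [h2] at hn
    simp at hn
    linarith
  -- If `d = 0`, the whole infinite circle would lie in the finite group `H`.
  have hd0 : d ≠ 0 := by
    rintro rfl
    have h1 : slopeExp p q '' Ico 0 (2 * Real.pi) ⊆ H := by
      rintro _ ⟨θ, _, rfl⟩
      exact (hmem θ).2 ⟨0, by simp⟩
    exact (Ico_infinite (by positivity : (0 : ℝ) < 2 * Real.pi)).image
      (fun s hs t ht => hinj s hs t ht) (hH.subset h1)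
  refine ⟨d, hd0, ?_, hd⟩
  have hdr : (d : ℝ) ≠ 0 := by exact_mod_cast hd0
  set N := d.natAbs with hN
  have hN0 : 0 < N := Int.natAbs_pos.2 hd0
  have hNr : (0 : ℝ) < N := by exact_mod_cast hN0
  have hset : (H : Set G) ∩ slopeCircle p q
      = (fun j : ℕ => slopeExp p q (j * (2 * Real.pi) / N)) '' (Finset.range N : Set ℕ) := by
    ext a
    constructor
    · rintro ⟨ha, θ, rfl⟩
      obtain ⟨n, hn⟩ := (hmem θ).1 ha
      -- The sign of `d` is absorbed into the integer; its residue modulo `N` then indexes the point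
      -- on the circle.
      obtain ⟨n', hn'⟩ : ∃ n' : ℤ, N * θ = n' * (2 * Real.pi) := by
        rcases Int.natAbs_eq d with h | h
        · refine ⟨n, ?_⟩
          rw [← hn, h]; simp [hN]
        · refine ⟨-n, ?_⟩
          have : (d : ℝ) = -N := by rw [h]; simp [hN]
          push_cast
          rw [this] at hn
          linarith
      refine ⟨(n' % N).toNat, ?_, ?_⟩
      · have h1 := Int.emod_nonneg n' (by exact_mod_cast hN0.ne' : (N : ℤ) ≠ 0)
        have h2 := Int.emod_lt_of_pos n' (by exact_mod_cast hN0 : (0 : ℤ) < N)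
        simp only [Finset.coe_range, mem_Iio]
        omega
      · refine (slopeExp_eq_iff hpq _ θ).2 ⟨-(n' / N), ?_⟩
        have h1 := Int.emod_nonneg n' (by exact_mod_cast hN0.ne' : (N : ℤ) ≠ 0)
        have h2 : (((n' % N).toNat : ℕ) : ℝ) = ((n' % N : ℤ) : ℝ) := by
          rw [← Int.cast_natCast, Int.toNat_of_nonneg h1]
        have h3 : ((n' % N : ℤ) : ℝ) = n' - N * (n' / N : ℤ) := by
          rw [Int.emod_def]; push_cast; ring
        rw [h2, h3]
        push_cast
        field_simp
        linear_combination -hn'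
    · rintro ⟨j, _, rfl⟩
      refine ⟨(hmem _).2 ?_, ⟨_, rfl⟩⟩
      rcases Int.natAbs_eq d with h | h
      · refine ⟨j, ?_⟩
        have : (d : ℝ) = N := by rw [h]; simp [hN]
        rw [this]; push_cast; field_simp
      · refine ⟨-j, ?_⟩
        have : (d : ℝ) = -N := by rw [h]; simp [hN]
        rw [this]; push_cast; field_simp
  rw [hset, InjOn.ncard_image, ncard_coe_finset, Finset.card_range]
  intro i hi j hj hij
  have hmemI : ∀ i ∈ (Finset.range N : Set ℕ),
      (i * (2 * Real.pi) / N : ℝ) ∈ Ico 0 (2 * Real.pi) := by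
    intro i hi
    have hi' : (i : ℝ) < N := by
      simp only [Finset.coe_range, mem_Iio] at hi
      exact_mod_cast hi
    refine ⟨by positivity, ?_⟩
    rw [div_lt_iff₀ hNr]
    nlinarith
  have h1 := hinj _ (hmemI i hi) _ (hmemI j hj) hij
  field_simp at h1
  exact_mod_cast h1

/-! ### Derivatives and velocities with values in the model space -/

section ModelDerivative

variable {E H E' H' E'' H'' : Type*} [NormedAddCommGroup E] [NormedSpace ℝ E] [TopologicalSpace H]
  [NormedAddCommGroup E'] [NormedSpace ℝ E'] [TopologicalSpace H']
  [NormedAddCommGroup E''] [NormedSpace ℝ E''] [TopologicalSpace H'']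
  (I : ModelWithCorners ℝ E H) (I' : ModelWithCorners ℝ E' H') (I'' : ModelWithCorners ℝ E'' H'')
  {N N' N'' : Type*} [TopologicalSpace N] [ChartedSpace H N] [TopologicalSpace N']
  [ChartedSpace H' N'] [TopologicalSpace N''] [ChartedSpace H'' N'']

/-- The derivative of a map of manifolds, as a map of the model spaces. -/
noncomputable def modelDeriv (f : N → N') (x : N) : E →L[ℝ] E' := mfderiv I I' f x

/-- The velocity of a curve at time `0`, as an element of the model space. -/
noncomputable def initialVelocity (c : ℝ → N) : E := mfderiv 𝓘(ℝ, ℝ) I c 0 (1 : ℝ)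

variable {I I' I''}

theorem modelDeriv_comp_apply {f : N → N'} {g : N' → N''} {x : N} {y : N'}
    (hg : MDifferentiableAt I' I'' g y) (hf : MDifferentiableAt I I' f x) (hy : f x = y) (v : E) :
    modelDeriv I I'' (fun z => g (f z)) x v = modelDeriv I' I'' g y (modelDeriv I I' f x v) := by
  subst hy
  exact mfderiv_comp_apply x hg hf v

theorem initialVelocity_comp {c : ℝ → N} {g : N → N'} {y : N}
    (hg : MDifferentiableAt I I' g y) (hc : MDifferentiableAt 𝓘(ℝ, ℝ) I c 0) (hy : c 0 = y) :
    initialVelocity I' (fun s => g (c s)) = modelDeriv I I' g y (initialVelocity I c) :=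
  modelDeriv_comp_apply (I := 𝓘(ℝ, ℝ)) hg hc hy (1 : ℝ)

theorem initialVelocity_eq_of_hasDerivAt {c : ℝ → E} {v : E} (hc : HasDerivAt c v 0) :
    initialVelocity 𝓘(ℝ, E) c = v := by
  change mfderiv 𝓘(ℝ, ℝ) 𝓘(ℝ, E) c 0 (1 : ℝ) = v
  rw [mfderiv_eq_fderiv]
  exact hc.deriv

theorem initialVelocity_comp_of_hasDerivAt {c : ℝ → E'} {v : E'} (hc : HasDerivAt c v 0)
    {g : E' → N} {y : E'} (hg : MDifferentiableAt 𝓘(ℝ, E') I g y) (hy : c 0 = y) :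
    initialVelocity I (fun s => g (c s)) = modelDeriv 𝓘(ℝ, E') I g y v := by
  rw [initialVelocity_comp hg hc.differentiableAt.mdifferentiableAt hy,
    initialVelocity_eq_of_hasDerivAt hc]

end ModelDerivative

/-- The imaginary quaternion with given coordinates. -/
noncomputable def imVec (α : Fin 3 → ℝ) : ℍ[ℝ] := ∑ l, α l • imUnit l

theorem modelDeriv_coe_sphere_injective (v : S3) :
    Function.Injective (modelDeriv (𝓡 3) 𝓘(ℝ, ℍ[ℝ]) (fun x : S3 => (x : ℍ[ℝ])) v) :=
  injective_mvfderiv_subtypeVal_sphere v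

theorem modelDeriv_coe_initialVelocity {c : ℝ → S3} (hc : MDifferentiableAt 𝓘(ℝ, ℝ) (𝓡 3) c 0)
    (hc0 : c 0 = 1) {ξ : ℍ[ℝ]} (hξ : HasDerivAt (fun s => (c s : ℍ[ℝ])) ξ 0) :
    modelDeriv (𝓡 3) 𝓘(ℝ, ℍ[ℝ]) (fun x : S3 => (x : ℍ[ℝ])) 1 (initialVelocity (𝓡 3) c) = ξ := by
  have hF : MDifferentiableAt (𝓡 3) 𝓘(ℝ, ℍ[ℝ]) (fun x : S3 => (x : ℍ[ℝ])) 1 :=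
    (contMDiff_coe_sphere (m := ∞)).mdifferentiableAt (by simp)
  rw [← initialVelocity_comp hF hc hc0, initialVelocity_eq_of_hasDerivAt hξ]

section Manifold

variable {M : Type*} [TopologicalSpace M] [ChartedSpace (EuclideanSpace ℝ (Fin 7)) M]

/-- The derivative at `0` of a curve in `S³` through `1` with a given velocity. -/
theorem initialVelocity_sphere_curve {F : S3 → M} (hF : MDifferentiableAt (𝓡 3) (𝓡 7) F 1)
    {c : ℝ → S3} (hc : MDifferentiableAt 𝓘(ℝ, ℝ) (𝓡 3) c 0) (hc0 : c 0 = 1) {α : Fin 3 → ℝ}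
    (hα : HasDerivAt (fun s => (c s : ℍ[ℝ])) (imVec α) 0) :
    initialVelocity (𝓡 7) (fun s => F (c s))
      = ∑ l, α l • initialVelocity (𝓡 7) (fun s => F (expUnit l s)) := by
  have hexp : ∀ l, MDifferentiableAt 𝓘(ℝ, ℝ) (𝓡 3) (expUnit l) 0 := fun l =>
    (contMDiff_expUnit l).mdifferentiableAt (by simp)
  -- The inclusion of the sphere into the quaternions has injective derivative, so velocities can be
  -- compared in `ℍ`.
  have key : initialVelocity (𝓡 3) c = ∑ l, α l • initialVelocity (𝓡 3) (expUnit l) := by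
    apply modelDeriv_coe_sphere_injective (1 : S3)
    rw [modelDeriv_coe_initialVelocity hc hc0 hα, map_sum, imVec]
    refine Finset.sum_congr rfl fun l _ => ?_
    rw [map_smul, modelDeriv_coe_initialVelocity (hexp l) (expUnit_zero l)
      (hasDerivAt_expQuat_zero l)]
  rw [initialVelocity_comp hF hc hc0, key, map_sum]
  refine Finset.sum_congr rfl fun l _ => ?_
  rw [map_smul, initialVelocity_comp hF (hexp l) (expUnit_zero l)]

variable [MulAction G M]

/-- The action field of an element of the Lie algebra of `G`, with values in the model space. -/
noncomputable def actionField (α β : Fin 3 → ℝ) (x : M) : EuclideanSpace ℝ (Fin 7) :=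
  ∑ l, α l • initialVelocity (𝓡 7) (fun s => ((expUnit l s, 1) : G) • x) +
    ∑ l, β l • initialVelocity (𝓡 7) (fun s => ((1, expUnit l s) : G) • x)

variable [ContMDiffSMul IG (𝓡 7) ∞ G M]

theorem contMDiffAt_pair_smul {E H N : Type*} [NormedAddCommGroup E] [NormedSpace ℝ E]
    [TopologicalSpace H] {I : ModelWithCorners ℝ E H} [TopologicalSpace N] [ChartedSpace H N]
    {γ δ : N → S3} {ξ : N → M} {n : N} (hγ : ContMDiffAt I (𝓡 3) ∞ γ n)
    (hδ : ContMDiffAt I (𝓡 3) ∞ δ n) (hξ : ContMDiffAt I (𝓡 7) ∞ ξ n) :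
    ContMDiffAt I (𝓡 7) ∞ (fun y => ((γ y, δ y) : G) • ξ y) n :=
  ContMDiffAt.smul (I := IG) (hγ.prodMk hδ) hξ

/-- With an independent time for each of the three curves, the velocity is the derivative in
direction `(1, 1, 1)`, hence the sum of the three partial derivatives. -/
theorem initialVelocity_pair_smul {γ δ : ℝ → S3} {ξ : ℝ → M}
    (hγ : ContMDiffAt 𝓘(ℝ, ℝ) (𝓡 3) ∞ γ 0) (hδ : ContMDiffAt 𝓘(ℝ, ℝ) (𝓡 3) ∞ δ 0)
    (hξ : ContMDiffAt 𝓘(ℝ, ℝ) (𝓡 7) ∞ ξ 0) (hγ0 : γ 0 = 1) (hδ0 : δ 0 = 1) {α β : Fin 3 → ℝ}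
    (hα : HasDerivAt (fun s => (γ s : ℍ[ℝ])) (imVec α) 0)
    (hβ : HasDerivAt (fun s => (δ s : ℍ[ℝ])) (imVec β) 0) :
    initialVelocity (𝓡 7) (fun s => ((γ s, δ s) : G) • ξ s)
      = actionField α β (ξ 0) + initialVelocity (𝓡 7) ξ := by
  set f : ℝ × ℝ × ℝ → M := fun y => ((γ y.1, δ y.2.1) : G) • ξ y.2.2 with hf
  have hfs : ContMDiffAt 𝓘(ℝ, ℝ × ℝ × ℝ) (𝓡 7) ∞ f 0 := by
    refine contMDiffAt_pair_smul ?_ ?_ ?_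
    · exact ContMDiffAt.comp (0 : ℝ × ℝ × ℝ) hγ contDiff_fst.contMDiff.contMDiffAt
    · exact ContMDiffAt.comp (0 : ℝ × ℝ × ℝ) (g := δ) (f := fun y : ℝ × ℝ × ℝ => y.2.1) hδ
        (contDiff_fst.comp contDiff_snd).contMDiff.contMDiffAt
    · exact ContMDiffAt.comp (0 : ℝ × ℝ × ℝ) (g := ξ) (f := fun y : ℝ × ℝ × ℝ => y.2.2) hξ
        (contDiff_snd.comp contDiff_snd).contMDiff.contMDiffAt
  have hfd : MDifferentiableAt 𝓘(ℝ, ℝ × ℝ × ℝ) (𝓡 7) f 0 := hfs.mdifferentiableAt (by simp)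
  have hid := hasDerivAt_id (0 : ℝ)
  have hz := hasDerivAt_const (0 : ℝ) (0 : ℝ)
  have h : initialVelocity (𝓡 7) (fun s => f (s, s, s))
      = modelDeriv 𝓘(ℝ, ℝ × ℝ × ℝ) (𝓡 7) f 0 (1, 1, 1) := by
    have hc : HasDerivAt (fun s : ℝ => (s, s, s)) ((1 : ℝ), (1 : ℝ), (1 : ℝ)) 0 :=
      hid.prodMk (hid.prodMk hid)
    exact initialVelocity_comp_of_hasDerivAt hc hfd rfl
  have h1 : initialVelocity (𝓡 7) (fun s => ((γ s, δ 0) : G) • ξ 0)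
      = modelDeriv 𝓘(ℝ, ℝ × ℝ × ℝ) (𝓡 7) f 0 (1, 0, 0) :=
    initialVelocity_comp_of_hasDerivAt (g := f) (y := 0) (hid.prodMk (hz.prodMk hz)) hfd rfl
  have h2 : initialVelocity (𝓡 7) (fun s => ((γ 0, δ s) : G) • ξ 0)
      = modelDeriv 𝓘(ℝ, ℝ × ℝ × ℝ) (𝓡 7) f 0 (0, 1, 0) :=
    initialVelocity_comp_of_hasDerivAt (g := f) (y := 0) (hz.prodMk (hid.prodMk hz)) hfd rfl
  have h3 : initialVelocity (𝓡 7) (fun s => ((γ 0, δ 0) : G) • ξ s)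
      = modelDeriv 𝓘(ℝ, ℝ × ℝ × ℝ) (𝓡 7) f 0 (0, 0, 1) :=
    initialVelocity_comp_of_hasDerivAt (g := f) (y := 0) (hz.prodMk (hz.prodMk hid)) hfd rfl
  have hX : MDifferentiableAt (𝓡 3) (𝓡 7) (fun a : S3 => ((a, 1) : G) • ξ 0) 1 :=
    (contMDiffAt_pair_smul contMDiffAt_id contMDiffAt_const contMDiffAt_const).mdifferentiableAt
      (by simp)
  have hY : MDifferentiableAt (𝓡 3) (𝓡 7) (fun a : S3 => ((1, a) : G) • ξ 0) 1 :=
    (contMDiffAt_pair_smul contMDiffAt_const contMDiffAt_id contMDiffAt_const).mdifferentiableAt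
      (by simp)
  have e3 : (fun s => (((1 : S3), (1 : S3)) : G) • ξ s) = ξ := by
    funext s
    exact one_smul G (ξ s)
  rw [hγ0, hδ0, e3] at h3
  rw [hδ0, initialVelocity_sphere_curve hX (hγ.mdifferentiableAt (by simp)) hγ0 hα] at h1
  rw [hγ0, initialVelocity_sphere_curve hY (hδ.mdifferentiableAt (by simp)) hδ0 hβ] at h2
  have hsum : ((1 : ℝ), (1 : ℝ), (1 : ℝ)) = (1, 0, 0) + (0, 1, 0) + (0, 0, 1) := by simp
  refine Eq.trans h ?_
  rw [hsum, map_add, map_add, ← h1, ← h2, ← h3]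
  rfl

end Manifold

/-! ### Curves in `S³` with prescribed velocity and the adjoint action -/

section ExpProd

/-- The product of exponentials `e^{α₀i}e^{α₁j}e^{α₂k}`. -/
noncomputable def expProd (α : Fin 3 → ℝ) : S3 :=
  expUnit 0 (α 0) * expUnit 1 (α 1) * expUnit 2 (α 2)

theorem expProd_zero : expProd 0 = 1 := by
  simp [expProd, expUnit_zero]

theorem contMDiff_expProd : ContMDiff 𝓘(ℝ, Fin 3 → ℝ) (𝓡 3) ∞ expProd := by
  have h : ∀ l : Fin 3, ContDiff ℝ ∞ fun α : Fin 3 → ℝ => expQuat l (α l) := fun l =>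
    (contDiff_expQuat l).comp (contDiff_apply ℝ ℝ l)
  exact (((h 0).mul (h 1)).mul (h 2)).contMDiff.codRestrict_sphere fun α => (expProd α).2

/-- At the identity the product rule merely adds the three velocities. Only this first-order
behaviour is used, so a product of one-parameter subgroups can replace the exponential map. -/
theorem hasDerivAt_expProd_smul (α : Fin 3 → ℝ) :
    HasDerivAt (fun s : ℝ => (expProd (s • α) : ℍ[ℝ])) (imVec α) 0 := by
  have h : ∀ l : Fin 3, HasDerivAt (fun s : ℝ => expQuat l (s * α l)) (α l • imUnit l) 0 := by
    intro l
    have h1 : HasDerivAt (fun s : ℝ => s * α l) (α l) 0 := by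
      simpa using (hasDerivAt_id (0 : ℝ)).mul_const (α l)
    have h2 : HasDerivAt (expQuat l) (imUnit l) (0 * α l) := by
      rw [zero_mul]
      exact hasDerivAt_expQuat_zero l
    exact h2.scomp (0 : ℝ) h1
  have h0 : ∀ l : Fin 3, expQuat l 0 = 1 := fun l => congrArg Subtype.val (expUnit_zero l)
  refine (((h 0).mul (h 1)).mul (h 2)).congr_deriv ?_
  simp [h0, imVec, Fin.sum_univ_three]

theorem expUnit_neg_mul_self (l : Fin 3) (ψ : ℝ) : expUnit l (-ψ) * expUnit l ψ = 1 := by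
  rw [← expUnit_add, neg_add_cancel, expUnit_zero]

/-- Rotation of the last two coordinates. -/
noncomputable def rotVec (ψ : ℝ) (α : Fin 3 → ℝ) : Fin 3 → ℝ :=
  ![α 0, Real.cos ψ * α 1 - Real.sin ψ * α 2, Real.sin ψ * α 1 + Real.cos ψ * α 2]

@[simp] theorem imVec_re (α : Fin 3 → ℝ) : (imVec α).re = 0 := by
  simp [imVec, Fin.sum_univ_three]

@[simp] theorem imVec_imI (α : Fin 3 → ℝ) : (imVec α).imI = α 0 := by
  simp [imVec, Fin.sum_univ_three]

@[simp] theorem imVec_imJ (α : Fin 3 → ℝ) : (imVec α).imJ = α 1 := by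
  simp [imVec, Fin.sum_univ_three]

@[simp] theorem imVec_imK (α : Fin 3 → ℝ) : (imVec α).imK = α 2 := by
  simp [imVec, Fin.sum_univ_three]

/-- The adjoint action of `e^{iψ}` on the imaginary quaternions. -/
theorem expQuat_mul_imVec_mul (ψ : ℝ) (α : Fin 3 → ℝ) :
    expQuat 0 ψ * imVec α * expQuat 0 (-ψ) = imVec (rotVec (2 * ψ) α) := by
  have h := Real.sin_sq_add_cos_sq ψ
  ext
  · simp [rotVec]; ring
  · simp [rotVec]; linear_combination (α 0) * h
  · simp [rotVec, Real.cos_two_mul, Real.sin_two_mul]; linear_combination (-α 1) * h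
  · simp [rotVec, Real.cos_two_mul, Real.sin_two_mul]; linear_combination (-α 2) * h

theorem hasDerivAt_conj_expProd_smul (ψ : ℝ) (α : Fin 3 → ℝ) :
    HasDerivAt (fun s : ℝ => ((expUnit 0 ψ * expProd (s • α) * expUnit 0 (-ψ) : S3) : ℍ[ℝ]))
      (imVec (rotVec (2 * ψ) α)) 0 := by
  rw [← expQuat_mul_imVec_mul]
  exact ((hasDerivAt_expProd_smul α).const_mul (expQuat 0 ψ)).mul_const (expQuat 0 (-ψ))

theorem contMDiff_conj_expProd (ψ : ℝ) :
    ContMDiff 𝓘(ℝ, Fin 3 → ℝ) (𝓡 3) ∞ fun α => expUnit 0 ψ * expProd α * expUnit 0 (-ψ) := by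
  have h : ContDiff ℝ ∞ fun α : Fin 3 → ℝ => (expProd α : ℍ[ℝ]) :=
    ((contMDiff_coe_sphere (m := ∞)).comp contMDiff_expProd).contDiff
  exact ((contDiff_const.mul h).mul contDiff_const).contMDiff.codRestrict_sphere
    fun α => (expUnit 0 ψ * expProd α * expUnit 0 (-ψ) : S3).2

end ExpProd

/-! ### Smooth vector fields along the slice -/

section Manifold

variable {M : Type*} [TopologicalSpace M] [ChartedSpace (EuclideanSpace ℝ (Fin 7)) M]

/-- The tangent vector at `x` with given coordinates in the model space. -/
def toTangent (x : M) (v : EuclideanSpace ℝ (Fin 7)) : TangentBundle (𝓡 7) M := ⟨x, v⟩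

/-- The velocities at time `0` of a smooth family of curves form a smooth vector field along their
initial points. -/
theorem contMDiffAt_initialVelocity [IsManifold (𝓡 7) ∞ M] {E H N : Type*} [NormedAddCommGroup E]
    [NormedSpace ℝ E] [TopologicalSpace H] {J : ModelWithCorners ℝ E H} [TopologicalSpace N]
    [ChartedSpace H N] [IsManifold J 1 N] {F : N → ℝ → M} {n₀ : N}
    (hF : ContMDiffAt (J.prod 𝓘(ℝ, ℝ)) (𝓡 7) ∞ (Function.uncurry F) (n₀, 0)) :
    ContMDiffAt J ((𝓡 7).prod 𝓘(ℝ, EuclideanSpace ℝ (Fin 7))) ∞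
      (fun n => toTangent (F n 0) (initialVelocity (𝓡 7) (F n))) n₀ := by
  have : IsManifold (𝓡 7) 1 M := IsManifold.of_le (n := ∞) (by simp)
  have hbase : ContMDiffAt J (𝓡 7) ∞ (fun n => F n 0) n₀ :=
    ContMDiffAt.comp n₀ (g := Function.uncurry F) (f := fun n => (n, (0 : ℝ))) hF
      (contMDiffAt_id.prodMk contMDiffAt_const)
  rw [contMDiffAt_totalSpace]
  refine ⟨hbase, ?_⟩
  have h1 := (ContMDiffAt.mfderiv (m := ∞) F (fun _ => (0 : ℝ)) hF contMDiffAt_const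
    (by simp)).clm_apply (contMDiffAt_const (c := (1 : ℝ)))
  refine h1.congr_of_eventuallyEq ?_
  -- The smooth expression of `ContMDiffAt.mfderiv` agrees with the tangent bundle coordinates only
  -- where the base point stays in the domain of the trivialization.
  have hmem := hbase.continuousAt.preimage_mem_nhds
    ((trivializationAt (EuclideanSpace ℝ (Fin 7)) (TangentSpace (𝓡 7))
      (F n₀ 0)).open_baseSet.mem_nhds
      (mem_baseSet_trivializationAt _ _ _))
  filter_upwards [hmem] with n hn
  simp only [inTangentCoordinates, ContinuousLinearMap.inCoordinates,
    ContinuousLinearMap.comp_apply]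
  rw [Trivialization.continuousLinearMapAt_apply, Trivialization.coe_linearMapAt_of_mem _ hn,
    TangentBundle.symmL_model_space]
  rfl

variable [MulAction G M]

theorem actionField_add (α β α' β' : Fin 3 → ℝ) (x : M) :
    actionField (α + α') (β + β') x = actionField α β x + actionField α' β' x := by
  simp only [actionField, Pi.add_apply, add_smul, Finset.sum_add_distrib]
  abel

theorem actionField_smul (c : ℝ) (α β : Fin 3 → ℝ) (x : M) :
    actionField (c • α) (c • β) x = c • actionField α β x := by
  simp only [actionField, Pi.smul_apply, smul_eq_mul, mul_smul, Finset.smul_sum, smul_add]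

theorem actionField_single_left (l : Fin 3) (x : M) :
    actionField (Pi.single l 1) 0 x = fieldX l x := by
  simp [actionField, Pi.single_apply, ite_smul]
  rfl

theorem actionField_single_right (l : Fin 3) (x : M) :
    actionField 0 (Pi.single l 1) x = fieldY l x := by
  simp [actionField, Pi.single_apply, ite_smul]
  rfl

namespace Tube

variable {H K : Subgroup G} {L : ℝ} (T : Tube M H K L)

/-- The tangent vector at `slice z` given by an element of the Lie algebra of `G` and a vector
tangent to the slice. -/
noncomputable def vec (z : ℂ) :
    ((Fin 3 → ℝ) × (Fin 3 → ℝ) × ℂ) →ₗ[ℝ] EuclideanSpace ℝ (Fin 7) where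
  toFun v := actionField v.1 v.2.1 (T.slice z) + modelDeriv 𝓘(ℝ, ℂ) (𝓡 7) T.slice z v.2.2
  map_add' v v' := by
    simp only [Prod.fst_add, Prod.snd_add, actionField_add, map_add]
    abel
  map_smul' c v := by
    simp only [Prod.smul_fst, Prod.smul_snd, actionField_smul, map_smul, RingHom.id_apply, smul_add]

theorem vec_apply (z : ℂ) (α β : Fin 3 → ℝ) (w : ℂ) : T.vec z (α, β, w)
    = actionField α β (T.slice z) + modelDeriv 𝓘(ℝ, ℂ) (𝓡 7) T.slice z w := rfl

theorem contMDiffAt_slice {z : ℂ} (hz : z ∈ Metric.ball (0 : ℂ) L) :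
    ContMDiffAt 𝓘(ℝ, ℂ) (𝓡 7) ∞ T.slice z :=
  T.contMDiffOn_slice.contMDiffAt (Metric.isOpen_ball.mem_nhds hz)

theorem hasDerivAt_add_smul (z w : ℂ) : HasDerivAt (fun s : ℝ => z + s • w) w 0 := by
  simpa using ((hasDerivAt_id (0 : ℝ)).smul_const w).const_add z

/-- The standard curve with velocity `vec z v`. -/
noncomputable def stdCurve (v : (Fin 3 → ℝ) × (Fin 3 → ℝ) × ℂ) (z : ℂ) (s : ℝ) : M :=
  ((expProd (s • v.1), expProd (s • v.2.1)) : G) • T.slice (z + s • v.2.2)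

theorem stdCurve_zero (v : (Fin 3 → ℝ) × (Fin 3 → ℝ) × ℂ) (z : ℂ) :
    T.stdCurve v z 0 = T.slice z := by
  simp only [stdCurve, zero_smul, expProd_zero, add_zero]
  exact one_smul G _

theorem contMDiffAt_expProd_smul (α : Fin 3 → ℝ) (s : ℝ) :
    ContMDiffAt 𝓘(ℝ, ℝ) (𝓡 3) ∞ (fun s : ℝ => expProd (s • α)) s :=
  (contMDiff_expProd.comp (contDiff_id.smul contDiff_const).contMDiff).contMDiffAt

variable [ContMDiffSMul IG (𝓡 7) ∞ G M]

theorem initialVelocity_smul_slice {γ δ : ℝ → S3} {ζ : ℝ → ℂ} {z : ℂ}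
    (hz : z ∈ Metric.ball (0 : ℂ) L) (hγ : ContMDiffAt 𝓘(ℝ, ℝ) (𝓡 3) ∞ γ 0)
    (hδ : ContMDiffAt 𝓘(ℝ, ℝ) (𝓡 3) ∞ δ 0) (hζ : ContDiffAt ℝ ∞ ζ 0)
    (hγ0 : γ 0 = 1) (hδ0 : δ 0 = 1) (hζ0 : ζ 0 = z) {α β : Fin 3 → ℝ} {w : ℂ}
    (hα : HasDerivAt (fun s => (γ s : ℍ[ℝ])) (imVec α) 0)
    (hβ : HasDerivAt (fun s => (δ s : ℍ[ℝ])) (imVec β) 0) (hw : HasDerivAt ζ w 0) :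
    initialVelocity (𝓡 7) (fun s => ((γ s, δ s) : G) • T.slice (ζ s)) = T.vec z (α, β, w) := by
  have hs := T.contMDiffAt_slice hz
  have hc : ContMDiffAt 𝓘(ℝ, ℝ) (𝓡 7) ∞ (fun s => T.slice (ζ s)) 0 :=
    ContMDiffAt.comp_of_eq hs hζ.contMDiffAt hζ0
  rw [initialVelocity_pair_smul hγ hδ hc hγ0 hδ0 hα hβ, hζ0, vec_apply,
    initialVelocity_comp_of_hasDerivAt hw (hs.mdifferentiableAt (by simp)) hζ0]

theorem initialVelocity_stdCurve (v : (Fin 3 → ℝ) × (Fin 3 → ℝ) × ℂ) {z : ℂ}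
    (hz : z ∈ Metric.ball (0 : ℂ) L) : initialVelocity (𝓡 7) (T.stdCurve v z) = T.vec z v :=
  T.initialVelocity_smul_slice hz (contMDiffAt_expProd_smul _ _) (contMDiffAt_expProd_smul _ _)
    (contDiff_const.add (contDiff_id.smul contDiff_const)).contDiffAt
    (by simp [expProd_zero]) (by simp [expProd_zero]) (by simp)
    (hasDerivAt_expProd_smul _) (hasDerivAt_expProd_smul _) (hasDerivAt_add_smul _ _)

theorem contMDiffAt_stdCurve (v : (Fin 3 → ℝ) × (Fin 3 → ℝ) × ℂ) {z : ℂ}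
    (hz : z ∈ Metric.ball (0 : ℂ) L) :
    ContMDiffAt (𝓘(ℝ, ℂ).prod 𝓘(ℝ, ℝ)) (𝓡 7) ∞ (Function.uncurry (T.stdCurve v)) (z, 0) := by
  have h2 : ContMDiffAt (𝓘(ℝ, ℂ).prod 𝓘(ℝ, ℝ)) 𝓘(ℝ, ℝ) ∞ (Prod.snd : ℂ × ℝ → ℝ) (z, 0) :=
    contMDiffAt_snd
  have hG : ∀ α : Fin 3 → ℝ, ContMDiffAt (𝓘(ℝ, ℂ).prod 𝓘(ℝ, ℝ)) (𝓡 3) ∞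
      (fun y : ℂ × ℝ => expProd (y.2 • α)) (z, 0) := fun α =>
    ContMDiffAt.comp (z, (0 : ℝ)) (contMDiffAt_expProd_smul α 0) h2
  refine contMDiffAt_pair_smul (hG _) (hG _) ?_
  have hmap : ContDiffAt ℝ ∞ (fun y : ℂ × ℝ => y.1 + y.2 • v.2.2) (z, 0) :=
    (contDiff_fst.add (contDiff_snd.smul contDiff_const)).contDiffAt
  refine ContMDiffAt.comp_of_eq (y := z) (T.contMDiffAt_slice hz) ?_ (by simp)
  have h3 := hmap.contMDiffAt
  rw [modelWithCornersSelf_prod, ← chartedSpaceSelf_prod] at h3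
  exact h3

theorem contMDiffAt_vec [IsManifold (𝓡 7) ∞ M] (v : (Fin 3 → ℝ) × (Fin 3 → ℝ) × ℂ) {z : ℂ}
    (hz : z ∈ Metric.ball (0 : ℂ) L) :
    ContMDiffAt 𝓘(ℝ, ℂ) ((𝓡 7).prod 𝓘(ℝ, EuclideanSpace ℝ (Fin 7))) ∞
      (fun z => toTangent (T.slice z) (T.vec z v)) z := by
  refine (contMDiffAt_initialVelocity (T.contMDiffAt_stdCurve v hz)).congr_of_eventuallyEq ?_
  filter_upwards [Metric.isOpen_ball.mem_nhds hz] with y hy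
  rw [T.stdCurve_zero, T.initialVelocity_stdCurve v hy]

end Tube

end Manifold

/-! ### The pull-back of the metric to the slice and its equivariance -/

section Manifold

variable {M : Type*} [TopologicalSpace M] [ChartedSpace (EuclideanSpace ℝ (Fin 7)) M]

theorem pair_smul_smul {X : Type*} [MulAction G X] (a b : G) (x : X) : a • b • x = (a * b) • x :=
  smul_smul a b x

/-- A family of bilinear forms on the tangent spaces. -/
abbrev FormFamily (M : Type*) [TopologicalSpace M] [ChartedSpace (EuclideanSpace ℝ (Fin 7)) M] :=
  ∀ x : M, TangentSpace (𝓡 7) x →L[ℝ] TangentSpace (𝓡 7) x →L[ℝ] ℝ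

/-- The form at a point, as a form on the model space. -/
def FormFamily.eval (B : FormFamily M) (x : M) :
    EuclideanSpace ℝ (Fin 7) →L[ℝ] EuclideanSpace ℝ (Fin 7) →L[ℝ] ℝ := B x

/-- The family of forms is smooth at a point. -/
def FormFamily.SmoothAt [IsManifold (𝓡 7) ∞ M] (n : ℕ∞ω) (B : FormFamily M) (x : M) : Prop :=
  ContMDiffAt (𝓡 7)
    ((𝓡 7).prod 𝓘(ℝ, EuclideanSpace ℝ (Fin 7) →L[ℝ] EuclideanSpace ℝ (Fin 7) →L[ℝ] ℝ)) n
    (fun x : M => TotalSpace.mk'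
      (EuclideanSpace ℝ (Fin 7) →L[ℝ] EuclideanSpace ℝ (Fin 7) →L[ℝ] ℝ) x (B x)) x

theorem FormFamily.SmoothAt.eval_apply [IsManifold (𝓡 7) ∞ M] {n : ℕ∞ω} {B : FormFamily M}
    {E H N : Type*} [NormedAddCommGroup E] [NormedSpace ℝ E] [TopologicalSpace H]
    {J : ModelWithCorners ℝ E H} [TopologicalSpace N] [ChartedSpace H N] {b : N → M}
    {v w : N → EuclideanSpace ℝ (Fin 7)} {y : N} (hB : B.SmoothAt n (b y))
    (hv : ContMDiffAt J ((𝓡 7).prod 𝓘(ℝ, EuclideanSpace ℝ (Fin 7))) n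
      (fun y => toTangent (b y) (v y)) y)
    (hw : ContMDiffAt J ((𝓡 7).prod 𝓘(ℝ, EuclideanSpace ℝ (Fin 7))) n
      (fun y => toTangent (b y) (w y)) y) :
    ContMDiffAt J 𝓘(ℝ, ℝ) n (fun y => B.eval (b y) (v y) (w y)) y := by
  have hb : ContMDiffAt J (𝓡 7) n b y := (contMDiffAt_totalSpace.1 hv).1
  have h := ContMDiffAt.clm_bundle_apply₂ (F₁ := EuclideanSpace ℝ (Fin 7))
    (F₂ := EuclideanSpace ℝ (Fin 7)) (F₃ := ℝ) (E₁ := fun x : M => TangentSpace (𝓡 7) x)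
    (E₂ := fun x : M => TangentSpace (𝓡 7) x) (E₃ := Bundle.Trivial M ℝ) (b := b)
    (v := fun y => v y) (w := fun y => w y) (ψ := fun y => B (b y))
    (ContMDiffAt.comp y hB hb) hv hw
  exact (contMDiffAt_totalSpace.1 h).2

theorem FormFamily.eval_congr (B : FormFamily M) {x y : M} (h : x = y)
    (v w : EuclideanSpace ℝ (Fin 7)) : B.eval x v w = B.eval y v w := by
  rw [h]

theorem initialVelocity_congr {c c' : ℝ → M} (h : c =ᶠ[𝓝 0] c') :
    initialVelocity (𝓡 7) c = initialVelocity (𝓡 7) c' := by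
  have h1 := h.mfderiv_eq (I := 𝓘(ℝ, ℝ)) (I' := 𝓡 7)
  exact congrArg (fun A : ℝ →L[ℝ] EuclideanSpace ℝ (Fin 7) => A 1) h1

variable [MulAction G M]

/-- Invariance of a family of forms, in terms of the model space. -/
theorem PointwiseMetric.InvariantOn.eval {m : PointwiseMetric M} {U : Set M} (h : m.InvariantOn U)
    (a : G) {x : M} (hx : x ∈ U) (v w : EuclideanSpace ℝ (Fin 7)) :
    FormFamily.eval m.inner (a • x) (modelDeriv (𝓡 7) (𝓡 7) (fun y : M => a • y) x v)
      (modelDeriv (𝓡 7) (𝓡 7) (fun y : M => a • y) x w) = FormFamily.eval m.inner x v w :=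
  h a x hx v w

/-- The simultaneous action of `(e^{ipθ}, e^{iqθ})` on the Lie algebra of `G` and on the slice. -/
noncomputable def rotateVec (p q d : ℤ) (θ : ℝ) (v : (Fin 3 → ℝ) × (Fin 3 → ℝ) × ℂ) :
    (Fin 3 → ℝ) × (Fin 3 → ℝ) × ℂ :=
  (rotVec (2 * (p * θ)) v.1, rotVec (2 * (q * θ)) v.2.1,
    Complex.exp ((d * θ : ℝ) * Complex.I) * v.2.2)

theorem rotVec_neg_rotVec (ψ : ℝ) (α : Fin 3 → ℝ) : rotVec (-ψ) (rotVec ψ α) = α := by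
  have h := Real.sin_sq_add_cos_sq ψ
  ext i
  fin_cases i
  · simp [rotVec]
  · simp [rotVec]; linear_combination (α 1) * h
  · simp [rotVec]; linear_combination (α 2) * h

theorem rotVec_rotVec_neg (ψ : ℝ) (α : Fin 3 → ℝ) : rotVec ψ (rotVec (-ψ) α) = α := by
  simpa using rotVec_neg_rotVec (-ψ) α

theorem rotateVec_rotateVec_neg (p q d : ℤ) (θ : ℝ) (v : (Fin 3 → ℝ) × (Fin 3 → ℝ) × ℂ) :
    rotateVec p q d θ (rotateVec p q d (-θ) v) = v := by
  have h1 : ∀ n : ℤ, 2 * ((n : ℝ) * -θ) = -(2 * (n * θ)) := fun n => by ring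
  simp only [rotateVec, h1, rotVec_rotVec_neg]
  rw [← mul_assoc, ← Complex.exp_add]
  simp

namespace Tube

variable {H K : Subgroup G} {L : ℝ} (T : Tube M H K L)

/-- The group `(e^{ipθ}, e^{iqθ})` rotates the slice by the angle `dθ`. -/
def HasRotation (p q d : ℤ) : Prop :=
  ∀ θ : ℝ, ∀ z ∈ Metric.ball (0 : ℂ) L,
    T.slice (Complex.exp ((d * θ : ℝ) * Complex.I) * z) = slopeExp p q θ • T.slice z

/-- The pull-back of a family of forms by the map `G × D → M`. -/
noncomputable def form (B : FormFamily M) (z : ℂ) (v v' : (Fin 3 → ℝ) × (Fin 3 → ℝ) × ℂ) : ℝ :=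
  B.eval (T.slice z) (T.vec z v) (T.vec z v')

theorem form_add_left (B : FormFamily M) (z : ℂ) (u v w : (Fin 3 → ℝ) × (Fin 3 → ℝ) × ℂ) :
    T.form B z (u + v) w = T.form B z u w + T.form B z v w := by
  simp only [form, map_add, add_apply]

theorem form_smul_left (B : FormFamily M) (z : ℂ) (c : ℝ) (v w : (Fin 3 → ℝ) × (Fin 3 → ℝ) × ℂ) :
    T.form B z (c • v) w = c * T.form B z v w := by
  simp only [form, map_smul, smul_apply, smul_eq_mul]

theorem slice_mem_compl_singularOrbit {z : ℂ} (hz : z ∈ Metric.ball (0 : ℂ) L) (hz0 : z ≠ 0) :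
    T.slice z ∈ T.singularOrbitᶜ := by
  rintro ⟨a, ha⟩
  have h0 : (0 : ℂ) ∈ Metric.ball (0 : ℂ) L := by
    rw [mem_ball_zero_iff, norm_zero]
    exact (norm_nonneg z).trans_lt (mem_ball_zero_iff.1 hz)
  obtain ⟨b, -, hb⟩ := T.eq_rep_of_smul_slice a 0 h0 z hz (by simpa [curve] using ha)
  exact hz0 (by simpa using hb.symm)

theorem smul_mem_compl_singularOrbit (a : G) {x : M} (hx : x ∈ T.singularOrbitᶜ) :
    a • x ∈ T.singularOrbitᶜ := by
  intro h
  apply hx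
  have h1 := MulAction.mem_orbit_of_mem_orbit a⁻¹ h
  rwa [inv_smul_smul] at h1

theorem contDiffAt_form [ContMDiffSMul IG (𝓡 7) ∞ G M] [IsManifold (𝓡 7) ∞ M] {B : FormFamily M}
    {z : ℂ} (hz : z ∈ Metric.ball (0 : ℂ) L) (hB : B.SmoothAt ∞ (T.slice z))
    (v v' : (Fin 3 → ℝ) × (Fin 3 → ℝ) × ℂ) : ContDiffAt ℝ ∞ (fun z => T.form B z v v') z :=
  contMDiffAt_iff_contDiffAt.1
    (FormFamily.SmoothAt.eval_apply hB (T.contMDiffAt_vec v hz) (T.contMDiffAt_vec v' hz))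

variable [ContMDiffSMul IG (𝓡 7) ∞ G M] {T} {p q d : ℤ}

set_option synthInstance.maxHeartbeats 200000 in
-- For `a = slopeExp p q θ` one has `a (e · slice ζ) = (a e a⁻¹) · slice (e^{idθ} ζ)`. Taking
-- velocities turns the conjugation into the rotations of the `jk`-planes.
theorem HasRotation.vec_rotateVec (hrot : T.HasRotation p q d) (θ : ℝ) {z : ℂ}
    (hz : z ∈ Metric.ball (0 : ℂ) L) (v : (Fin 3 → ℝ) × (Fin 3 → ℝ) × ℂ) :
    T.vec (Complex.exp ((d * θ : ℝ) * Complex.I) * z) (rotateVec p q d θ v)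
      = modelDeriv (𝓡 7) (𝓡 7) (fun y : M => slopeExp p q θ • y) (T.slice z) (T.vec z v) := by
  set e := Complex.exp ((d * θ : ℝ) * Complex.I) with he
  have hconj : ∀ (ψ : ℝ) (α : Fin 3 → ℝ), ContMDiffAt 𝓘(ℝ, ℝ) (𝓡 3) ∞
      (fun s : ℝ => expUnit 0 ψ * expProd (s • α) * expUnit 0 (-ψ)) 0 := fun ψ α =>
    ((contMDiff_conj_expProd ψ).comp (contDiff_id.smul contDiff_const).contMDiff).contMDiffAt
  have hconj0 : ∀ ψ : ℝ, expUnit 0 ψ * 1 * expUnit 0 (-ψ) = 1 := fun ψ => by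
    rw [mul_one, ← expUnit_add, add_neg_cancel, expUnit_zero]
  have h1 := T.initialVelocity_smul_slice (exp_mul_mem_ball (d * θ) hz)
    (hconj (p * θ) v.1) (hconj (q * θ) v.2.1)
    (ζ := fun s : ℝ => e * (z + s • v.2.2))
    (contDiff_const.mul (contDiff_const.add (contDiff_id.smul contDiff_const))).contDiffAt
    (by simpa only [zero_smul, expProd_zero] using hconj0 _)
    (by simpa only [zero_smul, expProd_zero] using hconj0 _) (by simp [he])
    (hasDerivAt_conj_expProd_smul _ _) (hasDerivAt_conj_expProd_smul _ _)
    ((hasDerivAt_add_smul z v.2.2).const_mul e)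
  refine h1.symm.trans ?_
  have hsm : MDifferentiableAt (𝓡 7) (𝓡 7) (fun y : M => slopeExp p q θ • y) (T.slice z) :=
    (ContMDiffSMul.contMDiff_const_smul (I := IG) (n := ∞) _).mdifferentiableAt (by simp)
  have hstd : MDifferentiableAt 𝓘(ℝ, ℝ) (𝓡 7) (T.stdCurve v z) 0 := by
    have h2 : ContMDiffAt 𝓘(ℝ, ℝ) (𝓡 7) ∞ (T.stdCurve v z) 0 :=
      ContMDiffAt.comp (0 : ℝ) (g := Function.uncurry (T.stdCurve v)) (f := fun s => (z, s))
        (T.contMDiffAt_stdCurve v hz) (contMDiffAt_const.prodMk contMDiffAt_id)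
    exact h2.mdifferentiableAt (by simp)
  rw [← T.initialVelocity_stdCurve v hz, ← initialVelocity_comp hsm hstd (T.stdCurve_zero v z)]
  apply initialVelocity_congr
  have hcont : Continuous fun s : ℝ => z + s • v.2.2 := by fun_prop
  have hmem : ∀ᶠ s : ℝ in 𝓝 0, z + s • v.2.2 ∈ Metric.ball (0 : ℂ) L :=
    hcont.continuousAt.preimage_mem_nhds (Metric.isOpen_ball.mem_nhds (by simpa using hz))
  filter_upwards [hmem] with s hs
  rw [hrot θ _ hs, stdCurve, pair_smul_smul, pair_smul_smul]
  have hcomm : ∀ (ψ : ℝ) (x : S3), expUnit 0 ψ * x * expUnit 0 (-ψ) * expUnit 0 ψ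
      = expUnit 0 ψ * x := fun ψ x => by rw [mul_assoc, expUnit_neg_mul_self, mul_one]
  exact congrArg (· • T.slice (z + s • v.2.2)) (Prod.ext (hcomm _ _) (hcomm _ _))

/-- The derivative of the rotation of the slice. -/
theorem HasRotation.vec_slope (hrot : T.HasRotation p q d) {z : ℂ}
    (hz : z ∈ Metric.ball (0 : ℂ) L) :
    T.vec z (Pi.single 0 (p : ℝ), Pi.single 0 (q : ℝ), 0) = T.vec z (0, 0, d * Complex.I * z) := by
  have hexp : ∀ n : ℤ, (fun θ : ℝ => expUnit 0 (n * θ)) =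
      fun θ => expProd (θ • Pi.single 0 (n : ℝ)) := by
    intro n
    funext θ
    simp [expProd, expUnit_zero, mul_comm]
  have h1 := T.initialVelocity_smul_slice (γ := fun θ => expUnit 0 (p * θ))
    (δ := fun θ => expUnit 0 (q * θ)) (ζ := fun _ => z) (w := 0) hz
    (by rw [hexp]; exact contMDiffAt_expProd_smul _ _)
    (by rw [hexp]; exact contMDiffAt_expProd_smul _ _)
    contDiffAt_const (by simp [expUnit_zero]) (by simp [expUnit_zero]) rfl
    (by
      have := hasDerivAt_expProd_smul (Pi.single 0 (p : ℝ))
      simpa only [← congrFun (hexp p)] using this)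
    (by
      have := hasDerivAt_expProd_smul (Pi.single 0 (q : ℝ))
      simpa only [← congrFun (hexp q)] using this)
    (hasDerivAt_const _ _)
  have hdζ : HasDerivAt (fun θ : ℝ => Complex.exp ((d * θ : ℝ) * Complex.I) * z)
      (d * Complex.I * z) 0 := by
    have h2 : HasDerivAt (fun θ : ℝ => (d * θ : ℝ)) (d : ℝ) 0 := by
      simpa using (hasDerivAt_id (0 : ℝ)).const_mul (d : ℝ)
    have h3 := ((h2.ofReal_comp.mul_const Complex.I).cexp).mul_const z
    simpa using h3
  have hcζ : ContDiffAt ℝ ∞ (fun θ : ℝ => Complex.exp ((d * θ : ℝ) * Complex.I) * z) 0 := by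
    have h2 : ContDiff ℝ ∞ (fun θ : ℝ => ((d * θ : ℝ) : ℂ) * Complex.I) :=
      (Complex.ofRealCLM.contDiff.comp (contDiff_const.mul contDiff_id)).mul contDiff_const
    exact (h2.cexp.mul contDiff_const).contDiffAt
  have him0 : imVec 0 = 0 := by simp [imVec]
  have hconst : HasDerivAt (fun _ : ℝ => ((1 : S3) : ℍ[ℝ])) (imVec 0) 0 := by
    rw [him0]
    exact hasDerivAt_const _ _
  have h2 := T.initialVelocity_smul_slice (γ := fun _ => 1) (δ := fun _ => 1) hz
    contMDiffAt_const contMDiffAt_const hcζ rfl rfl (by simp) hconst hconst hdζ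
  -- Both vectors are velocities of one curve, obtained by moving the point with the group or by
  -- rotating it in the slice.
  rw [← h1, ← h2]
  congr 1
  funext θ
  rw [hrot θ z hz]
  exact (one_smul G _).symm

theorem HasRotation.form_rotateVec (hrot : T.HasRotation p q d) {m : PointwiseMetric M}
    (hinv : m.InvariantOn T.singularOrbitᶜ) (θ : ℝ) {z : ℂ} (hz : z ∈ Metric.ball (0 : ℂ) L)
    (hz0 : z ≠ 0) (v v' : (Fin 3 → ℝ) × (Fin 3 → ℝ) × ℂ) :
    T.form m.inner (Complex.exp ((d * θ : ℝ) * Complex.I) * z) (rotateVec p q d θ v)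
      (rotateVec p q d θ v') = T.form m.inner z v v' := by
  rw [form, hrot.vec_rotateVec θ hz, hrot.vec_rotateVec θ hz, FormFamily.eval_congr _ (hrot θ z hz),
    hinv.eval _ (T.slice_mem_compl_singularOrbit hz hz0)]
  rfl

end Tube

end Manifold

/-! ### The metric along the curve in terms of `f, g, h` -/

/-- The bilinear form with coefficients `F`, `G`, `H` on the Lie algebra of `G`. -/
def coeffForm (F G H : Fin 3 → ℝ) (α β α' β' : Fin 3 → ℝ) : ℝ :=
  ∑ i, (F i * (α i * α' i) + H i * (α i * β' i + β i * α' i) + G i * (β i * β' i))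

theorem bilin_eq_coeffForm {E : Type*} [NormedAddCommGroup E] [NormedSpace ℝ E]
    (B : E →L[ℝ] E →L[ℝ] ℝ) (hsymm : ∀ v w, B v w = B w v) {x y : Fin 3 → E} {n : E}
    {F G H : Fin 3 → ℝ} (hn : B n n = 1) (hnx : ∀ l, B n (x l) = 0) (hny : ∀ l, B n (y l) = 0)
    (hxx : ∀ i j, i ≠ j → B (x i) (x j) = 0) (hxy : ∀ i j, i ≠ j → B (x i) (y j) = 0)
    (hyy : ∀ i j, i ≠ j → B (y i) (y j) = 0) (hF : ∀ i, F i = B (x i) (x i))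
    (hG : ∀ i, G i = B (y i) (y i)) (hH : ∀ i, H i = B (x i) (y i)) (α β α' β' : Fin 3 → ℝ)
    (a a' : ℝ) :
    B (∑ l, α l • x l + ∑ l, β l • y l + a • n) (∑ l, α' l • x l + ∑ l, β' l • y l + a' • n)
      = coeffForm F G H α β α' β' + a * a' := by
  have hxx' : ∀ i j, B (x i) (x j) = if i = j then F i else 0 := fun i j => by
    split_ifs with h
    · rw [← h, hF]
    · exact hxx i j h
  have hyy' : ∀ i j, B (y i) (y j) = if i = j then G i else 0 := fun i j => by
    split_ifs with h
    · rw [← h, hG]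
    · exact hyy i j h
  have hxy' : ∀ i j, B (x i) (y j) = if i = j then H i else 0 := fun i j => by
    split_ifs with h
    · rw [← h, hH]
    · exact hxy i j h
  have hyx' : ∀ i j, B (y i) (x j) = if i = j then H i else 0 := fun i j => by
    rw [hsymm, hxy' j i]
    by_cases h : i = j
    · simp [h]
    · simp [h, Ne.symm h]
  have hxn : ∀ l, B (x l) n = 0 := fun l => by rw [hsymm, hnx]
  have hyn : ∀ l, B (y l) n = 0 := fun l => by rw [hsymm, hny]
  simp only [map_add, map_sum, map_smul, add_apply, sum_apply, smul_apply, smul_eq_mul, hxx',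
    hyy', hxy', hyx', hxn, hyn, hnx, hny, hn, mul_ite, mul_zero, Finset.sum_ite_eq',
    Finset.mem_univ, if_true, Finset.sum_const_zero, add_zero, zero_add, mul_one,
    coeffForm, Finset.sum_add_distrib, mul_add]
  simp only [Fin.sum_univ_three]
  ring

section Manifold

variable {M : Type*} [TopologicalSpace M] [ChartedSpace (EuclideanSpace ℝ (Fin 7)) M]
  [MulAction G M]

namespace Tube

variable {H K : Subgroup G} {L : ℝ} {T : Tube M H K L}

theorem form_ofReal {m : PointwiseMetric M} (hnormal : T.IsNormal m) (hdiag : T.IsDiagonal m)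
    {f g h : Fin 3 → ℝ → ℝ} {r : ℝ} (hr : r ∈ Ioo 0 L)
    (hfgh : T.HasCoefficients r (m.inner (T.curve r)) f g h) (α β α' β' : Fin 3 → ℝ) (a a' : ℝ) :
    T.form m.inner r (α, β, (a : ℂ)) (α', β', (a' : ℂ))
      = coeffForm (f · r) (g · r) (h · r) α β α' β' + a * a' := by
  have hvec : ∀ (α β : Fin 3 → ℝ) (a : ℝ), T.vec r (α, β, (a : ℂ))
      = ∑ l, α l • initialVelocity (𝓡 7) (fun s => ((expUnit l s, 1) : G) • T.slice r) +
        ∑ l, β l • initialVelocity (𝓡 7) (fun s => ((1, expUnit l s) : G) • T.slice r) +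
        a • modelDeriv 𝓘(ℝ, ℂ) (𝓡 7) T.slice r 1 := by
    intro α β a
    rw [vec_apply, actionField, ← map_smul]
    simp
  rw [form, hvec, hvec]
  obtain ⟨h1, h2⟩ := hnormal r hr
  have h3 := hdiag r hr
  exact bilin_eq_coeffForm (FormFamily.eval m.inner (T.slice r)) (m.symm (T.slice r)) h1
    (fun l => (h2 l).1) (fun l => (h2 l).2) (fun i j hij => (h3 i j hij).1)
    (fun i j hij => (h3 i j hij).2.1) (fun i j hij => (h3 i j hij).2.2) (fun i => (hfgh i).1)
    (fun i => (hfgh i).2.1) (fun i => (hfgh i).2.2) α β α' β' a a'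

variable [ContMDiffSMul IG (𝓡 7) ∞ G M] {p q d : ℤ}

/-- At `r > 0` the slice vector `i` equals the field of `pX₁ + qY₁` divided by `d r`. This trades
the imaginary part of `w`, on which nothing is assumed, for action fields with known inner products.
-/
theorem HasRotation.vec_ofReal (hrot : T.HasRotation p q d) (hd : d ≠ 0) {r : ℝ}
    (hr : r ∈ Ioo 0 L) (α β : Fin 3 → ℝ) (w : ℂ) : T.vec r (α, β, w)
      = T.vec r (α + (w.im / (d * r)) • Pi.single 0 (p : ℝ),
          β + (w.im / (d * r)) • Pi.single 0 (q : ℝ), (w.re : ℂ)) := by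
  have hr0 : (r : ℝ) ≠ 0 := hr.1.ne'
  have hd0 : (d : ℝ) ≠ 0 := by exact_mod_cast hd
  have hmem : (r : ℂ) ∈ Metric.ball (0 : ℂ) L := ofReal_mem_ball ⟨by linarith [hr.1, hr.2], hr.2⟩
  have e1 : ((α, β, w) : (Fin 3 → ℝ) × (Fin 3 → ℝ) × ℂ)
      = (α, β, (w.re : ℂ)) + (w.im / (d * r)) • ((0, 0, d * Complex.I * r) :
        (Fin 3 → ℝ) × (Fin 3 → ℝ) × ℂ) := by
    refine Prod.ext (by simp) (Prod.ext (by simp) ?_)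
    simp only [Prod.smul_mk, Prod.mk_add_mk, Complex.real_smul]
    have hr0' : (r : ℂ) ≠ 0 := by exact_mod_cast hr0
    have hd0' : (d : ℂ) ≠ 0 := by exact_mod_cast hd0
    conv_lhs => rw [← Complex.re_add_im w]
    push_cast
    field_simp
  have e2 : ((α + (w.im / (d * r)) • Pi.single 0 (p : ℝ),
      β + (w.im / (d * r)) • Pi.single 0 (q : ℝ), (w.re : ℂ)) : (Fin 3 → ℝ) × (Fin 3 → ℝ) × ℂ)
      = (α, β, (w.re : ℂ)) + (w.im / (d * r)) • ((Pi.single 0 (p : ℝ), Pi.single 0 (q : ℝ), 0) :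
        (Fin 3 → ℝ) × (Fin 3 → ℝ) × ℂ) := by
    refine Prod.ext (by simp) (Prod.ext (by simp) (by simp))
  rw [e1, e2, map_add, map_add, map_smul, map_smul, hrot.vec_slope hmem]

end Tube

end Manifold

/-- The form on the Lie algebra of `G` plus the tangent plane of the slice, at a point `r > 0` of
the slice. -/
noncomputable def polarForm (p q d : ℤ) (f g h : Fin 3 → ℝ → ℝ) (r : ℝ)
    (v v' : (Fin 3 → ℝ) × (Fin 3 → ℝ) × ℂ) : ℝ :=
  coeffForm (f · r) (g · r) (h · r) (v.1 + (v.2.2.im / (d * r)) • Pi.single 0 (p : ℝ))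
    (v.2.1 + (v.2.2.im / (d * r)) • Pi.single 0 (q : ℝ))
    (v'.1 + (v'.2.2.im / (d * r)) • Pi.single 0 (p : ℝ))
    (v'.2.1 + (v'.2.2.im / (d * r)) • Pi.single 0 (q : ℝ)) + v.2.2.re * v'.2.2.re

namespace Tube

variable {M : Type*} [TopologicalSpace M] [ChartedSpace (EuclideanSpace ℝ (Fin 7)) M]
  [MulAction G M] [ContMDiffSMul IG (𝓡 7) ∞ G M] {H K : Subgroup G} {L : ℝ} {T : Tube M H K L}
  {p q d : ℤ}

theorem HasRotation.form_eq_polarForm (hrot : T.HasRotation p q d) (hd : d ≠ 0)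
    {m : PointwiseMetric M} (hnormal : T.IsNormal m) (hdiag : T.IsDiagonal m)
    {f g h : Fin 3 → ℝ → ℝ} {r : ℝ} (hr : r ∈ Ioo 0 L)
    (hfgh : T.HasCoefficients r (m.inner (T.curve r)) f g h)
    (v v' : (Fin 3 → ℝ) × (Fin 3 → ℝ) × ℂ) :
    T.form m.inner r v v' = polarForm p q d f g h r v v' := by
  rw [form, hrot.vec_ofReal hd hr v.1 v.2.1 v.2.2, hrot.vec_ofReal hd hr v'.1 v'.2.1 v'.2.2]
  exact form_ofReal hnormal hdiag hr hfgh _ _ _ _ _ _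

end Tube

/-! ### Construction of smooth forms on the disc -/

/-- The last two coordinates as a complex number. -/
def planePart (α : Fin 3 → ℝ) : ℂ := ⟨α 1, α 2⟩

theorem planePart_rotVec (ψ : ℝ) (α : Fin 3 → ℝ) :
    planePart (rotVec ψ α) = Complex.exp (ψ * Complex.I) * planePart α := by
  apply Complex.ext <;>
    simp [planePart, rotVec, Complex.exp_ofReal_mul_I_re, Complex.exp_ofReal_mul_I_im]
  ring

open Complex in
/-- A real bilinear form on `ℂ`, by its parts of the two types. -/
noncomputable def blockForm (U V a b : ℂ) : ℝ :=
  ((U * (a * (starRingEnd ℂ) b)).re + (V * (a * b)).re) / 2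

theorem blockForm_ofReal (u v : ℝ) (α β : Fin 3 → ℝ) :
    blockForm ((u + v : ℝ) : ℂ) ((u - v : ℝ) : ℂ) (planePart α) (planePart β)
      = u * (α 1 * β 1) + v * (α 2 * β 2) := by
  rw [blockForm, Complex.re_ofReal_mul, Complex.re_ofReal_mul]
  simp [planePart]
  ring

open Complex in
theorem blockForm_rotate (ψ χ : ℝ) (u v : ℂ) (a b : ℂ) :
    blockForm (exp ((χ - ψ : ℝ) * I) * u) (exp (-(ψ + χ : ℝ) * I) * v) (exp (ψ * I) * a)
      (exp (χ * I) * b) = blockForm u v a b := by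
  have hconj : (starRingEnd ℂ) (exp (χ * I)) = exp (-(χ * I)) := by
    rw [← exp_conj]
    simp
  have h1 : exp ((χ - ψ : ℝ) * I) * exp (ψ * I) * exp (-(χ * I)) = 1 := by
    rw [← exp_add, ← exp_add, ← exp_zero]
    congr 1; push_cast; ring
  have h2 : exp (-(ψ + χ : ℝ) * I) * exp (ψ * I) * exp (χ * I) = 1 := by
    rw [← exp_add, ← exp_add, ← exp_zero]
    congr 1; push_cast; ring
  have e1 : exp ((χ - ψ : ℝ) * I) * u * (exp (ψ * I) * a * (exp (-(χ * I)) * (starRingEnd ℂ) b))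
      = u * (a * (starRingEnd ℂ) b) := by
    linear_combination (u * a * (starRingEnd ℂ) b) * h1
  have e2 : exp (-(ψ + χ : ℝ) * I) * v * (exp (ψ * I) * a * (exp (χ * I) * b)) = v * (a * b) := by
    linear_combination (v * a * b) * h2
  simp only [blockForm, map_mul, hconj, e1, e2]

open Complex in
-- When the planes rotate by `ψ` and `χ`, the products `a b̄` and `a b` turn by `ψ - χ` and `ψ + χ`.
-- Their coefficients `u + v` and `u - v` must therefore extend with the opposite rotations.
theorem exists_smooth_block {L : ℝ} {d m n : ℤ} (hd : d ≠ 0) {u v : ℝ → ℝ}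
    (hp : IsPowTimesEven L m.natAbs d.natAbs fun t => u t + v t)
    (hm : IsPowTimesEven L n.natAbs d.natAbs fun t => u t - v t) :
    ∃ Q : ℂ → ℂ → ℂ → ℝ, (∀ a b, ContDiffOn ℝ ∞ (fun z => Q z a b) (Metric.ball 0 L)) ∧
      ∀ r ∈ Ico 0 L, ∀ θ ψ χ : ℝ, χ - ψ = m * θ → -(ψ + χ) = n * θ → ∀ α β : Fin 3 → ℝ,
        Q (exp ((d * θ : ℝ) * I) * r) (planePart (rotVec ψ α)) (planePart (rotVec χ β))
          = u r * (α 1 * β 1) + v r * (α 2 * β 2) := by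
  obtain ⟨U, hU, hU'⟩ := hp.exists_equivariant hd
  obtain ⟨V, hV, hV'⟩ := hm.exists_equivariant hd
  refine ⟨fun z => blockForm (U z) (V z), fun a b => ?_, fun r hr θ ψ χ h1 h2 α β => ?_⟩
  · have h1 : ContDiffOn ℝ ∞ (fun z => (U z * (a * (starRingEnd ℂ) b)).re) (Metric.ball 0 L) :=
      Complex.reCLM.contDiff.comp_contDiffOn (hU.mul contDiffOn_const)
    have h2 : ContDiffOn ℝ ∞ (fun z => (V z * (a * b)).re) (Metric.ball 0 L) :=
      Complex.reCLM.contDiff.comp_contDiffOn (hV.mul contDiffOn_const)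
    exact (h1.add h2).div_const 2
  · have e1 : exp (m * θ * I) = exp ((χ - ψ : ℝ) * I) := by
      rw [h1]; push_cast; rfl
    have e2 : exp (n * θ * I) = exp (-(ψ + χ : ℝ) * I) := by
      rw [← ofReal_neg, h2]; push_cast; rfl
    beta_reduce
    rw [hU' r hr θ, hV' r hr θ, planePart_rotVec, planePart_rotVec, e1, e2, blockForm_rotate,
      blockForm_ofReal]

open Complex in
theorem im_exp_mul_conj (φ r : ℝ) (w : ℂ) :
    (exp (φ * I) * w * (starRingEnd ℂ) (exp (φ * I) * r)).im = r * w.im := by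
  have h : exp (φ * I) * w * (starRingEnd ℂ) (exp (φ * I) * r) = r * w := by
    have h1 : exp (φ * I) * exp (-(φ * I)) = 1 := by rw [← exp_add]; simp
    have h2 : (starRingEnd ℂ) (exp (φ * I)) = exp (-(φ * I)) := by rw [← exp_conj]; simp
    rw [map_mul, h2, conj_ofReal]
    linear_combination (r * w) * h1
  rw [h, im_ofReal_mul]

open Complex in
theorem re_exp_mul_conj (φ : ℝ) (w w' : ℂ) :
    (exp (φ * I) * w * (starRingEnd ℂ) (exp (φ * I) * w')).re = w.re * w'.re + w.im * w'.im := by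
  have h : exp (φ * I) * w * (starRingEnd ℂ) (exp (φ * I) * w') = w * (starRingEnd ℂ) w' := by
    have h1 : exp (φ * I) * exp (-(φ * I)) = 1 := by rw [← exp_add]; simp
    have h2 : (starRingEnd ℂ) (exp (φ * I)) = exp (-(φ * I)) := by rw [← exp_conj]; simp
    rw [map_mul, h2]
    linear_combination (w * (starRingEnd ℂ) w') * h1
  rw [h]
  simp

theorem contDiffOn_radial {L : ℝ} (hL : 0 < L) {u : ℝ → ℝ} (hu : IsEvenAtZero L u) :
    ContDiffOn ℝ ∞ (fun z : ℂ => u ‖z‖) (Metric.ball 0 L) := by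
  obtain ⟨φ, hφ, h⟩ := hu.exists_eq_comp_sq hL
  refine (contDiffOn_comp_norm_sq hφ).congr fun z hz => ?_
  exact h _ ⟨norm_nonneg z, mem_ball_zero_iff.1 hz⟩

open Complex in
-- At `z = r e^{iφ}` the angular component of a slice vector is `Im(w z̄)/r`, so its Lie algebra
-- coordinate is `Im(w z̄)/(d r²)` and powers of `1/r²` have to cancel. By `h1` and `h2` the
-- combinations `pf + qh` and `qg + ph` are divisible by `r²`. By `h3` the quotient `(p²f + q²g +
-- 2pqh)/r²` is `d² + r² y`: its leading term combines with the radial part into the Euclidean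
-- product `Re(w w̄')`, and `y` is the smooth remainder.
theorem exists_smooth_radial {L : ℝ} (hL : 0 < L) {p q d : ℤ} (hd : d ≠ 0) {f g h : ℝ → ℝ}
    (hf : IsEvenAtZero L f) (hg : IsEvenAtZero L g) (hh : IsEvenAtZero L h)
    (h1 : p * f 0 = -(q * h 0)) (h2 : q * g 0 = -(p * h 0))
    (h3 : p ^ 2 * secondDerivAtZero L f + q ^ 2 * secondDerivAtZero L g
      + 2 * p * q * secondDerivAtZero L h = 2 * d ^ 2) :
    ∃ R : ℂ → ℝ × ℝ × ℂ → ℝ × ℝ × ℂ → ℝ,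
      (∀ v v', ContDiffOn ℝ ∞ (fun z => R z v v') (Metric.ball 0 L)) ∧
      (∀ r ∈ Ioo 0 L, ∀ φ a b a' b' : ℝ, ∀ w w' : ℂ,
        R (exp (φ * I) * r) (a, b, exp (φ * I) * w) (a', b', exp (φ * I) * w') =
          f r * ((a + w.im / (d * r) * p) * (a' + w'.im / (d * r) * p))
          + h r * ((a + w.im / (d * r) * p) * (b' + w'.im / (d * r) * q)
            + (b + w.im / (d * r) * q) * (a' + w'.im / (d * r) * p))
          + g r * ((b + w.im / (d * r) * q) * (b' + w'.im / (d * r) * q)) + w.re * w'.re) ∧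
      ∀ a b a' b' : ℝ, ∀ w w' : ℂ, R 0 (a, b, w) (a', b', w') =
        f 0 * (a * a') + h 0 * (a * b' + b * a') + g 0 * (b * b')
          + (w * (starRingEnd ℂ) w').re := by
  obtain ⟨F, hF, hF', hF''⟩ := hf.exists_eq_add_sq_mul hL
  obtain ⟨K, hK, hK', hK''⟩ := hg.exists_eq_add_sq_mul hL
  obtain ⟨J, hJ, hJ', hJ''⟩ := hh.exists_eq_add_sq_mul hL
  have hA := (hF.const_mul p).add (hJ.const_mul q)
  have hB := (hK.const_mul q).add (hJ.const_mul p)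
  have hX := (hA.const_mul p).add (hB.const_mul q)
  obtain ⟨y, hy, hy', -⟩ := hX.exists_eq_add_sq_mul hL
  have hd0 : (d : ℝ) ≠ 0 := by exact_mod_cast hd
  have him : ∀ w : ℂ, ContDiffOn ℝ ∞ (fun z => (w * (starRingEnd ℂ) z).im) (Metric.ball 0 L) :=
    fun w => (Complex.imCLM.contDiff.comp (contDiff_const.mul
      Complex.conjCLE.contDiff)).contDiffOn
  refine ⟨fun z v v' => f ‖z‖ * (v.1 * v'.1) + h ‖z‖ * (v.1 * v'.2.1 + v.2.1 * v'.1)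
    + g ‖z‖ * (v.2.1 * v'.2.1)
    + (p * F ‖z‖ + q * J ‖z‖) / d * (v.1 * (v'.2.2 * (starRingEnd ℂ) z).im
        + v'.1 * (v.2.2 * (starRingEnd ℂ) z).im)
    + (q * K ‖z‖ + p * J ‖z‖) / d * (v.2.1 * (v'.2.2 * (starRingEnd ℂ) z).im
        + v'.2.1 * (v.2.2 * (starRingEnd ℂ) z).im)
    + y ‖z‖ / d ^ 2 * ((v.2.2 * (starRingEnd ℂ) z).im * (v'.2.2 * (starRingEnd ℂ) z).im)
    + (v.2.2 * (starRingEnd ℂ) v'.2.2).re, fun v v' => ?_, ?_, ?_⟩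
  · have c1 := contDiffOn_radial hL hf
    have c2 := contDiffOn_radial hL hg
    have c3 := contDiffOn_radial hL hh
    have c4 := contDiffOn_radial hL hA
    have c5 := contDiffOn_radial hL hB
    have c6 := contDiffOn_radial hL hy
    have d1 := him v.2.2
    have d2 := him v'.2.2
    exact ((((((c1.mul contDiffOn_const).add (c3.mul contDiffOn_const)).add
      (c2.mul contDiffOn_const)).add ((c4.div_const _).mul ((contDiffOn_const.mul d2).add
      (contDiffOn_const.mul d1)))).add ((c5.div_const _).mul ((contDiffOn_const.mul d2).add
      (contDiffOn_const.mul d1)))).add ((c6.div_const _).mul (d1.mul d2))).add contDiffOn_const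
  · intro r hr φ a b a' b' w w'
    have hn : ‖exp (φ * I) * r‖ = r := norm_exp_mul_ofReal hr.1.le φ
    have hr' : r ∈ Ico 0 L := ⟨hr.1.le, hr.2⟩
    have hr0 : r ≠ 0 := hr.1.ne'
    have ey := hy' r hr'
    -- The Taylor coefficients are half the second derivatives, which turns `2 d²` into `d²`.
    have e0 : p * (p * F 0 + q * J 0) + q * (q * K 0 + p * J 0) = (d : ℝ) ^ 2 := by
      rw [hF'', hK'', hJ''] at h3
      linear_combination h3 / 2
    beta_reduce at ey
    simp only [hn, im_exp_mul_conj, re_exp_mul_conj]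
    rw [e0] at ey
    obtain ⟨s, hs⟩ : ∃ s, w.im = s * (d * r) := ⟨w.im / (d * r), by field_simp⟩
    obtain ⟨s', hs'⟩ : ∃ s', w'.im = s' * (d * r) := ⟨w'.im / (d * r), by field_simp⟩
    have hdr : (d : ℝ) * r ≠ 0 := mul_ne_zero hd0 hr0
    rw [hF' r hr', hJ' r hr', hK' r hr', hs, hs', mul_div_cancel_right₀ s hdr,
      mul_div_cancel_right₀ s' hdr]
    have e1 : ∀ x, (p * F r + q * J r) / d * (a * (r * (s' * (d * r))) + x * (r * (s * (d * r))))
        = (p * F r + q * J r) * (r ^ 2 * (a * s' + x * s)) := fun x => by field_simp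
    have e2 : ∀ x, (q * K r + p * J r) / d * (b * (r * (s' * (d * r))) + x * (r * (s * (d * r))))
        = (q * K r + p * J r) * (r ^ 2 * (b * s' + x * s)) := fun x => by field_simp
    have e3 : y r / d ^ 2 * (r * (s * (d * r)) * (r * (s' * (d * r))))
        = y r * (r ^ 4 * (s * s')) := by
      field_simp
    rw [e1, e2, e3]
    linear_combination (-(a * s' + a' * s) - s * s' * p) * h1 - (b * s' + b' * s + s * s' * q) * h2
      - s * s' * r ^ 2 * ey
  · intro a b a' b' w w'
    simp

open Complex in
/-- The conditions at the singular orbit give a smooth family of forms on the slice. -/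
theorem exists_smooth_form {L : ℝ} (hL : 0 < L) {p q d : ℤ} (hd : d ≠ 0) {f g h : Fin 3 → ℝ → ℝ}
    (hf : IsEvenAtZero L (f 0)) (hg : IsEvenAtZero L (g 0)) (hh : IsEvenAtZero L (h 0))
    (h1 : p * f 0 0 = -(q * h 0 0)) (h2 : q * g 0 0 = -(p * h 0 0))
    (h3 : p ^ 2 * secondDerivAtZero L (f 0) + q ^ 2 * secondDerivAtZero L (g 0)
      + 2 * p * q * secondDerivAtZero L (h 0) = 2 * d ^ 2)
    (hf1 : IsPowTimesEven L 0 d.natAbs fun t => f 1 t + f 2 t)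
    (hf2 : IsPowTimesEven L (4 * p.natAbs) d.natAbs fun t => f 1 t - f 2 t)
    (hg1 : IsPowTimesEven L 0 d.natAbs fun t => g 1 t + g 2 t)
    (hg2 : IsPowTimesEven L (4 * q.natAbs) d.natAbs fun t => g 1 t - g 2 t)
    (hh1 : IsPowTimesEven L (2 * (q - p).natAbs) d.natAbs fun t => h 1 t + h 2 t)
    (hh2 : IsPowTimesEven L (2 * (q + p).natAbs) d.natAbs fun t => h 1 t - h 2 t) :
    ∃ P : ℂ → (Fin 3 → ℝ) × (Fin 3 → ℝ) × ℂ → (Fin 3 → ℝ) × (Fin 3 → ℝ) × ℂ → ℝ,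
      (∀ v v', ContDiffOn ℝ ∞ (fun z => P z v v') (Metric.ball 0 L)) ∧
      (∀ r ∈ Ioo 0 L, ∀ θ v v', P (exp ((d * θ : ℝ) * I) * r) (rotateVec p q d θ v)
        (rotateVec p q d θ v') = polarForm p q d f g h r v v') ∧
      ∀ v v', P 0 v v' = coeffForm (f · 0) (g · 0) (h · 0) v.1 v.2.1 v'.1 v'.2.1
        + (v.2.2 * (starRingEnd ℂ) v'.2.2).re := by
  obtain ⟨R, hR, hR', hR''⟩ := exists_smooth_radial hL hd hf hg hh h1 h2 h3
  -- In the `XX` block both angles are `2pθ`, so `χ - ψ = 0` and `-(ψ + χ) = -4pθ`; likewise with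
  -- `q` for `YY`. The mixed block has angles `2pθ` and `2qθ`.
  obtain ⟨A, hA, hA'⟩ := exists_smooth_block (m := 0) (n := -4 * p) hd hf1
    (by rwa [Int.natAbs_mul])
  obtain ⟨B, hB, hB'⟩ := exists_smooth_block (m := 0) (n := -4 * q) hd hg1
    (by rwa [Int.natAbs_mul])
  obtain ⟨C, hC, hC'⟩ := exists_smooth_block (m := 2 * (q - p)) (n := -2 * (q + p)) hd
    (by rwa [Int.natAbs_mul]) (by rwa [Int.natAbs_mul])
  refine ⟨fun z v v' => R z (v.1 0, v.2.1 0, v.2.2) (v'.1 0, v'.2.1 0, v'.2.2)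
    + A z (planePart v.1) (planePart v'.1) + B z (planePart v.2.1) (planePart v'.2.1)
    + C z (planePart v.1) (planePart v'.2.1) + C z (planePart v'.1) (planePart v.2.1),
    fun v v' => ((((hR _ _).add (hA _ _)).add (hB _ _)).add (hC _ _)).add (hC _ _), ?_, ?_⟩
  · rintro r hr θ ⟨α, β, w⟩ ⟨α', β', w'⟩
    have hr' : r ∈ Ico 0 L := ⟨hr.1.le, hr.2⟩
    have e1 : -(2 * (p * θ) + 2 * (p * θ)) = ((-4 * p : ℤ) : ℝ) * θ := by push_cast; ring
    have e2 : -(2 * (q * θ) + 2 * (q * θ)) = ((-4 * q : ℤ) : ℝ) * θ := by push_cast; ring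
    have e3 : 2 * (q * θ) - 2 * (p * θ) = ((2 * (q - p) : ℤ) : ℝ) * θ := by push_cast; ring
    have e4 : -(2 * (p * θ) + 2 * (q * θ)) = ((-2 * (q + p) : ℤ) : ℝ) * θ := by push_cast; ring
    have e5 : ∀ x : ℝ, x - x = ((0 : ℤ) : ℝ) * θ := fun x => by simp
    have e6 : ∀ ψ α, rotVec ψ α 0 = α 0 := fun ψ α => rfl
    simp only [rotateVec]
    rw [e6, e6, e6, e6, hR' r hr, hA' r hr' θ _ _ (e5 _) e1, hB' r hr' θ _ _ (e5 _) e2,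
      hC' r hr' θ _ _ e3 e4, hC' r hr' θ _ _ e3 e4]
    simp only [polarForm, coeffForm, Fin.sum_univ_three, Pi.add_apply, Pi.smul_apply, smul_eq_mul,
      Pi.single_eq_same, Pi.single_eq_of_ne (show (1 : Fin 3) ≠ 0 by decide),
      Pi.single_eq_of_ne (show (2 : Fin 3) ≠ 0 by decide), mul_zero, add_zero]
    ring
  · rintro ⟨α, β, w⟩ ⟨α', β', w'⟩
    have h0 : (0 : ℝ) ∈ Ico 0 L := ⟨le_rfl, hL⟩
    have e0 : ∀ α, rotVec 0 α = α := fun α => by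
      ext i; fin_cases i <;> simp [rotVec]
    have a0 := hA' 0 h0 0 0 0 (by simp) (by simp) α α'
    have b0 := hB' 0 h0 0 0 0 (by simp) (by simp) β β'
    have c0 := hC' 0 h0 0 0 0 (by simp) (by simp) α β'
    have c0' := hC' 0 h0 0 0 0 (by simp) (by simp) α' β
    simp only [e0, mul_zero, ofReal_zero] at a0 b0 c0 c0'
    simp only [hR'', a0, b0, c0, c0', coeffForm, Fin.sum_univ_three]
    ring

/-! ### Necessity of the conditions -/

open Complex in
theorem exists_eq_exp_mul_norm {d : ℤ} (hd : d ≠ 0) (z : ℂ) :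
    ∃ θ : ℝ, z = exp ((d * θ : ℝ) * I) * ‖z‖ := by
  have hd0 : (d : ℝ) ≠ 0 := by exact_mod_cast hd
  refine ⟨arg z / d, ?_⟩
  rw [mul_div_cancel₀ _ hd0, mul_comm, norm_mul_exp_arg_mul_I]

theorem norm_mem_Ioo {L : ℝ} {z : ℂ} (hz : z ∈ Metric.ball (0 : ℂ) L) (hz0 : z ≠ 0) :
    ‖z‖ ∈ Ioo 0 L := ⟨norm_pos_iff.2 hz0, mem_ball_zero_iff.1 hz⟩

open Complex in
theorem isPowTimesEven_of_polar {L : ℝ} (hL : 0 < L) {m d : ℤ} (hd : d ≠ 0) {U : ℂ → ℂ}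
    (hU : ContDiffOn ℝ ∞ U (Metric.ball 0 L)) {u : ℝ → ℝ}
    (h : ∀ r ∈ Ioo 0 L, ∀ θ : ℝ, U (exp ((d * θ : ℝ) * I) * r) = exp (m * θ * I) * u r)
    (hu0 : u 0 = (U 0).re) : IsPowTimesEven L m.natAbs d.natAbs u := by
  refine isPowTimesEven_of_equivariant hL hd hU (fun θ z hz hz0 => ?_) (fun t ht => ?_) hu0
  · obtain ⟨η, hη⟩ := exists_eq_exp_mul_norm hd z
    have hr := norm_mem_Ioo hz hz0
    have e1 : exp ((d * θ : ℝ) * I) * z = exp ((d * (θ + η) : ℝ) * I) * ‖z‖ := by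
      conv_lhs => rw [hη]
      rw [← mul_assoc, ← exp_add]
      congr 2; push_cast; ring
    have e2 : U z = exp (m * η * I) * u ‖z‖ := by
      conv_lhs => rw [hη]
      exact h _ hr η
    rw [e1, h _ hr, e2, ← mul_assoc, ← exp_add]
    congr 2; push_cast; ring
  · have := h t ht 0
    simpa using this

open Complex in
-- The two types of a real bilinear form on the plane are read off from its matrix: `Q₁₁ + Q₂₂ +
-- i(Q₁₂ - Q₂₁)` and `Q₁₁ - Q₂₂ - i(Q₁₂ + Q₂₁)`. Each is equivariant, and on the positive axis they
-- are `u + v` and `u - v`.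
theorem isPowTimesEven_of_block {L : ℝ} (hL : 0 < L) {a b d : ℤ} (hd : d ≠ 0)
    {Q : ℂ → (Fin 3 → ℝ) → (Fin 3 → ℝ) → ℝ}
    (hQ : ∀ α β, ContDiffOn ℝ ∞ (fun z => Q z α β) (Metric.ball 0 L)) {w u v : ℝ → ℝ}
    (h : ∀ r ∈ Ioo 0 L, ∀ θ α β, Q (exp ((d * θ : ℝ) * I) * r) (rotVec (2 * (a * θ)) α)
      (rotVec (2 * (b * θ)) β) = w r * (α 0 * β 0) + u r * (α 1 * β 1) + v r * (α 2 * β 2))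
    (hu : u 0 = Q 0 (Pi.single 1 1) (Pi.single 1 1))
    (hv : v 0 = Q 0 (Pi.single 2 1) (Pi.single 2 1)) :
    IsPowTimesEven L (2 * (b - a)).natAbs d.natAbs (fun t => u t + v t) ∧
      IsPowTimesEven L (2 * (b + a)).natAbs d.natAbs (fun t => u t - v t) := by
  have hs : ∀ i j : Fin 3, ContDiffOn ℝ ∞
      (fun z => (Q z (Pi.single i 1) (Pi.single j 1) : ℂ)) (Metric.ball 0 L) := fun i j =>
    ofRealCLM.contDiff.comp_contDiffOn (hQ _ _)
  have key : ∀ r ∈ Ioo 0 L, ∀ θ α β, Q (exp ((d * θ : ℝ) * I) * r) α β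
      = w r * (rotVec (-(2 * (a * θ))) α 0 * rotVec (-(2 * (b * θ))) β 0)
        + u r * (rotVec (-(2 * (a * θ))) α 1 * rotVec (-(2 * (b * θ))) β 1)
        + v r * (rotVec (-(2 * (a * θ))) α 2 * rotVec (-(2 * (b * θ))) β 2) := by
    intro r hr θ α β
    rw [← h r hr θ, rotVec_rotVec_neg, rotVec_rotVec_neg]
  have hexp : ∀ x : ℝ, exp (x * I) = Real.cos x + Real.sin x * I := fun x => by
    rw [exp_mul_I, ofReal_cos, ofReal_sin]
  constructor
  · refine isPowTimesEven_of_polar hL hd (U := fun z =>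
      Q z (Pi.single 1 1) (Pi.single 1 1) + Q z (Pi.single 2 1) (Pi.single 2 1)
      + (Q z (Pi.single 1 1) (Pi.single 2 1) - Q z (Pi.single 2 1) (Pi.single 1 1)) * I)
      (((hs 1 1).add (hs 2 2)).add (((hs 1 2).sub (hs 2 1)).mul contDiffOn_const)) ?_ ?_
    · intro r hr θ
      have e : exp ((2 * (b - a) : ℤ) * θ * I)
          = exp ((2 * (b * θ) - 2 * (a * θ) : ℝ) * I) := by
        congr 1; push_cast; ring
      simp only [key r hr]
      rw [e, hexp, Real.cos_sub, Real.sin_sub]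
      simp [rotVec]
      ring
    · simp [hu, hv]
  · refine isPowTimesEven_of_polar hL hd (m := -(2 * (b + a))) (U := fun z =>
      Q z (Pi.single 1 1) (Pi.single 1 1) - Q z (Pi.single 2 1) (Pi.single 2 1)
      - (Q z (Pi.single 1 1) (Pi.single 2 1) + Q z (Pi.single 2 1) (Pi.single 1 1)) * I)
      (((hs 1 1).sub (hs 2 2)).sub (((hs 1 2).add (hs 2 1)).mul contDiffOn_const)) ?_ ?_ |>
      fun h => by rwa [Int.natAbs_neg] at h
    · intro r hr θ
      have e : exp ((-(2 * (b + a)) : ℤ) * θ * I)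
          = exp ((-(2 * (b * θ) + 2 * (a * θ)) : ℝ) * I) := by
        congr 1; push_cast; ring
      simp only [key r hr]
      rw [e, hexp, Real.cos_neg, Real.sin_neg, Real.cos_add, Real.sin_add]
      simp [rotVec]
      ring
    · simp [hu, hv]

theorem rotVec_zero (ψ : ℝ) : rotVec ψ 0 = 0 := by
  ext i; fin_cases i <;> simp [rotVec]

theorem rotVec_single_zero (ψ c : ℝ) : rotVec ψ (Pi.single 0 c) = Pi.single 0 c := by
  ext i; fin_cases i <;> simp [rotVec]

theorem isEvenAtZero_of_comp_norm {L : ℝ} {Q : ℂ → ℝ} (hQ : ContDiffOn ℝ ∞ Q (Metric.ball 0 L))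
    {u : ℝ → ℝ} (h : ∀ z ∈ Metric.ball (0 : ℂ) L, Q z = u ‖z‖) : IsEvenAtZero L u := by
  have h1 : ContDiffOn ℝ ∞ (fun t : ℝ => Q t) (Ioo (-L) L) :=
    hQ.comp Complex.ofRealCLM.contDiff.contDiffOn fun t ht => ofReal_mem_ball ht
  refine h1.congr fun t ht => ?_
  rw [h _ (ofReal_mem_ball ht), Complex.norm_real, Real.norm_eq_abs]

open Complex in
/-- The conditions at the singular orbit hold if the family of forms on the slice is smooth. -/
theorem conditions_of_smooth_form {L : ℝ} (hL : 0 < L) {p q d : ℤ} (hd : d ≠ 0)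
    {f g h : Fin 3 → ℝ → ℝ}
    {P : ℂ → (Fin 3 → ℝ) × (Fin 3 → ℝ) × ℂ → (Fin 3 → ℝ) × (Fin 3 → ℝ) × ℂ → ℝ}
    (hP : ∀ v v', ContDiffOn ℝ ∞ (fun z => P z v v') (Metric.ball 0 L))
    (hrot : ∀ r ∈ Ioo 0 L, ∀ θ v v', P (exp ((d * θ : ℝ) * I) * r) (rotateVec p q d θ v)
        (rotateVec p q d θ v') = polarForm p q d f g h r v v')
    (hf0 : ∀ i, f i 0 = P 0 (Pi.single i 1, 0, 0) (Pi.single i 1, 0, 0))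
    (hg0 : ∀ i, g i 0 = P 0 (0, Pi.single i 1, 0) (0, Pi.single i 1, 0))
    (hh0 : ∀ i, h i 0 = P 0 (Pi.single i 1, 0, 0) (0, Pi.single i 1, 0))
    (h1 : p * f 0 0 = -(q * h 0 0)) (h2 : q * g 0 0 = -(p * h 0 0)) :
    ((IsEvenAtZero L (f 0) ∧ IsEvenAtZero L (g 0) ∧ IsEvenAtZero L (h 0)) ∧
      p ^ 2 * secondDerivAtZero L (f 0) + q ^ 2 * secondDerivAtZero L (g 0)
        + 2 * p * q * secondDerivAtZero L (h 0) = 2 * d ^ 2) ∧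
      IsPowTimesEven L 0 d.natAbs (fun t => f 1 t + f 2 t) ∧
      IsPowTimesEven L (4 * p.natAbs) d.natAbs (fun t => f 1 t - f 2 t) ∧
      IsPowTimesEven L 0 d.natAbs (fun t => g 1 t + g 2 t) ∧
      IsPowTimesEven L (4 * q.natAbs) d.natAbs (fun t => g 1 t - g 2 t) ∧
      IsPowTimesEven L (2 * (q - p).natAbs) d.natAbs (fun t => h 1 t + h 2 t) ∧
      IsPowTimesEven L (2 * (q + p).natAbs) d.natAbs (fun t => h 1 t - h 2 t) := by
  have hd0 : (d : ℝ) ≠ 0 := by exact_mod_cast hd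
  have key : ∀ v v', (∀ θ, rotateVec p q d θ v = v) → (∀ θ, rotateVec p q d θ v' = v') →
      ∀ z ∈ Metric.ball (0 : ℂ) L, z ≠ 0 → P z v v' = polarForm p q d f g h ‖z‖ v v' := by
    intro v v' hv hv' z hz hz0
    obtain ⟨θ, hθ⟩ := exists_eq_exp_mul_norm hd z
    rw [← hrot _ (norm_mem_Ioo hz hz0) θ, ← hθ, hv, hv']
  have hx : ∀ θ, rotateVec p q d θ (Pi.single 0 1, 0, 0) = (Pi.single 0 1, 0, 0) := fun θ => by
    simp only [rotateVec, rotVec_zero, rotVec_single_zero, mul_zero]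
  have hy : ∀ θ, rotateVec p q d θ (0, Pi.single 0 1, 0) = (0, Pi.single 0 1, 0) := fun θ => by
    simp only [rotateVec, rotVec_zero, rotVec_single_zero, mul_zero]
  have hf : IsEvenAtZero L (f 0) := isEvenAtZero_of_comp_norm (hP _ _) fun z hz => by
    by_cases hz0 : z = 0
    · rw [hz0, norm_zero, hf0]
    · rw [key _ _ hx hx z hz hz0]
      simp [polarForm, coeffForm, Fin.sum_univ_three]
  have hg : IsEvenAtZero L (g 0) := isEvenAtZero_of_comp_norm (hP _ _) fun z hz => by
    by_cases hz0 : z = 0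
    · rw [hz0, norm_zero, hg0]
    · rw [key _ _ hy hy z hz hz0]
      simp [polarForm, coeffForm, Fin.sum_univ_three]
  have hh : IsEvenAtZero L (h 0) := isEvenAtZero_of_comp_norm (hP _ _) fun z hz => by
    by_cases hz0 : z = 0
    · rw [hz0, norm_zero, hh0]
    · rw [key _ _ hx hy z hz hz0]
      simp [polarForm, coeffForm, Fin.sum_univ_three]
  refine ⟨⟨⟨hf, hg, hh⟩, ?_⟩, ?_⟩
  · obtain ⟨F, hF, hF', hF''⟩ := hf.exists_eq_add_sq_mul hL
    obtain ⟨K, hK, hK', hK''⟩ := hg.exists_eq_add_sq_mul hL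
    obtain ⟨J, hJ, hJ', hJ''⟩ := hh.exists_eq_add_sq_mul hL
    have hcont : ContinuousAt (fun z => P z (0, 0, I) (0, 0, I)) 0 :=
      (hP _ _).continuousOn.continuousAt (Metric.ball_mem_nhds 0 hL)
    have hX := ((hF.const_mul (p ^ 2)).add (hK.const_mul (q ^ 2))).add (hJ.const_mul (2 * p * q))
    have hXc : ContinuousAt (fun t => p ^ 2 * F |t| + q ^ 2 * K |t| + 2 * p * q * J |t|) 0 :=
      ContDiffOn.continuousOn hX |>.continuousAt (Ioo_mem_nhds (by linarith) hL)
    have hmem : ∀ᶠ t : ℝ in 𝓝[>] 0, t ∈ Ioo 0 L := Ioo_mem_nhdsGT hL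
    have t1 : Tendsto (fun t : ℝ => P (I * t) (0, 0, I) (0, 0, I)) (𝓝[>] 0)
        (𝓝 (P 0 (0, 0, I) (0, 0, I))) := by
      have hc : ContinuousAt (fun t : ℝ => I * (t : ℂ)) 0 := by fun_prop
      refine Tendsto.mono_left ?_ nhdsWithin_le_nhds
      exact ContinuousAt.tendsto (x := (0 : ℝ)) (f := fun t : ℝ => P (I * t) (0, 0, I) (0, 0, I))
        (ContinuousAt.comp (g := fun z => P z (0, 0, I) (0, 0, I)) (by simpa using hcont) hc)
        |>.trans (by simp)
    have t2 : Tendsto (fun t : ℝ => P t (0, 0, I) (0, 0, I)) (𝓝[>] 0)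
        (𝓝 (P 0 (0, 0, I) (0, 0, I))) := by
      have hc : ContinuousAt (fun t : ℝ => (t : ℂ)) 0 := by fun_prop
      refine Tendsto.mono_left ?_ nhdsWithin_le_nhds
      exact ContinuousAt.tendsto (x := (0 : ℝ)) (f := fun t : ℝ => P t (0, 0, I) (0, 0, I))
        (ContinuousAt.comp (g := fun z => P z (0, 0, I) (0, 0, I)) (by simpa using hcont) hc)
        |>.trans (by simp)
    -- The value at the centre is approached along two rays. On the imaginary axis `i` is the radial
    -- direction, of length `1`.
    have e1 : P 0 (0, 0, I) (0, 0, I) = 1 := by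
      refine tendsto_nhds_unique t1 (tendsto_const_nhds.congr' ?_)
      filter_upwards [hmem] with t ht
      have hexp : exp ((d * (Real.pi / 2 / d) : ℝ) * I) = I := by
        rw [mul_div_cancel₀ _ hd0]
        push_cast
        exact exp_pi_div_two_mul_I
      have := hrot t ht (Real.pi / 2 / d) (0, 0, 1) (0, 0, 1)
      simp only [rotateVec, rotVec_zero, hexp, mul_one] at this
      rw [this]
      simp [polarForm, coeffForm]
    -- On the real axis `i` is the angular direction, whose squared length is `(p²f + q²g + 2pqh)/(d
    -- t)²`; the constant terms of the numerator cancel by `h1` and `h2`.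
    have e2 : P 0 (0, 0, I) (0, 0, I) = (p ^ 2 * F 0 + q ^ 2 * K 0 + 2 * p * q * J 0) / d ^ 2 := by
      have t3 := (hXc.tendsto.div_const ((d : ℝ) ^ 2)).mono_left
        (nhdsWithin_le_nhds (s := Ioi (0 : ℝ)))
      rw [abs_zero] at t3
      refine tendsto_nhds_unique t2 (t3.congr' ?_)
      filter_upwards [hmem] with t ht
      have ht0 : t ≠ 0 := ht.1.ne'
      have ht' : t ∈ Ico 0 L := ⟨ht.1.le, ht.2⟩
      have := hrot t ht 0 (0, 0, I) (0, 0, I)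
      simp only [rotateVec, rotVec_zero, mul_zero, ofReal_zero, zero_mul, exp_zero, one_mul] at this
      rw [this, abs_of_pos ht.1]
      simp [polarForm, coeffForm, Fin.sum_univ_three]
      rw [hF' t ht', hK' t ht', hJ' t ht']
      field_simp
      linear_combination (-(p : ℝ)) * h1 - q * h2
    have e3 := e2.symm.trans e1
    rw [div_eq_one_iff_eq (pow_ne_zero 2 hd0)] at e3
    rw [hF'', hK'', hJ'']
    linear_combination 2 * e3
  · have hXX := isPowTimesEven_of_block hL (a := p) (b := p) hd (w := f 0) (u := f 1) (v := f 2)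
      (Q := fun z α β => P z (α, 0, 0) (β, 0, 0)) (fun _ _ => hP _ _) (fun r hr θ α β => by
        have := hrot r hr θ (α, 0, 0) (β, 0, 0)
        simp only [rotateVec, rotVec_zero, mul_zero] at this
        rw [this]
        simp [polarForm, coeffForm, Fin.sum_univ_three]) (hf0 1) (hf0 2)
    have hYY := isPowTimesEven_of_block hL (a := q) (b := q) hd (w := g 0) (u := g 1) (v := g 2)
      (Q := fun z α β => P z (0, α, 0) (0, β, 0)) (fun _ _ => hP _ _) (fun r hr θ α β => by
        have := hrot r hr θ (0, α, 0) (0, β, 0)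
        simp only [rotateVec, rotVec_zero, mul_zero] at this
        rw [this]
        simp [polarForm, coeffForm, Fin.sum_univ_three]) (hg0 1) (hg0 2)
    have hXY := isPowTimesEven_of_block hL (a := p) (b := q) hd (w := h 0) (u := h 1) (v := h 2)
      (Q := fun z α β => P z (α, 0, 0) (0, β, 0)) (fun _ _ => hP _ _) (fun r hr θ α β => by
        have := hrot r hr θ (α, 0, 0) (0, β, 0)
        simp only [rotateVec, rotVec_zero, mul_zero] at this
        rw [this]
        simp [polarForm, coeffForm, Fin.sum_univ_three]) (hh0 1) (hh0 2)
    have n1 : ∀ x : ℤ, (2 * (x - x)).natAbs = 0 := fun x => by simp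
    have n2 : ∀ x : ℤ, (2 * (x + x)).natAbs = 4 * x.natAbs := fun x => by omega
    have n3 : ∀ x : ℤ, (2 * x).natAbs = 2 * x.natAbs := fun x => by omega
    rw [n1, n2] at hXX hYY
    rw [n3, n3] at hXY
    exact ⟨hXX.1, hXX.2, hYY.1, hYY.2, hXY.1, hXY.2⟩

namespace Tube

variable {M : Type*} [TopologicalSpace M] [ChartedSpace (EuclideanSpace ℝ (Fin 7)) M]
  [MulAction G M] {H K : Subgroup G} {L : ℝ} (T : Tube M H K L)

theorem vec_single_left (i : Fin 3) (z : ℂ) :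
    T.vec z (Pi.single i 1, 0, 0) = fieldX i (T.slice z) := by
  rw [vec_apply, map_zero, add_zero]
  exact actionField_single_left i _

theorem vec_single_right (i : Fin 3) (z : ℂ) :
    T.vec z (0, Pi.single i 1, 0) = fieldY i (T.slice z) := by
  rw [vec_apply, map_zero, add_zero]
  exact actionField_single_right i _

theorem hasCoefficients_zero_iff {B : FormFamily M} {f g h : Fin 3 → ℝ → ℝ} :
    T.HasCoefficients 0 (B (T.curve 0)) f g h ↔ ∀ i,
      f i 0 = T.form B 0 (Pi.single i 1, 0, 0) (Pi.single i 1, 0, 0) ∧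
      g i 0 = T.form B 0 (0, Pi.single i 1, 0) (0, Pi.single i 1, 0) ∧
      h i 0 = T.form B 0 (Pi.single i 1, 0, 0) (0, Pi.single i 1, 0) := by
  simp only [form, vec_single_left, vec_single_right]
  have h0 : ((0 : ℝ) : ℂ) = 0 := Complex.ofReal_zero
  rw [← h0]
  rfl

variable [ContMDiffSMul IG (𝓡 7) ∞ G M] {T} {p q d : ℤ}

theorem HasRotation.vec_zero_slope (hrot : T.HasRotation p q d) (hL : 0 < L) :
    T.vec 0 (Pi.single 0 (p : ℝ), Pi.single 0 (q : ℝ), 0) = 0 := by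
  rw [hrot.vec_slope (Metric.mem_ball_self hL), mul_zero]
  exact map_zero _

theorem HasRotation.form_rotate_eq_polarForm (hrot : T.HasRotation p q d) (hd : d ≠ 0)
    {m : PointwiseMetric M} (hinv : m.InvariantOn T.singularOrbitᶜ) (hnormal : T.IsNormal m)
    (hdiag : T.IsDiagonal m) {f g h : Fin 3 → ℝ → ℝ}
    (hfgh : ∀ t ∈ Ioo 0 L, T.HasCoefficients t (m.inner (T.curve t)) f g h)
    {r : ℝ} (hr : r ∈ Ioo 0 L) (θ : ℝ) (v v' : (Fin 3 → ℝ) × (Fin 3 → ℝ) × ℂ) :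
    T.form m.inner (Complex.exp ((d * θ : ℝ) * Complex.I) * r) (rotateVec p q d θ v)
      (rotateVec p q d θ v') = polarForm p q d f g h r v v' := by
  have hmem : (r : ℂ) ∈ Metric.ball (0 : ℂ) L := ofReal_mem_ball ⟨by linarith [hr.1, hr.2], hr.2⟩
  rw [hrot.form_rotateVec hinv θ hmem (by exact_mod_cast hr.1.ne'),
    hrot.form_eq_polarForm hd hnormal hdiag hr (hfgh r hr)]

/-- The field of `pX₁ + qY₁` vanishes at the centre, so pairing it with `X₁` and `Y₁` gives the two
linear relations. The rest holds because the pull-back of a smooth metric is smooth on the disc. -/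
theorem HasRotation.conditions_of_smoothMetric [IsManifold (𝓡 7) ∞ M] (hL : 0 < L)
    (hrot : T.HasRotation p q d) (hd : d ≠ 0)
    {m : PointwiseMetric M} (hinv : m.InvariantOn T.singularOrbitᶜ) (hnormal : T.IsNormal m)
    (hdiag : T.IsDiagonal m) {f g h : Fin 3 → ℝ → ℝ}
    (hfgh : ∀ t ∈ Ioo 0 L, T.HasCoefficients t (m.inner (T.curve t)) f g h)
    (S : SmoothMetric M) (hS : ∀ x ∈ T.singularOrbitᶜ, S.inner x = m.inner x)
    (hS0 : T.HasCoefficients 0 (S.inner (T.curve 0)) f g h) :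
    (p * f 0 0 = -(q * h 0 0) ∧ q * g 0 0 = -(p * h 0 0)) ∧
    ((IsEvenAtZero L (f 0) ∧ IsEvenAtZero L (g 0) ∧ IsEvenAtZero L (h 0)) ∧
      p ^ 2 * secondDerivAtZero L (f 0) + q ^ 2 * secondDerivAtZero L (g 0)
        + 2 * p * q * secondDerivAtZero L (h 0) = 2 * d ^ 2) ∧
      IsPowTimesEven L 0 d.natAbs (fun t => f 1 t + f 2 t) ∧
      IsPowTimesEven L (4 * p.natAbs) d.natAbs (fun t => f 1 t - f 2 t) ∧
      IsPowTimesEven L 0 d.natAbs (fun t => g 1 t + g 2 t) ∧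
      IsPowTimesEven L (4 * q.natAbs) d.natAbs (fun t => g 1 t - g 2 t) ∧
      IsPowTimesEven L (2 * (q - p).natAbs) d.natAbs (fun t => h 1 t + h 2 t) ∧
      IsPowTimesEven L (2 * (q + p).natAbs) d.natAbs (fun t => h 1 t - h 2 t) := by
  have h0 := (T.hasCoefficients_zero_iff (B := S.inner)).1 hS0
  have hZ := hrot.vec_zero_slope hL
  have hZ' : ((Pi.single 0 (p : ℝ), Pi.single 0 (q : ℝ), 0) : (Fin 3 → ℝ) × (Fin 3 → ℝ) × ℂ)
      = (p : ℝ) • (Pi.single 0 1, 0, 0) + (q : ℝ) • (0, Pi.single 0 1, 0) := by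
    refine Prod.ext ?_ (Prod.ext ?_ ?_) <;> simp [← Pi.single_smul]
  have hzero : ∀ v, T.form S.inner 0 (Pi.single 0 (p : ℝ), Pi.single 0 (q : ℝ), 0) v = 0 := by
    intro v
    rw [form, hZ]
    simp
  have hsymm : ∀ v v', T.form S.inner 0 v v' = T.form S.inner 0 v' v := fun v v' =>
    S.symm _ _ _
  have h1 : p * f 0 0 = -(q * h 0 0) := by
    have := hzero (Pi.single 0 1, 0, 0)
    rw [hZ', form_add_left, form_smul_left, form_smul_left, ← (h0 0).1, hsymm, ← (h0 0).2.2] at this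
    linarith
  have h2 : q * g 0 0 = -(p * h 0 0) := by
    have := hzero (0, Pi.single 0 1, 0)
    rw [hZ', form_add_left, form_smul_left, form_smul_left, ← (h0 0).2.1, ← (h0 0).2.2] at this
    linarith
  refine ⟨⟨h1, h2⟩, ?_⟩
  refine conditions_of_smooth_form (P := T.form S.inner) hL hd (fun v v' z hz => ?_)
    (fun r hr θ v v' => ?_) (fun i => (h0 i).1) (fun i => (h0 i).2.1) (fun i => (h0 i).2.2) h1 h2
  · exact (T.contDiffAt_form hz (S.contMDiff _) v v').contDiffWithinAt
  · rw [← hrot.form_rotate_eq_polarForm hd hinv hnormal hdiag hfgh hr θ v v']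
    have hmem : (r : ℂ) ∈ Metric.ball (0 : ℂ) L :=
      ofReal_mem_ball ⟨by linarith [hr.1, hr.2], hr.2⟩
    have hne : Complex.exp ((d * θ : ℝ) * Complex.I) * r ≠ 0 :=
      mul_ne_zero (Complex.exp_ne_zero _) (by exact_mod_cast hr.1.ne')
    exact congrArg (fun B : EuclideanSpace ℝ (Fin 7) →L[ℝ] EuclideanSpace ℝ (Fin 7) →L[ℝ] ℝ =>
      B (T.vec _ _) (T.vec _ _))
      (hS _ (T.slice_mem_compl_singularOrbit (exp_mul_mem_ball (d * θ) hmem) hne))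

end Tube

/-! ### Local sections, and forms given by their values on a frame -/

section Manifold

variable {M : Type*} [TopologicalSpace M] [ChartedSpace (EuclideanSpace ℝ (Fin 7)) M]

/-- The inverse function theorem for a parametrization of a manifold. -/
theorem exists_local_section [IsManifold (𝓡 7) ∞ M] {Ψ : EuclideanSpace ℝ (Fin 7) → M}
    (hΨ : ContMDiffAt 𝓘(ℝ, EuclideanSpace ℝ (Fin 7)) (𝓡 7) ∞ Ψ 0)
    (hd : ∀ y, modelDeriv 𝓘(ℝ, EuclideanSpace ℝ (Fin 7)) (𝓡 7) Ψ 0 y = y) :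
    ∃ σ : M → EuclideanSpace ℝ (Fin 7),
      ContMDiffAt (𝓡 7) 𝓘(ℝ, EuclideanSpace ℝ (Fin 7)) ∞ σ (Ψ 0) ∧ σ (Ψ 0) = 0 ∧
      ∀ᶠ x in 𝓝 (Ψ 0), Ψ (σ x) = x := by
  set φ := extChartAt (𝓡 7) (Ψ 0) with hφ
  have hsm : ContDiffAt ℝ ∞ (fun y => φ (Ψ y)) 0 :=
    contMDiffAt_iff_contDiffAt.1 (contMDiffAt_extChartAt.comp (0 : EuclideanSpace ℝ (Fin 7)) hΨ)
  have hder : HasFDerivAt (fun y => φ (Ψ y))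
      ((ContinuousLinearEquiv.refl ℝ (EuclideanSpace ℝ (Fin 7)) :
        EuclideanSpace ℝ (Fin 7) ≃L[ℝ] EuclideanSpace ℝ (Fin 7)) :
        EuclideanSpace ℝ (Fin 7) →L[ℝ] EuclideanSpace ℝ (Fin 7)) 0 := by
    have h1 := (hΨ.mdifferentiableAt (by simp)).hasMFDerivAt.2
    rw [modelWithCornersSelf_coe, range_id] at h1
    have h2 : (mfderiv 𝓘(ℝ, EuclideanSpace ℝ (Fin 7)) (𝓡 7) Ψ 0 :
        EuclideanSpace ℝ (Fin 7) →L[ℝ] EuclideanSpace ℝ (Fin 7))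
        = ContinuousLinearMap.id ℝ (EuclideanSpace ℝ (Fin 7)) := ContinuousLinearMap.ext hd
    rw [ContinuousLinearEquiv.coe_refl, ← h2]
    exact h1.hasFDerivAt univ_mem
  have hn : (∞ : ℕ∞ω) ≠ 0 := by simp
  set τ := hsm.localInverse hder hn with hτ
  have hτs : ContDiffAt ℝ ∞ τ (φ (Ψ 0)) := hsm.to_localInverse hder hn
  have hτ0 : τ (φ (Ψ 0)) = 0 := hsm.localInverse_apply_image hder hn
  have hσ : ContMDiffAt (𝓡 7) 𝓘(ℝ, EuclideanSpace ℝ (Fin 7)) ∞ (fun x => τ (φ x)) (Ψ 0) :=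
    ContMDiffAt.comp (Ψ 0) hτs.contMDiffAt contMDiffAt_extChartAt
  refine ⟨fun x => τ (φ x), hσ, hτ0, ?_⟩
  have h1 : ∀ᶠ w in 𝓝 (φ (Ψ 0)), φ (Ψ (τ w)) = w :=
    (hsm.hasStrictFDerivAt' hder hn).eventually_right_inverse
  have h2 : ∀ᶠ x in 𝓝 (Ψ 0), φ (Ψ (τ (φ x))) = φ x :=
    (continuousAt_extChartAt (I := 𝓡 7) (Ψ 0)).eventually h1
  have h3 : ContinuousAt (fun x => Ψ (τ (φ x))) (Ψ 0) :=
    ContinuousAt.comp_of_eq hΨ.continuousAt hσ.continuousAt hτ0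
  -- The right inverse is known only after applying the chart, which is injective on its source
  -- alone.
  have h4 : ∀ᶠ x in 𝓝 (Ψ 0), Ψ (τ (φ x)) ∈ φ.source :=
    h3.preimage_mem_nhds (extChartAt_source_mem_nhds' (by rw [hτ0]; exact mem_extChartAt_source _))
  filter_upwards [h2, h4, extChartAt_source_mem_nhds (I := 𝓡 7) (Ψ 0)] with x hx1 hx2 hx3
  exact φ.injOn hx2 hx3 hx1

/-- The coordinates of a tangent vector at `x` in the trivialization at `x₀`. -/
noncomputable def tangentCoord (x₀ x : M) [IsManifold (𝓡 7) ∞ M] (v : EuclideanSpace ℝ (Fin 7)) :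
    EuclideanSpace ℝ (Fin 7) :=
  (trivializationAt (EuclideanSpace ℝ (Fin 7)) (TangentSpace (𝓡 7)) x₀ (toTangent x v)).2

/-- The coordinates of a bilinear form at `x` in the trivialization at `x₀`. -/
noncomputable def formCoord [IsManifold (𝓡 7) ∞ M] (x₀ x : M)
    (B : EuclideanSpace ℝ (Fin 7) →L[ℝ] EuclideanSpace ℝ (Fin 7) →L[ℝ] ℝ) :
    EuclideanSpace ℝ (Fin 7) →L[ℝ] EuclideanSpace ℝ (Fin 7) →L[ℝ] ℝ :=
  (trivializationAt (EuclideanSpace ℝ (Fin 7) →L[ℝ] EuclideanSpace ℝ (Fin 7) →L[ℝ] ℝ)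
    (fun x : M => TangentSpace (𝓡 7) x →L[ℝ] TangentSpace (𝓡 7) x →L[ℝ] ℝ) x₀
    ⟨x, B⟩).2

/-- The trivialization of the bundle of forms is induced by that of the tangent bundle, so pairings
can be computed in coordinates. -/
theorem formCoord_tangentCoord [IsManifold (𝓡 7) ∞ M] {x₀ x : M}
    (hx : x ∈ (chartAt (EuclideanSpace ℝ (Fin 7)) x₀).source)
    (B : EuclideanSpace ℝ (Fin 7) →L[ℝ] EuclideanSpace ℝ (Fin 7) →L[ℝ] ℝ)
    (v w : EuclideanSpace ℝ (Fin 7)) :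
    formCoord x₀ x B (tangentCoord x₀ x v) (tangentCoord x₀ x w) = B v w := by
  have hx' : x ∈ (trivializationAt (EuclideanSpace ℝ (Fin 7))
      (fun x : M => TangentSpace (𝓡 7) x) x₀).baseSet := hx
  have h := inCoordinates_apply_eq₂
    (F₁ := EuclideanSpace ℝ (Fin 7)) (E₁ := fun x : M => TangentSpace (𝓡 7) x)
    (F₂ := EuclideanSpace ℝ (Fin 7)) (E₂ := fun x : M => TangentSpace (𝓡 7) x)
    (F₃ := ℝ) (E₃ := Bundle.Trivial M ℝ) (x₀ := x₀) (x := x)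
    (ϕ := B) (v := tangentCoord x₀ x v) (w := tangentCoord x₀ x w) hx' hx' (mem_univ x)
  have e : ∀ v : EuclideanSpace ℝ (Fin 7), (trivializationAt (EuclideanSpace ℝ (Fin 7))
      (fun x : M => TangentSpace (𝓡 7) x) x₀).symm x (tangentCoord x₀ x v) = v := fun v =>
    Trivialization.symm_apply_apply_mk _ hx' v
  refine Eq.trans ?_ (h.trans ?_)
  · rfl
  · rw [e, e]
    change (Bundle.Trivial.trivialization M ℝ).linearMapAt ℝ x (B v w) = B v w
    rw [Bundle.Trivial.linearMapAt_trivialization]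
    rfl

/-- `tangentCoord` as a linear equivalence. -/
theorem exists_tangentCoord_equiv [IsManifold (𝓡 7) ∞ M] {x₀ x : M}
    (hx : x ∈ (chartAt (EuclideanSpace ℝ (Fin 7)) x₀).source) :
    ∃ e : EuclideanSpace ℝ (Fin 7) ≃L[ℝ] EuclideanSpace ℝ (Fin 7),
      ∀ v, e v = tangentCoord x₀ x v :=
  ⟨(trivializationAt (EuclideanSpace ℝ (Fin 7))
      (fun x : M => TangentSpace (𝓡 7) x) x₀).continuousLinearEquivAt ℝ x hx, fun _ => rfl⟩

theorem exists_formCoord_eq [IsManifold (𝓡 7) ∞ M] (x₀ x : M)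
    (hx : x ∈ (chartAt (EuclideanSpace ℝ (Fin 7)) x₀).source)
    (N : EuclideanSpace ℝ (Fin 7) →L[ℝ] EuclideanSpace ℝ (Fin 7) →L[ℝ] ℝ) :
    ∃ B, formCoord x₀ x B = N := by
  have hx' : x ∈ (trivializationAt (EuclideanSpace ℝ (Fin 7) →L[ℝ] EuclideanSpace ℝ (Fin 7) →L[ℝ] ℝ)
    (fun x : M => TangentSpace (𝓡 7) x →L[ℝ] TangentSpace (𝓡 7) x →L[ℝ] ℝ) x₀).baseSet :=
    ⟨hx, hx, mem_univ _⟩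
  exact ⟨(trivializationAt (EuclideanSpace ℝ (Fin 7) →L[ℝ] EuclideanSpace ℝ (Fin 7) →L[ℝ] ℝ)
    (fun x : M => TangentSpace (𝓡 7) x →L[ℝ] TangentSpace (𝓡 7) x →L[ℝ] ℝ) x₀).symm x N,
    congrArg Prod.snd (Trivialization.apply_mk_symm _ hx' N)⟩

theorem formCoord_injective [IsManifold (𝓡 7) ∞ M] {x₀ x : M}
    (hx : x ∈ (chartAt (EuclideanSpace ℝ (Fin 7)) x₀).source) :
    Function.Injective (formCoord x₀ x) := by
  intro B B' h
  ext v w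
  rw [← formCoord_tangentCoord hx B v w, ← formCoord_tangentCoord hx B' v w, h]

set_option synthInstance.maxHeartbeats 200000 in
/-- A family of forms with smooth coefficients in a smooth frame is smooth. -/
theorem exists_smooth_formFamily [IsManifold (𝓡 7) ∞ M] {x₀ : M}
    {A : M → EuclideanSpace ℝ (Fin 7) →ₗ[ℝ] EuclideanSpace ℝ (Fin 7)} (hA0 : A x₀ = LinearMap.id)
    (hA : ∀ y, ContMDiffAt (𝓡 7) ((𝓡 7).prod 𝓘(ℝ, EuclideanSpace ℝ (Fin 7))) ∞
      (fun x => toTangent x (A x y)) x₀)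
    {g : EuclideanSpace ℝ (Fin 7) → EuclideanSpace ℝ (Fin 7) → M → ℝ}
    (hg : ∀ y y', ContMDiffAt (𝓡 7) 𝓘(ℝ, ℝ) ∞ (g y y') x₀) :
    ∃ n : FormFamily M, n.SmoothAt ∞ x₀ ∧ ∀ᶠ x in 𝓝 x₀,
      ∀ B : EuclideanSpace ℝ (Fin 7) →L[ℝ] EuclideanSpace ℝ (Fin 7) →L[ℝ] ℝ,
        (∀ y y', B (A x y) (A x y') = g y y' x) → n.eval x = B := by
  set ε : Fin 7 → EuclideanSpace ℝ (Fin 7) := fun i => EuclideanSpace.single i 1 with hε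
  have hsum : ∀ y : EuclideanSpace ℝ (Fin 7), y = ∑ i, y i • ε i := fun y => by
    have := (EuclideanSpace.basisFun (Fin 7) ℝ).sum_repr y
    simpa [hε] using this.symm
  -- `C` is the matrix of the frame in the trivialization. It is invertible at `x₀`, hence nearby,
  -- and the coordinates `N` of the form are the values `g` on the frame transported by the inverse
  -- `R` of `C`.
  set C : M → EuclideanSpace ℝ (Fin 7) →L[ℝ] EuclideanSpace ℝ (Fin 7) := fun x =>
    ∑ i, ContinuousLinearMap.smulRightL ℝ _ _ (EuclideanSpace.proj i)
      (tangentCoord x₀ x (A x (ε i))) with hC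
  have hsrc := (chartAt (EuclideanSpace ℝ (Fin 7)) x₀).open_source.mem_nhds
    (mem_chart_source (EuclideanSpace ℝ (Fin 7)) x₀)
  have hCA : ∀ x ∈ (chartAt (EuclideanSpace ℝ (Fin 7)) x₀).source, ∀ y,
      C x y = tangentCoord x₀ x (A x y) := by
    intro x hx y
    obtain ⟨e, he⟩ := exists_tangentCoord_equiv hx
    conv_rhs => rw [hsum y]
    simp [hC, ← he, map_sum]
  have hCs : ContMDiffAt (𝓡 7) 𝓘(ℝ, EuclideanSpace ℝ (Fin 7) →L[ℝ] EuclideanSpace ℝ (Fin 7)) ∞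
      C x₀ := by
    refine contMDiffAt_finsetSum fun i _ => ?_
    exact contMDiffAt_const.clm_apply (contMDiffAt_totalSpace.1 (hA (ε i))).2
  obtain ⟨e₀, he₀⟩ := exists_tangentCoord_equiv (mem_chart_source (EuclideanSpace ℝ (Fin 7)) x₀)
  have hC0 : C x₀ = e₀ := by
    ext1 y
    rw [hCA x₀ (mem_chart_source _ _), hA0, LinearMap.id_apply]
    exact (he₀ y).symm
  set R : M → EuclideanSpace ℝ (Fin 7) →L[ℝ] EuclideanSpace ℝ (Fin 7) := fun x =>
    ContinuousLinearMap.inverse (C x) with hR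
  have hRs : ContMDiffAt (𝓡 7) 𝓘(ℝ, EuclideanSpace ℝ (Fin 7) →L[ℝ] EuclideanSpace ℝ (Fin 7)) ∞
      R x₀ :=
    ContMDiffAt.comp_of_eq (contDiffAt_map_inverse e₀).contMDiffAt hCs hC0
  set N : M → EuclideanSpace ℝ (Fin 7) →L[ℝ] EuclideanSpace ℝ (Fin 7) →L[ℝ] ℝ := fun x =>
    ∑ i, ∑ j, g (ε i) (ε j) x • ContinuousLinearMap.smulRightL ℝ _ _
      ((EuclideanSpace.proj i : EuclideanSpace ℝ (Fin 7) →L[ℝ] ℝ).comp (R x))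
      ((EuclideanSpace.proj j : EuclideanSpace ℝ (Fin 7) →L[ℝ] ℝ).comp (R x)) with hN
  have hNs : ContMDiffAt (𝓡 7)
      𝓘(ℝ, EuclideanSpace ℝ (Fin 7) →L[ℝ] EuclideanSpace ℝ (Fin 7) →L[ℝ] ℝ) ∞ N x₀ := by
    refine contMDiffAt_finsetSum fun i _ => contMDiffAt_finsetSum fun j _ => ?_
    exact (hg _ _).smul ((contMDiffAt_const.clm_apply (contMDiffAt_const.clm_comp hRs)).clm_apply
      (contMDiffAt_const.clm_comp hRs))
  -- Outside the chart the form is arbitrary; only its germ at `x₀` matters.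
  choose! n hn using fun x hx => exists_formCoord_eq x₀ x hx (N x)
  refine ⟨n, ?_, ?_⟩
  · refine contMDiffAt_totalSpace.2 ⟨contMDiffAt_id, hNs.congr_of_eventuallyEq ?_⟩
    filter_upwards [hsrc] with x hx
    exact hn x hx
  · have hinv : ∀ᶠ x in 𝓝 x₀, ∃ e : EuclideanSpace ℝ (Fin 7) ≃L[ℝ] EuclideanSpace ℝ (Fin 7),
        (e : EuclideanSpace ℝ (Fin 7) →L[ℝ] EuclideanSpace ℝ (Fin 7)) = C x :=
      hCs.continuousAt.eventually (by rw [hC0]; exact ContinuousLinearEquiv.nhds e₀)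
    filter_upwards [hsrc, hinv] with x hx ⟨e, he⟩ B hB
    refine formCoord_injective hx ((hn x hx).trans ?_)
    ext u w
    have hRe : R x = e.symm := by
      rw [hR]
      beta_reduce
      rw [← he, ContinuousLinearMap.inverse_equiv]
    have hu : ∀ u, u = tangentCoord x₀ x (A x (e.symm u)) := fun u => by
      rw [← hCA x hx, ← he]
      simp
    conv_rhs => rw [hu u, hu w, formCoord_tangentCoord hx, hsum (e.symm u), hsum (e.symm w)]
    simp only [map_sum, map_smul, sum_apply, smul_apply, hB, hN, hRe]
    simp only [ContinuousLinearMap.smulRightL_apply_apply, ContinuousLinearMap.smulRight_apply,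
      ContinuousLinearMap.comp_apply, ContinuousLinearEquiv.coe_coe, EuclideanSpace.coe_proj,
      smul_apply, smul_eq_mul, Finset.mul_sum]
    rw [Finset.sum_comm]
    exact Finset.sum_congr rfl fun i _ => Finset.sum_congr rfl fun j _ => by ring

end Manifold

/-! ### Extension of the metric across the singular orbit -/

namespace Tube

variable {M : Type*} [TopologicalSpace M] [ChartedSpace (EuclideanSpace ℝ (Fin 7)) M]
  [MulAction G M] {H K : Subgroup G} {L : ℝ} (T : Tube M H K L)

/-- The tangent vector at `a • slice z` given by an element of the Lie algebra of `G` and a vector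
tangent to the slice. -/
noncomputable def vecAt (a : G) (z : ℂ) :
    ((Fin 3 → ℝ) × (Fin 3 → ℝ) × ℂ) →ₗ[ℝ] EuclideanSpace ℝ (Fin 7) :=
  (modelDeriv (𝓡 7) (𝓡 7) (fun y : M => a • y) (T.slice z)).toLinearMap ∘ₗ T.vec z

theorem vecAt_apply (a : G) (z : ℂ) (v : (Fin 3 → ℝ) × (Fin 3 → ℝ) × ℂ) :
    T.vecAt a z v = modelDeriv (𝓡 7) (𝓡 7) (fun y : M => a • y) (T.slice z) (T.vec z v) := rfl

theorem vec_surjective {z : ℂ} (hz : z ∈ Metric.ball (0 : ℂ) L) :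
    Function.Surjective (T.vec z) := by
  intro u
  obtain ⟨α, β, w, h⟩ := T.transverse z hz u
  exact ⟨(α, β, w), h.symm⟩

theorem _root_.CohomOne.PointwiseMetric.InvariantOn.eval_vecAt {T : Tube M H K L}
    {m : PointwiseMetric M} (hinv : m.InvariantOn T.singularOrbitᶜ) (a : G) {z : ℂ}
    (hz : z ∈ Metric.ball (0 : ℂ) L) (hz0 : z ≠ 0) (v v' : (Fin 3 → ℝ) × (Fin 3 → ℝ) × ℂ) :
    FormFamily.eval m.inner (a • T.slice z) (T.vecAt a z v) (T.vecAt a z v')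
      = T.form m.inner z v v' :=
  hinv.eval a (T.slice_mem_compl_singularOrbit hz hz0) _ _

set_option synthInstance.maxHeartbeats 200000 in
theorem vecAt_one (v : (Fin 3 → ℝ) × (Fin 3 → ℝ) × ℂ) (z : ℂ) :
    T.vecAt 1 z v = T.vec z v := by
  have h : (fun y : M => (1 : G) • y) = id := funext (one_smul G)
  rw [vecAt_apply, h]
  exact congrArg (fun A : EuclideanSpace ℝ (Fin 7) →L[ℝ] EuclideanSpace ℝ (Fin 7) => A _)
    (mfderiv_id (I := 𝓡 7) (x := T.slice z))

variable [ContMDiffSMul IG (𝓡 7) ∞ G M]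

theorem mdifferentiable_smul (a : G) : MDifferentiable (𝓡 7) (𝓡 7) (fun y : M => a • y) :=
  (ContMDiffSMul.contMDiff_const_smul (I := IG) (n := ∞) a).mdifferentiable (by simp)

set_option synthInstance.maxHeartbeats 200000 in
theorem modelDeriv_smul_surjective (a : G) (x : M) :
    Function.Surjective (modelDeriv (𝓡 7) (𝓡 7) (fun y : M => a • y) x) := by
  intro u
  refine ⟨modelDeriv (𝓡 7) (𝓡 7) (fun y : M => a⁻¹ • y) (a • x) u, ?_⟩
  rw [← modelDeriv_comp_apply (mdifferentiable_smul a x) (mdifferentiable_smul a⁻¹ (a • x))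
    (inv_smul_smul a x)]
  have h : (fun y : M => a • a⁻¹ • y) = id := funext fun y => smul_inv_smul a y
  rw [h]
  exact congrArg (fun A : EuclideanSpace ℝ (Fin 7) →L[ℝ] EuclideanSpace ℝ (Fin 7) => A u)
    (mfderiv_id (I := 𝓡 7) (x := a • x))

theorem vecAt_surjective (a : G) {z : ℂ} (hz : z ∈ Metric.ball (0 : ℂ) L) :
    Function.Surjective (T.vecAt a z) :=
  (modelDeriv_smul_surjective a _).comp (T.vec_surjective hz)

theorem initialVelocity_smul_stdCurve (a : G) (v : (Fin 3 → ℝ) × (Fin 3 → ℝ) × ℂ) {z : ℂ}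
    (hz : z ∈ Metric.ball (0 : ℂ) L) :
    initialVelocity (𝓡 7) (fun s => a • T.stdCurve v z s) = T.vecAt a z v := by
  have h2 : ContMDiffAt 𝓘(ℝ, ℝ) (𝓡 7) ∞ (T.stdCurve v z) 0 :=
    ContMDiffAt.comp (0 : ℝ) (g := Function.uncurry (T.stdCurve v)) (f := fun s => (z, s))
      (T.contMDiffAt_stdCurve v hz) (contMDiffAt_const.prodMk contMDiffAt_id)
  rw [initialVelocity_comp (mdifferentiable_smul a _) (h2.mdifferentiableAt (by simp))
    (T.stdCurve_zero v z), T.initialVelocity_stdCurve v hz, vecAt_apply]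

theorem contMDiffAt_vecAt [IsManifold (𝓡 7) ∞ M] {E H' N : Type*} [NormedAddCommGroup E]
    [NormedSpace ℝ E] [TopologicalSpace H'] {J : ModelWithCorners ℝ E H'} [TopologicalSpace N]
    [ChartedSpace H' N] [IsManifold J 1 N] (v : (Fin 3 → ℝ) × (Fin 3 → ℝ) × ℂ)
    {a : N → G} {z : N → ℂ} {n : N} (ha : ContMDiffAt J IG ∞ a n)
    (hz : ContMDiffAt J 𝓘(ℝ, ℂ) ∞ z n) (hzn : z n ∈ Metric.ball (0 : ℂ) L) :
    ContMDiffAt J ((𝓡 7).prod 𝓘(ℝ, EuclideanSpace ℝ (Fin 7))) ∞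
      (fun y => toTangent (a y • T.slice (z y)) (T.vecAt (a y) (z y) v)) n := by
  have hF : ContMDiffAt (J.prod 𝓘(ℝ, ℝ)) (𝓡 7) ∞
      (Function.uncurry fun y s => a y • T.stdCurve v (z y) s) (n, 0) := by
    have h1 : ContMDiffAt (J.prod 𝓘(ℝ, ℝ)) IG ∞ (fun y : N × ℝ => a y.1) (n, 0) :=
      ContMDiffAt.comp (n, (0 : ℝ)) (g := a) ha contMDiffAt_fst
    have h2 : ContMDiffAt (J.prod 𝓘(ℝ, ℝ)) (𝓘(ℝ, ℂ).prod 𝓘(ℝ, ℝ)) ∞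
        (fun y : N × ℝ => (z y.1, y.2)) (n, 0) :=
      (ContMDiffAt.comp (n, (0 : ℝ)) (g := z) hz contMDiffAt_fst).prodMk contMDiffAt_snd
    exact h1.smul (ContMDiffAt.comp (n, (0 : ℝ)) (T.contMDiffAt_stdCurve v hzn) h2)
  refine (contMDiffAt_initialVelocity hF).congr_of_eventuallyEq ?_
  filter_upwards [hz.continuousAt.preimage_mem_nhds (Metric.isOpen_ball.mem_nhds hzn)] with y hy
  rw [T.stdCurve_zero, T.initialVelocity_smul_stdCurve (a y) v hy]

variable {T} {p q d : ℤ}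

/-- Every point of the punctured disc is a rotation of a positive real one, where both sides are the
same explicit form. -/
theorem HasRotation.form_eq (hrot : T.HasRotation p q d) (hd : d ≠ 0)
    {m : PointwiseMetric M} (hinv : m.InvariantOn T.singularOrbitᶜ) (hnormal : T.IsNormal m)
    (hdiag : T.IsDiagonal m) {f g h : Fin 3 → ℝ → ℝ}
    (hfgh : ∀ t ∈ Ioo 0 L, T.HasCoefficients t (m.inner (T.curve t)) f g h)
    {P : ℂ → (Fin 3 → ℝ) × (Fin 3 → ℝ) × ℂ → (Fin 3 → ℝ) × (Fin 3 → ℝ) × ℂ → ℝ}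
    (hP : ∀ r ∈ Ioo 0 L, ∀ θ v v', P (Complex.exp ((d * θ : ℝ) * Complex.I) * r)
      (rotateVec p q d θ v) (rotateVec p q d θ v') = polarForm p q d f g h r v v')
    {z : ℂ} (hz : z ∈ Metric.ball (0 : ℂ) L) (hz0 : z ≠ 0)
    (v v' : (Fin 3 → ℝ) × (Fin 3 → ℝ) × ℂ) : T.form m.inner z v v' = P z v v' := by
  obtain ⟨θ, hθ⟩ := exists_eq_exp_mul_norm hd z
  have hr := norm_mem_Ioo hz hz0
  rw [hθ, ← rotateVec_rotateVec_neg p q d θ v, ← rotateVec_rotateVec_neg p q d θ v', hP _ hr,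
    hrot.form_rotate_eq_polarForm hd hinv hnormal hdiag hfgh hr]

variable [IsManifold (𝓡 7) ∞ M]

variable (T) in
/-- The values at the singular orbit of a continuous extension of the metric. -/
theorem eval_vecAt_zero (hL : 0 < L) {m : FormFamily M}
    {P : ℂ → (Fin 3 → ℝ) × (Fin 3 → ℝ) × ℂ → (Fin 3 → ℝ) × (Fin 3 → ℝ) × ℂ → ℝ}
    (hP : ∀ v v', ContDiffOn ℝ ∞ (fun z => P z v v') (Metric.ball 0 L)) {a : G}
    (hPm : ∀ z ∈ Metric.ball (0 : ℂ) L, z ≠ 0 → ∀ v v',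
      m.eval (a • T.slice z) (T.vecAt a z v) (T.vecAt a z v') = P z v v')
    {n : FormFamily M} (hn : n.SmoothAt 0 (a • T.slice 0))
    (hnm : ∀ᶠ x in 𝓝 (a • T.slice 0), x ∈ T.singularOrbitᶜ → n.eval x = m.eval x)
    (v v' : (Fin 3 → ℝ) × (Fin 3 → ℝ) × ℂ) :
    n.eval (a • T.slice 0) (T.vecAt a 0 v) (T.vecAt a 0 v') = P 0 v v' := by
  have h0 := Metric.mem_ball_self (x := (0 : ℂ)) hL
  have hv : ∀ v, ContMDiffAt 𝓘(ℝ, ℂ) ((𝓡 7).prod 𝓘(ℝ, EuclideanSpace ℝ (Fin 7))) 0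
      (fun z => toTangent (a • T.slice z) (T.vecAt a z v)) 0 := fun v =>
    (T.contMDiffAt_vecAt v (a := fun _ => a) (z := fun z => z) contMDiffAt_const contMDiffAt_id
      h0).of_le (by simp)
  have hc : ContinuousAt (fun z => n.eval (a • T.slice z) (T.vecAt a z v) (T.vecAt a z v')) 0 :=
    (FormFamily.SmoothAt.eval_apply (b := fun z => a • T.slice z) (y := (0 : ℂ)) hn (hv v)
      (hv v')).continuousAt
  have hPc : ContinuousAt (fun z => P z v v') 0 :=
    (hP v v').continuousOn.continuousAt (Metric.ball_mem_nhds 0 hL)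
  have hs : ContinuousAt (fun z => a • T.slice z) 0 :=
    (contMDiffAt_totalSpace.1 (hv 0)).1.continuousAt
  -- Both sides are continuous in `z` and agree for `z ≠ 0`.
  refine tendsto_nhds_unique (hc.tendsto.mono_left (nhdsWithin_le_nhds (s := {0}ᶜ)))
    ((hPc.tendsto.mono_left (nhdsWithin_le_nhds (s := {0}ᶜ))).congr' ?_)
  filter_upwards [nhdsWithin_le_nhds (hs.eventually hnm), self_mem_nhdsWithin,
    nhdsWithin_le_nhds (Metric.ball_mem_nhds (0 : ℂ) hL)] with z hz hz0 hzL
  rw [hz (T.smul_mem_compl_singularOrbit a (T.slice_mem_compl_singularOrbit hzL hz0)),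
    hPm z hzL hz0]

end Tube

theorem contMDiff_const_mul_expProd (b : S3) :
    ContMDiff 𝓘(ℝ, Fin 3 → ℝ) (𝓡 3) ∞ fun α => b * expProd α := by
  have h : ContDiff ℝ ∞ fun α : Fin 3 → ℝ => (expProd α : ℍ[ℝ]) :=
    ((contMDiff_coe_sphere (m := ∞)).comp contMDiff_expProd).contDiff
  exact (contDiff_const.mul h).contMDiff.codRestrict_sphere fun α => (b * expProd α : S3).2

namespace Tube

variable {M : Type*} [TopologicalSpace M] [ChartedSpace (EuclideanSpace ℝ (Fin 7)) M]
  [MulAction G M] {H K : Subgroup G} {L : ℝ} (T : Tube M H K L)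
  [ContMDiffSMul IG (𝓡 7) ∞ G M] [IsManifold (𝓡 7) ∞ M]

set_option synthInstance.maxHeartbeats 200000 in
/-- Near each point of the singular orbit the metric extends smoothly. -/
theorem exists_local_extension (hL : 0 < L) {m : FormFamily M}
    {P : ℂ → (Fin 3 → ℝ) × (Fin 3 → ℝ) × ℂ → (Fin 3 → ℝ) × (Fin 3 → ℝ) × ℂ → ℝ}
    (hP : ∀ v v', ContDiffOn ℝ ∞ (fun z => P z v v') (Metric.ball 0 L))
    (hPm : ∀ a : G, ∀ z ∈ Metric.ball (0 : ℂ) L, z ≠ 0 → ∀ v v',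
      m.eval (a • T.slice z) (T.vecAt a z v) (T.vecAt a z v') = P z v v') (a : G) :
    ∃ n : FormFamily M, n.SmoothAt ∞ (a • T.slice 0) ∧
      ∀ᶠ x in 𝓝 (a • T.slice 0), x ∈ T.singularOrbitᶜ → n.eval x = m.eval x := by
  have h0 := Metric.mem_ball_self (x := (0 : ℂ)) hL
  -- The Lie algebra plus the slice plane has dimension eight and the tangent space seven. A linear
  -- right inverse selects a complement of the kernel, and its image parametrizes a neighbourhood of
  -- the point.
  obtain ⟨D', hD'⟩ := (T.vecAt a 0).exists_rightInverse_of_surjective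
    (LinearMap.range_eq_top.2 (T.vecAt_surjective a h0))
  obtain ⟨D, hD⟩ : ∃ D : EuclideanSpace ℝ (Fin 7) →L[ℝ] (Fin 3 → ℝ) × (Fin 3 → ℝ) × ℂ,
      ∀ y, T.vecAt a 0 (D y) = y :=
    ⟨D'.toContinuousLinearMap, fun y => LinearMap.congr_fun hD' y⟩
  set α : EuclideanSpace ℝ (Fin 7) → G := fun y => a * (expProd (D y).1, expProd (D y).2.1)
    with hα
  set ζ : EuclideanSpace ℝ (Fin 7) → ℂ := fun y => (D y).2.2 with hζ
  have hα0 : α 0 = a := by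
    simp only [hα, map_zero, Prod.fst_zero, Prod.snd_zero, expProd_zero]
    exact mul_one a
  have hζ0 : ζ 0 = 0 := by simp [hζ]
  have hαs : ContMDiff 𝓘(ℝ, EuclideanSpace ℝ (Fin 7)) IG ∞ α := by
    exact ((contMDiff_const_mul_expProd a.1).comp (contDiff_fst.comp D.contDiff).contMDiff).prodMk
      ((contMDiff_const_mul_expProd a.2).comp
        (contDiff_fst.comp (contDiff_snd.comp D.contDiff)).contMDiff)
  have hζs : ContDiff ℝ ∞ ζ := contDiff_snd.comp (contDiff_snd.comp D.contDiff)
  set Ψ : EuclideanSpace ℝ (Fin 7) → M := fun y => α y • T.slice (ζ y) with hΨ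
  have hΨ0 : Ψ 0 = a • T.slice 0 := by simp only [hΨ, hα0, hζ0]
  have hΨs : ContMDiffAt 𝓘(ℝ, EuclideanSpace ℝ (Fin 7)) (𝓡 7) ∞ Ψ 0 :=
    ContMDiffAt.smul (I := IG) hαs.contMDiffAt
      (ContMDiffAt.comp_of_eq (T.contMDiffAt_slice h0) hζs.contMDiff.contMDiffAt hζ0)
  -- Along the line through `y` the parametrization is the translate by `a` of a standard curve, so
  -- its velocity is `vecAt a 0 (D y) = y`.
  have hΨd : ∀ y, modelDeriv 𝓘(ℝ, EuclideanSpace ℝ (Fin 7)) (𝓡 7) Ψ 0 y = y := by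
    intro y
    have hline : HasDerivAt (fun s : ℝ => s • y) y 0 := by
      simpa using (hasDerivAt_id (0 : ℝ)).smul_const y
    rw [← initialVelocity_comp_of_hasDerivAt hline (hΨs.mdifferentiableAt (by simp))
      (zero_smul ℝ y)]
    refine Eq.trans ?_ ((T.initialVelocity_smul_stdCurve a (D y) h0).trans (hD y))
    congr 1
    funext s
    simp only [hΨ, hα, hζ, map_smul, stdCurve, zero_add, Prod.smul_fst, Prod.smul_snd]
    exact (pair_smul_smul a _ _).symm
  obtain ⟨σ, hσ, hσ0, hΨσ⟩ := exists_local_section hΨs hΨd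
  rw [hΨ0] at hσ hσ0 hΨσ
  have hασ : ContMDiffAt (𝓡 7) IG ∞ (fun x => α (σ x)) (a • T.slice 0) :=
    ContMDiffAt.comp (a • T.slice 0) (g := α) (f := σ) hαs.contMDiffAt hσ
  have hζσ : ContMDiffAt (𝓡 7) 𝓘(ℝ, ℂ) ∞ (fun x => ζ (σ x)) (a • T.slice 0) :=
    ContMDiffAt.comp (a • T.slice 0) (g := ζ) (f := σ) hζs.contMDiff.contMDiffAt hσ
  have hζσ0 : ζ (σ (a • T.slice 0)) = 0 := by rw [hσ0, hζ0]
  have hmem : ζ (σ (a • T.slice 0)) ∈ Metric.ball (0 : ℂ) L := by rwa [hζσ0]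
  have : IsManifold (𝓡 7) 1 M := IsManifold.of_le (n := ∞) (by simp)
  obtain ⟨n, hn, hn'⟩ := exists_smooth_formFamily (x₀ := a • T.slice 0)
    (A := fun x => T.vecAt (α (σ x)) (ζ (σ x)) ∘ₗ D.toLinearMap)
    (by
      rw [hσ0, hα0, hζ0]
      exact LinearMap.ext hD)
    (fun y => by
      refine (T.contMDiffAt_vecAt (D y) hασ hζσ hmem).congr_of_eventuallyEq ?_
      filter_upwards [hΨσ] with x hx
      exact congrArg (fun x' => toTangent x' (T.vecAt (α (σ x)) (ζ (σ x)) (D y))) hx.symm)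
    (g := fun y y' x => P (ζ (σ x)) (D y) (D y'))
    (fun y y' => ContMDiffAt.comp_of_eq (x := a • T.slice 0) (g := fun z => P z (D y) (D y'))
      ((hP _ _).contDiffAt (Metric.ball_mem_nhds 0 hL)).contMDiffAt hζσ hζσ0)
  refine ⟨n, hn, ?_⟩
  filter_upwards [hn', hΨσ, hζσ.continuousAt.preimage_mem_nhds
    (Metric.isOpen_ball.mem_nhds hmem)] with x hx1 hx2 hx3 hxB
  have hz0 : ζ (σ x) ≠ 0 := by
    intro h
    apply hxB
    refine ⟨α (σ x), Eq.trans ?_ hx2⟩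
    simp only [hΨ, h, curve, Complex.ofReal_zero]
  refine hx1 _ fun y y' => ?_
  have h1 := hPm (α (σ x)) (ζ (σ x)) hx3 hz0 (D y) (D y')
  rwa [FormFamily.eval_congr m (show α (σ x) • T.slice (ζ (σ x)) = x from hx2)] at h1

set_option synthInstance.maxHeartbeats 200000 in
/-- Local extensions of the metric fit together. -/
theorem exists_smooth_extension [T2Space M] (hL : 0 < L) {m : PointwiseMetric M}
    (hm : m.SmoothOn T.singularOrbitᶜ)
    {P : ℂ → (Fin 3 → ℝ) × (Fin 3 → ℝ) × ℂ → (Fin 3 → ℝ) × (Fin 3 → ℝ) × ℂ → ℝ}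
    (hP : ∀ v v', ContDiffOn ℝ ∞ (fun z => P z v v') (Metric.ball 0 L))
    (hPm : ∀ a : G, ∀ z ∈ Metric.ball (0 : ℂ) L, z ≠ 0 → ∀ v v',
      FormFamily.eval m.inner (a • T.slice z) (T.vecAt a z v) (T.vecAt a z v') = P z v v') :
    ∃ n : FormFamily M, (∀ x, n.SmoothAt ∞ x) ∧ (∀ x ∈ T.singularOrbitᶜ, n x = m.inner x) ∧
      ∀ a v v', n.eval (a • T.slice 0) (T.vecAt a 0 v) (T.vecAt a 0 v') = P 0 v v' := by
  classical
  have h0 := Metric.mem_ball_self (x := (0 : ℂ)) hL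
  have hex : ∀ x, ∃ n : FormFamily M, x ∈ T.singularOrbit → n.SmoothAt ∞ x ∧
      ∀ᶠ y in 𝓝 x, y ∈ T.singularOrbitᶜ → n.eval y = FormFamily.eval m.inner y := by
    intro x
    by_cases hx : x ∈ T.singularOrbit
    · obtain ⟨a, rfl⟩ := hx
      obtain ⟨n, hn⟩ := T.exists_local_extension (m := m.inner) hL hP hPm a
      exact ⟨n, fun _ => by simpa only [curve, Complex.ofReal_zero] using hn⟩
    · exact ⟨m.inner, fun h => (hx h).elim⟩
  choose N hN using hex
  -- The orbit is the continuous image of the compact group `G` in a Hausdorff space.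
  have hclosed : IsClosed T.singularOrbit := by
    have hc : Continuous fun a : G => a • T.curve 0 :=
      (ContMDiffSMul.contMDiff_smul (I := IG) (I' := 𝓡 7) (n := ∞) (G := G)
        (M := M)).continuous.comp
        (continuous_id.prodMk continuous_const)
    exact (isCompact_range hc).isClosed
  have huniq : ∀ (a : G) (n : FormFamily M), n.SmoothAt 0 (a • T.slice 0) →
      (∀ᶠ y in 𝓝 (a • T.slice 0), y ∈ T.singularOrbitᶜ → n.eval y = FormFamily.eval m.inner y) →
      ∀ v v', n.eval (a • T.slice 0) (T.vecAt a 0 v) (T.vecAt a 0 v') = P 0 v v' :=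
    fun a n h1 h2 => T.eval_vecAt_zero hL hP (hPm a) h1 h2
  have huniq' : ∀ x ∈ T.singularOrbit, ∀ n n' : FormFamily M, n.SmoothAt 0 x → n'.SmoothAt 0 x →
      (∀ᶠ y in 𝓝 x, y ∈ T.singularOrbitᶜ → n.eval y = FormFamily.eval m.inner y) →
      (∀ᶠ y in 𝓝 x, y ∈ T.singularOrbitᶜ → n'.eval y = FormFamily.eval m.inner y) →
      n x = n' x := by
    rintro _ ⟨a, rfl⟩ n n' h1 h1' h2 h2'
    simp only [curve, Complex.ofReal_zero] at h1 h1' h2 h2' ⊢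
    change n.eval (a • T.slice 0) = n'.eval (a • T.slice 0)
    ext u w
    obtain ⟨v, rfl⟩ := T.vecAt_surjective a h0 u
    obtain ⟨v', rfl⟩ := T.vecAt_surjective a h0 w
    rw [huniq a n h1 h2, huniq a n' h1' h2']
  set n : FormFamily M := fun x => if x ∈ T.singularOrbit then N x x else m.inner x with hn
  have hnm : ∀ x ∈ T.singularOrbitᶜ, n x = m.inner x := fun x hx => if_neg hx
  have hnN : ∀ x ∈ T.singularOrbit, n x = N x x := fun x hx => if_pos hx
  -- At a nearby orbit point `y` the local extensions chosen at `x` and at `y` are both continuous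
  -- extensions of the metric, so they have the same value there.
  have hnear : ∀ x ∈ T.singularOrbit, ∀ᶠ y in 𝓝 x, n y = N x y := by
    intro x hx
    obtain ⟨h1, h2⟩ := hN x hx
    -- Smoothness of a finite order at a point passes to a neighbourhood; order `0` suffices for the
    -- uniqueness argument.
    have h3 : ∀ᶠ y in 𝓝 x, (N x).SmoothAt 0 y :=
      (contMDiffAt_iff_contMDiffAt_nhds (by simp)).1 (h1.of_le (by simp))
    filter_upwards [h2, h3, h2.eventually_nhds] with y hy2 hy3 hy2'
    by_cases hy : y ∈ T.singularOrbit
    · rw [hnN y hy]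
      exact huniq' y hy _ _ ((hN y hy).1.of_le (by simp)) hy3 (hN y hy).2 hy2'
    · rw [hnm y hy]
      exact (hy2 hy).symm
  have hsm : ∀ x, n.SmoothAt ∞ x := by
    intro x
    by_cases hx : x ∈ T.singularOrbit
    · refine (hN x hx).1.congr_of_eventuallyEq ?_
      filter_upwards [hnear x hx] with y hy
      rw [hy]
    · have hx' : T.singularOrbitᶜ ∈ 𝓝 x := hclosed.isOpen_compl.mem_nhds hx
      refine (hm.contMDiffAt hx').congr_of_eventuallyEq ?_
      filter_upwards [hx'] with y hy
      rw [hnm y hy]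
  refine ⟨n, hsm, hnm, fun a => huniq a n ((hsm _).of_le (by simp)) (Eventually.of_forall hnm)⟩

end Tube

/-! ### Positivity of the extended form and sufficiency of the conditions -/

/-- The unit ball of a positive definite form on a finite-dimensional space is bounded. -/
theorem isVonNBounded_of_pos {E : Type*} [NormedAddCommGroup E] [NormedSpace ℝ E]
    [FiniteDimensional ℝ E] (B : E →L[ℝ] E →L[ℝ] ℝ) (hB : ∀ v, v ≠ 0 → 0 < B v v) :
    Bornology.IsVonNBounded ℝ {v : E | B v v < 1} := by
  have : ProperSpace E := FiniteDimensional.proper ℝ E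
  rw [NormedSpace.isVonNBounded_iff, isBounded_iff_forall_norm_le]
  rcases (Metric.sphere (0 : E) 1).eq_empty_or_nonempty with hS | hS
  · refine ⟨0, fun v _ => ?_⟩
    by_contra! hv
    have : (‖v‖⁻¹ : ℝ) • v ∈ Metric.sphere (0 : E) 1 := by
      rw [mem_sphere_zero_iff_norm, norm_smul, norm_inv, norm_norm, inv_mul_cancel₀ hv.ne']
    simp [hS] at this
  · have hc : Continuous fun v => B v v := by fun_prop
    obtain ⟨u, hu, hmin⟩ := (isCompact_sphere (0 : E) 1).exists_isMinOn hS hc.continuousOn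
    have hu0 : u ≠ 0 := by
      rintro rfl
      simp at hu
    have hpos := hB u hu0
    refine ⟨Real.sqrt (1 / B u u), fun v hv => ?_⟩
    refine Real.le_sqrt_of_sq_le ?_
    rw [le_div_iff₀ hpos]
    rcases eq_or_ne v 0 with rfl | hv0
    · simp
    have hn : ‖v‖ ≠ 0 := norm_ne_zero_iff.2 hv0
    have h1 : (‖v‖⁻¹ : ℝ) • v ∈ Metric.sphere (0 : E) 1 := by
      rw [mem_sphere_zero_iff_norm, norm_smul, norm_inv, norm_norm, inv_mul_cancel₀ hn]
    have h2 : B u u ≤ B ((‖v‖⁻¹ : ℝ) • v) ((‖v‖⁻¹ : ℝ) • v) := hmin h1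
    simp only [map_smul, smul_apply, smul_eq_mul] at h2
    have h3 : ‖v‖ ^ 2 * (‖v‖⁻¹ * (‖v‖⁻¹ * B v v)) = B v v := by field_simp
    have h4 := mul_le_mul_of_nonneg_left h2 (sq_nonneg ‖v‖)
    rw [h3] at h4
    exact h4.trans (le_of_lt hv)

theorem coeffForm_symm (F G' H : Fin 3 → ℝ) (α β α' β' : Fin 3 → ℝ) :
    coeffForm F G' H α β α' β' = coeffForm F G' H α' β' α β :=
  Finset.sum_congr rfl fun i _ => by ring

/-- The limit form is positive outside the kernel. -/
theorem coeffForm_add_pos {p q : ℤ} {f g h : Fin 3 → ℝ → ℝ}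
    (hpos : ∀ α β : Fin 3 → ℝ,
      (¬ ∃ s : ℝ, α = ![s * p, 0, 0] ∧ β = ![s * q, 0, 0]) →
        0 < ∑ i, (f i 0 * α i ^ 2 + 2 * h i 0 * (α i * β i) + g i 0 * β i ^ 2))
    (h1 : p * f 0 0 = -(q * h 0 0)) (h2 : q * g 0 0 = -(p * h 0 0))
    (v : (Fin 3 → ℝ) × (Fin 3 → ℝ) × ℂ)
    (hv : ¬ ∃ s : ℝ, v = s • (Pi.single 0 (p : ℝ), Pi.single 0 (q : ℝ), 0)) :
    0 < coeffForm (f · 0) (g · 0) (h · 0) v.1 v.2.1 v.1 v.2.1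
      + (v.2.2 * (starRingEnd ℂ) v.2.2).re := by
  obtain ⟨α, β, w⟩ := v
  have hw : (w * (starRingEnd ℂ) w).re = Complex.normSq w := by
    rw [Complex.mul_conj, Complex.ofReal_re]
  have hc : coeffForm (f · 0) (g · 0) (h · 0) α β α β
      = ∑ i, (f i 0 * α i ^ 2 + 2 * h i 0 * (α i * β i) + g i 0 * β i ^ 2) :=
    Finset.sum_congr rfl fun i _ => by ring
  simp only [hw]
  -- On the line of `pX₁ + qY₁` the Lie algebra part vanishes, and the slice component must then be
  -- non-zero.
  by_cases hs : ∃ s : ℝ, α = ![s * p, 0, 0] ∧ β = ![s * q, 0, 0]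
  · obtain ⟨s, rfl, rfl⟩ := hs
    have hw0 : w ≠ 0 := by
      rintro rfl
      refine hv ⟨s, Prod.ext ?_ (Prod.ext ?_ (by simp))⟩ <;>
      · ext i
        fin_cases i <;> simp
    have h0 : coeffForm (f · 0) (g · 0) (h · 0) ![s * p, 0, 0] ![s * q, 0, 0] ![s * p, 0, 0]
        ![s * q, 0, 0] = 0 := by
      simp only [coeffForm, Fin.sum_univ_three, Matrix.cons_val]
      linear_combination s ^ 2 * p * h1 + s ^ 2 * q * h2
    rw [h0, zero_add]
    exact Complex.normSq_pos.2 hw0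
  · have := hpos α β hs
    rw [hc]
    exact add_pos_of_pos_of_nonneg this (Complex.normSq_nonneg w)

namespace Tube

variable {M : Type*} [TopologicalSpace M] [ChartedSpace (EuclideanSpace ℝ (Fin 7)) M]
  [MulAction G M] [ContMDiffSMul IG (𝓡 7) ∞ G M] {H K : Subgroup G} {L : ℝ} {T : Tube M H K L}
  {p q d : ℤ}

theorem HasRotation.vecAt_zero_smul_slope (hrot : T.HasRotation p q d) (hL : 0 < L) (a : G)
    (s : ℝ) : T.vecAt a 0 (s • (Pi.single 0 (p : ℝ), Pi.single 0 (q : ℝ), 0)) = 0 := by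
  rw [vecAt_apply, map_smul, hrot.vec_zero_slope hL, smul_zero, map_zero]

variable [T2Space M] [IsManifold (𝓡 7) ∞ M]

set_option synthInstance.maxHeartbeats 200000 in
/-- Sufficiency of the conditions. -/
theorem HasRotation.exists_smoothMetric (hL : 0 < L) (hrot : T.HasRotation p q d) (hd : d ≠ 0)
    {m : PointwiseMetric M} (hm : m.SmoothOn T.singularOrbitᶜ)
    (hinv : m.InvariantOn T.singularOrbitᶜ) (hnormal : T.IsNormal m) (hdiag : T.IsDiagonal m)
    {f g h : Fin 3 → ℝ → ℝ}
    (hfgh : ∀ t ∈ Ioo 0 L, T.HasCoefficients t (m.inner (T.curve t)) f g h)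
    (hpos : ∀ α β : Fin 3 → ℝ,
      (¬ ∃ s : ℝ, α = ![s * p, 0, 0] ∧ β = ![s * q, 0, 0]) →
        0 < ∑ i, (f i 0 * α i ^ 2 + 2 * h i 0 * (α i * β i) + g i 0 * β i ^ 2))
    (h1 : p * f 0 0 = -(q * h 0 0)) (h2 : q * g 0 0 = -(p * h 0 0))
    {P : ℂ → (Fin 3 → ℝ) × (Fin 3 → ℝ) × ℂ → (Fin 3 → ℝ) × (Fin 3 → ℝ) × ℂ → ℝ}
    (hP : ∀ v v', ContDiffOn ℝ ∞ (fun z => P z v v') (Metric.ball 0 L))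
    (hrotP : ∀ r ∈ Ioo 0 L, ∀ θ v v', P (Complex.exp ((d * θ : ℝ) * Complex.I) * r)
      (rotateVec p q d θ v) (rotateVec p q d θ v') = polarForm p q d f g h r v v')
    (hP0 : ∀ v v', P 0 v v' = coeffForm (f · 0) (g · 0) (h · 0) v.1 v.2.1 v'.1 v'.2.1
        + (v.2.2 * (starRingEnd ℂ) v'.2.2).re) :
    ∃ S : SmoothMetric M, (∀ x ∈ T.singularOrbitᶜ, S.inner x = m.inner x) ∧
      T.HasCoefficients 0 (S.inner (T.curve 0)) f g h := by
  have h0 := Metric.mem_ball_self (x := (0 : ℂ)) hL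
  have hPm : ∀ a : G, ∀ z ∈ Metric.ball (0 : ℂ) L, z ≠ 0 → ∀ v v',
      FormFamily.eval m.inner (a • T.slice z) (T.vecAt a z v) (T.vecAt a z v') = P z v v' := by
    intro a z hz hz0 v v'
    rw [hinv.eval_vecAt a hz hz0, hrot.form_eq hd hinv hnormal hdiag hfgh hrotP hz hz0]
  obtain ⟨n, hn, hnm, hnP⟩ := T.exists_smooth_extension hL hm hP hPm
  have hsymm : ∀ (x : M) (v w : EuclideanSpace ℝ (Fin 7)), n.eval x v w = n.eval x w v := by
    intro x v w
    by_cases hx : x ∈ T.singularOrbit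
    · obtain ⟨a, rfl⟩ := hx
      simp only [curve, Complex.ofReal_zero]
      obtain ⟨u, rfl⟩ := T.vecAt_surjective a h0 v
      obtain ⟨u', rfl⟩ := T.vecAt_surjective a h0 w
      rw [hnP, hnP, hP0, hP0, coeffForm_symm]
      simp
      ring
    · have e : n.eval x = FormFamily.eval m.inner x := hnm x hx
      rw [e]
      exact m.symm x v w
  have hposn : ∀ (x : M) (v : EuclideanSpace ℝ (Fin 7)), v ≠ 0 → 0 < n.eval x v v := by
    intro x v hv
    by_cases hx : x ∈ T.singularOrbit
    · obtain ⟨a, rfl⟩ := hx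
      simp only [curve, Complex.ofReal_zero]
      obtain ⟨u, rfl⟩ := T.vecAt_surjective a h0 v
      rw [hnP, hP0]
      -- The excluded multiples of `pX₁ + qY₁` represent the zero tangent vector on the singular
      -- orbit.
      refine coeffForm_add_pos hpos h1 h2 u ?_
      rintro ⟨s, rfl⟩
      exact hv (hrot.vecAt_zero_smul_slope hL a s)
    · have e : n.eval x = FormFamily.eval m.inner x := hnm x hx
      rw [e]
      exact m.pos x v hv
  refine ⟨{ inner := n, symm := hsymm, pos := hposn,
            isVonNBounded := fun x => isVonNBounded_of_pos (n.eval x) (hposn x),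
            contMDiff := hn }, hnm, ?_⟩
  have hform : ∀ v v', T.form n 0 v v' = P 0 v v' := by
    intro v v'
    have h3 := hnP 1 v v'
    rwa [T.vecAt_one, T.vecAt_one, FormFamily.eval_congr n (one_smul G _)] at h3
  refine T.hasCoefficients_zero_iff.2 fun i => ?_
  simp only [hform, hP0]
  fin_cases i <;> simp [coeffForm, Fin.sum_univ_three]

end Tube

end CohomOne

/-! ### The smoothness criterion -/

theorem mainTheorem5
    (p q : ℤ) (hpq : IsCoprime p q)
    (H K : Subgroup CohomOne.G) (hH : (H : Set CohomOne.G).Finite)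
    (hK : (K : Set CohomOne.G) = CohomOne.slopeCircle p q * (H : Set CohomOne.G))
    (k : ℕ) (hk : k = ((H : Set CohomOne.G) ∩ CohomOne.slopeCircle p q).ncard)
    {M : Type*} [TopologicalSpace M] [T2Space M]
    [ChartedSpace (EuclideanSpace ℝ (Fin 7)) M] [IsManifold (𝓡 7) ∞ M]
    [MulAction CohomOne.G M] [ContMDiffSMul CohomOne.IG (𝓡 7) ∞ CohomOne.G M]
    (L : ℝ) (hL : 0 < L) (T : CohomOne.Tube M H K L)
    -- the metric on the complement of the singular orbit; its values on that orbit play no role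
    (metric : CohomOne.PointwiseMetric M)
    (hsmooth : metric.SmoothOn T.singularOrbitᶜ)
    (hinv : metric.InvariantOn T.singularOrbitᶜ)
    (hnormal : T.IsNormal metric) (hdiag : T.IsDiagonal metric)
    -- the functions describing it, extended to `t = 0`
    (f g h : Fin 3 → ℝ → ℝ)
    (hfgh : ∀ t ∈ Ioo 0 L, T.HasCoefficients t (metric.inner (T.curve t)) f g h)
    -- at `t = 0` they are positive on the vectors of the Lie algebra outside that of `K`
    (hpos : ∀ α β : Fin 3 → ℝ,
      (¬ ∃ s : ℝ, α = ![s * p, 0, 0] ∧ β = ![s * q, 0, 0]) →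
        0 < ∑ i, (f i 0 * α i ^ 2 + 2 * h i 0 * (α i * β i) + g i 0 * β i ^ 2)) :
    (∃ smoothMetric : CohomOne.SmoothMetric M,
        (∀ x ∈ T.singularOrbitᶜ, smoothMetric.inner x = metric.inner x) ∧
        T.HasCoefficients 0 (smoothMetric.inner (T.curve 0)) f g h) ↔
      -- the collapsing functions
      ((CohomOne.IsEvenAtZero L (f 0) ∧ CohomOne.IsEvenAtZero L (g 0) ∧
          CohomOne.IsEvenAtZero L (h 0)) ∧
        (p * f 0 0 = -(q * h 0 0) ∧ q * g 0 0 = -(p * h 0 0)) ∧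
        (p ^ 2 * CohomOne.secondDerivAtZero L (f 0) + q ^ 2 * CohomOne.secondDerivAtZero L (g 0)
          + 2 * p * q * CohomOne.secondDerivAtZero L (h 0) = 2 * k ^ 2)) ∧
      -- the remaining functions
      (CohomOne.IsPowTimesEven L 0 k (fun t => f 1 t + f 2 t) ∧
        CohomOne.IsPowTimesEven L (4 * p.natAbs) k (fun t => f 1 t - f 2 t) ∧
        CohomOne.IsPowTimesEven L 0 k (fun t => g 1 t + g 2 t) ∧
        CohomOne.IsPowTimesEven L (4 * q.natAbs) k (fun t => g 1 t - g 2 t) ∧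
        CohomOne.IsPowTimesEven L (2 * (q - p).natAbs) k (fun t => h 1 t + h 2 t) ∧
        CohomOne.IsPowTimesEven L (2 * (q + p).natAbs) k (fun t => h 1 t - h 2 t)) := by
  obtain ⟨d, hd, hdk, hrep⟩ := CohomOne.exists_rep_slopeExp hpq hH hK T.rep T.continuous_rep
    T.rep_one_eq_iff
  rw [← hk] at hdk
  have hrot : T.HasRotation p q d := fun θ z hz => by
    rw [← hrep θ z]
    exact T.slice_rep _ z hz
  -- The sign of the rotation number is immaterial: the conditions involve only `d²` and `|d| = k`.
  have hkd : (k : ℝ) ^ 2 = (d : ℝ) ^ 2 := by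
    rw [← hdk, Nat.cast_natAbs, Int.cast_abs, sq_abs]
  rw [hkd]
  subst hdk
  constructor
  · rintro ⟨S, hS, hS0⟩
    obtain ⟨h1, ⟨h2, h3⟩, h4⟩ := hrot.conditions_of_smoothMetric hL hd hinv hnormal hdiag hfgh S
      hS hS0
    exact ⟨⟨h2, h1, h3⟩, h4⟩
  · rintro ⟨⟨⟨hf, hg, hh⟩, ⟨h1, h2⟩, h3⟩, hf1, hf2, hg1, hg2, hh1, hh2⟩
    obtain ⟨P, hP, hrotP, hP0⟩ := CohomOne.exists_smooth_form hL hd hf hg hh h1 h2 h3 hf1 hf2 hg1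
      hg2 hh1 hh2
    exact hrot.exists_smoothMetric hL hd hsmooth hinv hnormal hdiag hfgh hpos h1 h2 hP hrotP hP0
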